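/- Let $d\ge 1$, $V=\mathbb{R}^d$ with the metric $\eta=\mathrm{diag}(1,\dots,1,-1)$ of signature $(d-1,1)$ ($x^d$ is the time coordinate), and let $\mathbb{U}_r=V^{\otimes r}$ ($r\ge 0$) carry the natural action of $GL(d)$ and the metric $\eta_{(a)(b)}=\eta_{a_1b_1}\cdots\eta_{a_rb_r}$. Let $GL(d-1)\subset GL(d)$ be the subgroup acting on the first $d-1$ coordinates and fixing the last one. For a Young diagram $\lambda$ with $m$ boxes, a representation of $GL(k)$ is said to have type $\lambda$ if it is equivalent to the image in $(\mathbb{R}^k)^{\otimes m}$ of the Young symmetrizer $\sum_{p}p\,\sum_{q}\mathrm{sgn}(q)\,q$ of a tableau of shape $\lambda$ ($p$, $q$ run over the row- and column-preserving permutations). 1. The metric $\eta_{(a)(b)}$ is non-degenerate on $\mathbb{U}_r$, with signature $n_\pm=\tfrac12\left(d^r\pm(d-2)^r\right)$ (where $0^0=1$). 2. For every tableau with $r$ boxes and at most $d$ rows, the image of its Young symmetrizer in $\mathbb{U}_r$ is an irreducible $GL(d)$-representation. 3. Let $\mathbb{V}\subseteq\mathbb{U}_r$ be any irreducible $GL(d)$-invariant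 subspace. Then $\eta_{(a)(b)}$ restricted to $\mathbb{V}$ is non-degenerate, and $\mathbb{V}$ has type $\lambda$ for exactly one Young diagram $\lambda$; this $\lambda$ has $r$ boxes and at most $d$ rows. Let $B(\lambda)$ be the set of diagrams $\mu$ with at most $d-1$ rows that arise from $\lambda$ by removing one box from the bottom of some (possibly none or all) of the columns of $\lambda$. Then there is a decomposition $$\mathbb{V}=\bigoplus_{\mu\in B(\lambda)}\mathbb{W}_\mu$$ into $GL(d-1)$-invariant subspaces such that $\mathbb{W}_\mu$ is irreducible under $GL(d-1)$ of type $\mu$, the $\mathbb{W}_\mu$ are pairwise orthogonal under $\eta_{(a)(b)}$, and $(-1)^{|\lambda|-|\mu|}\eta_{(a)(b)}$ is positive definite on $\mathbb{W}_\mu$. The signature of $\eta_{(a)(b)}$ on $\mathbb{V}$ is $$n_+=\sum_{\mu\in B(\lambda),\ |\lambda|-|\mu|\text{ even}}\dim\mathbb{W}_\mu,\qquad n_-=\sum_{\mu\in B(\lambda),\ |\lambda|-|\mu|\text{ odd}}\dim\mathbb{W}_\mu .$$ 4. For $d=4$ and $r\le5$ the signature $(n_+,n_-)$ of an irreducible $\mathbb{V}$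 of type $\lambda$ is: $\emptyset$: $(1,0)$; $\{1\}$: $(3,1)$; $\{2\}$: $(7,3)$; $\{1,1\}$: $(3,3)$; $\{3\}$: $(13,7)$; $\{2,1\}$: $(11,9)$; $\{1,1,1\}$: $(1,3)$; $\{4\}$: $(22,13)$; $\{3,1\}$: $(24,21)$; $\{2,2\}$: $(12,8)$; $\{2,1,1\}$: $(6,9)$; $\{1,1,1,1\}$: $(0,1)$; $\{5\}$: $(34,22)$; $\{4,1\}$: $(45,39)$; $\{3,2\}$: $(33,27)$; $\{3,1,1\}$: $(15,21)$; $\{2,2,1\}$: $(11,9)$; $\{2,1,1,1\}$: $(1,3)$; and these are the only types that occur. -/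

import Mathlib

open scoped TensorProduct

noncomputable section

namespace TensorSignature

/-- The natural action of `GL(V)` on the space `⨂[ℝ]^r V` of contravariant tensors of rank `r`:
`g` acts on every tensor factor. -/
def tensorRep (V : Type*) [AddCommGroup V] [Module ℝ V] (r : ℕ) :
    Representation ℝ (LinearMap.GeneralLinearGroup ℝ V) (⨂[ℝ]^r V) where
  toFun g := PiTensorProduct.map fun _ => (g : V →ₗ[ℝ] V)
  map_one' := PiTensorProduct.map_id
  map_mul' g h := PiTensorProduct.map_mul (fun _ => (g : V →ₗ[ℝ] V)) (fun _ => (h : V →ₗ[ℝ] V))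

/-- A permutation of the tensor indices:
`v₁ ⊗ ⋯ ⊗ vᵣ` goes to the tensor product of the `v_(σ⁻¹ i)`. -/
def permAct (V : Type*) [AddCommGroup V] [Module ℝ V] {r : ℕ} (σ : Equiv.Perm (Fin r)) :
    Module.End ℝ (⨂[ℝ]^r V) :=
  (PiTensorProduct.reindex ℝ (fun _ : Fin r => V) σ).toLinearMap

/-- The Young symmetrizer `(∑ p) (∑ sgn(q) q)` of a tableau `T` (a filling of the boxes of `lam`
with the tensor indices), where `p` runs over the permutations preserving the rows of `T` and `q`
over those preserving its columns. Its normalization is irrelevant for its image. -/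
def youngSymmetrizer (V : Type*) [AddCommGroup V] [Module ℝ V] {lam : YoungDiagram} {r : ℕ}
    (T : lam.cells ≃ Fin r) : Module.End ℝ (⨂[ℝ]^r V) :=
  (∑ p : Equiv.Perm (Fin r) with
      ∀ i, (T.symm (p i) : ℕ × ℕ).1 = (T.symm i : ℕ × ℕ).1, permAct V p) *
  (∑ q : Equiv.Perm (Fin r) with
      ∀ i, (T.symm (q i) : ℕ × ℕ).2 = (T.symm i : ℕ × ℕ).2,
        ((Equiv.Perm.sign q : ℤ) : ℝ) • permAct V q)

theorem tensorRep_mul_permAct (V : Type*) [AddCommGroup V] [Module ℝ V] {r : ℕ}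
    (g : LinearMap.GeneralLinearGroup ℝ V) (σ : Equiv.Perm (Fin r)) :
    tensorRep V r g * permAct V σ = permAct V σ * tensorRep V r g := by
  refine PiTensorProduct.ext ?_
  ext v
  simp [tensorRep, permAct, PiTensorProduct.reindex_tprod, PiTensorProduct.map_tprod]

theorem tensorRep_mul_youngSymmetrizer (V : Type*) [AddCommGroup V] [Module ℝ V]
    {lam : YoungDiagram} {r : ℕ} (T : lam.cells ≃ Fin r)
    (g : LinearMap.GeneralLinearGroup ℝ V) :
    tensorRep V r g * youngSymmetrizer V T = youngSymmetrizer V T * tensorRep V r g := by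
  refine Commute.mul_right ?_ ?_
  · exact Commute.sum_right _ _ _ fun p _ => tensorRep_mul_permAct V g p
  · exact Commute.sum_right _ _ _ fun q _ =>
      Commute.smul_right (tensorRep_mul_permAct V g q) _

/-- The `GL(V)`-invariant space of all tensors of the symmetry type given by the tableau `T`:
the image of its Young symmetrizer. -/
def youngSubrep (V : Type*) [AddCommGroup V] [Module ℝ V] {lam : YoungDiagram} {r : ℕ}
    (T : lam.cells ≃ Fin r) : Subrepresentation (tensorRep V r) where
  toSubmodule := LinearMap.range (youngSymmetrizer V T)
  apply_mem_toSubmodule g := by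
    rintro _ ⟨F, rfl⟩
    exact ⟨tensorRep V r g F, (LinearMap.congr_fun (tensorRep_mul_youngSymmetrizer V T g) F).symm⟩

/-- A representation of `GL(V)` has symmetry type (Young diagram) `lam` if it is equivalent to the
space of tensors cut out by the Young symmetrizer of a tableau of shape `lam`. -/
def HasShape {V W : Type*} [AddCommGroup V] [Module ℝ V] [AddCommMonoid W] [Module ℝ W]
    (ρ : Representation ℝ (LinearMap.GeneralLinearGroup ℝ V) W) (lam : YoungDiagram) : Prop :=
  ∃ T : lam.cells ≃ Fin lam.card, Nonempty (ρ.Equiv (youngSubrep V T).toRepresentation)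

/-- The space `V = ℝ^d`, `d = n + 1`: the first component of a pair holds the space coordinates
`x^1, …, x^(d-1)`, the second one is the time coordinate `x^d`. -/
abbrev Spacetime (n : ℕ) : Type := (Fin n → ℝ) × ℝ

/-- The metric `η_ab`, of signature `(d - 1, 1)`: `η(v, w) = ∑ i, v_i w_i - v_d w_d`. -/
def eta (n : ℕ) : LinearMap.BilinForm ℝ (Spacetime n) :=
  LinearMap.mk₂ ℝ (fun v w => ∑ i, v.1 i * w.1 i - v.2 * w.2)
    (fun v v' w => by simp [add_mul, Finset.sum_add_distrib]; ring)
    (fun c v w => by simp [mul_assoc, Finset.mul_sum, mul_sub])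
    (fun v w w' => by simp [mul_add, Finset.sum_add_distrib]; ring)
    (fun c v w => by simp [mul_left_comm, Finset.mul_sum, mul_sub])

/-- The metric `η_(a)(b) = η_(a₁b₁) ⋯ η_(aᵣbᵣ)` on tensors of rank `r`. -/
def tensorMetric (n r : ℕ) : LinearMap.BilinForm ℝ (⨂[ℝ]^r (Spacetime n)) :=
  PiTensorProduct.dualDistrib ∘ₗ PiTensorProduct.map fun _ => eta n

theorem tensorMetric_tprod (n r : ℕ) (v w : Fin r → Spacetime n) :
    tensorMetric n r (PiTensorProduct.tprod ℝ v) (PiTensorProduct.tprod ℝ w) =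
      ∏ i, eta n (v i) (w i) := by
  simp [tensorMetric]

/-- The tensor norm `F ↦ η_(a)(b) F^(a) F^(b)`. -/
def tensorNorm (n r : ℕ) : QuadraticForm ℝ (⨂[ℝ]^r (Spacetime n)) :=
  LinearMap.BilinMap.toQuadraticMap (tensorMetric n r)

/-- The signature `(n₊, n₋)` of the tensor norm restricted to a space `V` of tensors. -/
def signature (n r : ℕ) (V : Submodule ℝ (⨂[ℝ]^r (Spacetime n))) : ℕ × ℕ :=
  let Q : QuadraticForm ℝ V := (tensorNorm n r).restrict V
  (sigPos (R := ℝ) (M := V) Q, sigNeg (R := ℝ) (M := V) Q)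

/-- The embedding of `GL(d - 1)` into `GL(d)` as the group of purely spatial transformations. -/
def spatial (n : ℕ) : LinearMap.GeneralLinearGroup ℝ (Fin n → ℝ) →*
    LinearMap.GeneralLinearGroup ℝ (Spacetime n) :=
  Units.map
    { toFun := fun A => A.prodMap LinearMap.id
      map_one' := LinearMap.prodMap_id
      map_mul' := fun _ _ => rfl }

/-- The tensors of rank `r` as a representation of `GL(d - 1)`. -/
def spatialRep (n r : ℕ) : Representation ℝ (LinearMap.GeneralLinearGroup ℝ (Fin n → ℝ))
    (⨂[ℝ]^r (Spacetime n)) :=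
  (tensorRep (Spacetime n) r).comp (spatial n)

/-- `mu` arises from `lam` by removing one box from the bottom of some (or none, or all) of the
columns, and has at most `n` rows. -/
def IsBranch (n : ℕ) (lam mu : YoungDiagram) : Prop :=
  mu ≤ lam ∧ (∀ j, lam.colLen j ≤ mu.colLen j + 1) ∧ mu.colLen 0 ≤ n

theorem finite_isBranch (n : ℕ) (lam : YoungDiagram) : {mu | IsBranch n lam mu}.Finite := by
  refine Set.Finite.of_finite_image (f := YoungDiagram.cells)
    ((Finset.finite_toSet lam.cells.powerset).subset ?_) fun a _ b _ h => YoungDiagram.ext h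
  rintro _ ⟨mu, h, rfl⟩
  simpa using h.1

/-- The diagrams of the pieces of a `GL(n + 1)`-irreducible space of type `lam` under `GL(n)`. -/
def branches (n : ℕ) (lam : YoungDiagram) : Finset YoungDiagram :=
  (finite_isBranch n lam).toFinset

/-- The values `(n₊, n₋)` for `d = 4` and rank at most `5`, by the row lengths of the diagram. -/
def generalTable : List (List ℕ × ℕ × ℕ) :=
  [([], 1, 0),
   ([1], 3, 1),
   ([2], 7, 3), ([1, 1], 3, 3),
   ([3], 13, 7), ([2, 1], 11, 9), ([1, 1, 1], 1, 3),
   ([4], 22, 13), ([3, 1], 24, 21), ([2, 2], 12, 8), ([2, 1, 1], 6, 9), ([1, 1, 1, 1], 0, 1),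
   ([5], 34, 22), ([4, 1], 45, 39), ([3, 2], 33, 27), ([3, 1, 1], 15, 21), ([2, 2, 1], 11, 9),
   ([2, 1, 1, 1], 1, 3)]

end TensorSignature

end

/-! A space of tensors stable under the group is stable under the operators `E_ij`, the matrix units
summed over the tensor factors: they are the linear coefficients in `t` of the action of `1 + t
E_ij`. For the Euclidean product in which words in a basis are orthonormal, `E_ij` and `E_ji` are
adjoint, so stable spaces have stable complements. Nonzero stable spaces contain highest weight
vectors (`exists_hw_vector`). Hence a stable space whose highest weight vectors lie on one line has
no stable subspaces besides zero and itself.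

Highest weight vectors are controlled by leading words. In colexicographic order the leading word of
a highest weight vector is a ballot word (`IsLeading.isBallot`), and every ballot word leads the
column antisymmetrization of a tableau word, so these antisymmetrized words span
(`hw_inf_wt_le_span`). Dominance of weights then leaves a single line of highest weight vectors in
the image of a Young symmetrizer, of weight equal to the row lengths (`hw_range`), so the image is
irreducible. Every irreducible invariant space is mapped isomorphically onto such an image
(`exists_youngSymmetrizer`), and the highest weight determines the diagram.

For the branching, a product of the commuting operators that replace a time index by a space index
carries a `GL(d-1)` highest weight vector of the image to a multiple of the `GL(d)` one. So its
weight determines it up to a factor (`branch_unique`). The same argument with time ordered first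
shows that its weight interlaces with the diagram (`branch_bounds`). Conversely each branch `mu`
occurs: a spatial tensor of type `mu` is put into the boxes of `mu`, the time vector into the
others, and the symmetrizer is applied (`branchMap_rowWord_ne_zero`).

The metric is the Euclidean product twisted by time reversal (`tensorMetric_eq_form`). Time reversal
belongs to `GL(d)` and acts on a piece with `k` time indices as `(-1)^k`. Non-degeneracy,
orthogonality of the pieces and their definiteness all follow from the corresponding Euclidean
facts. Branching also gives a recursion for the dimensions, from which the table is a finite
computation. -/

namespace TensorSignature

noncomputable section

open Module

/-! ### Operators acting on single tensor factors -/

variable {V V' : Type*} [AddCommGroup V] [Module ℝ V] [AddCommGroup V'] [Module ℝ V'] {r d : ℕ}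

/-- The operator on tensors acting as `A` on the `k`-th factor. -/
def siteOp (k : Fin r) : Module.End ℝ V →ₗ[ℝ] Module.End ℝ (⨂[ℝ]^r V) :=
  (PiTensorProduct.mapMultilinear ℝ (fun _ : Fin r => V) fun _ => V).toLinearMap
    (fun _ => LinearMap.id) k

theorem siteOp_tprod (k : Fin r) (A : Module.End ℝ V) (v : Fin r → V) :
    siteOp k A (PiTensorProduct.tprod ℝ v) =
      PiTensorProduct.tprod ℝ (Function.update v k (A (v k))) := by
  simp only [siteOp, MultilinearMap.toLinearMap_apply, PiTensorProduct.mapMultilinear_apply,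
    PiTensorProduct.map_tprod]
  congr 1
  ext l
  by_cases h : l = k
  · subst h; simp
  · simp [h]

theorem siteOp_mul_same (k : Fin r) (A B : Module.End ℝ V) :
    siteOp k A * siteOp k B = siteOp k (A * B) := by
  refine PiTensorProduct.ext ?_
  ext v
  simp [siteOp_tprod]

theorem siteOp_commute {k l : Fin r} (h : k ≠ l) (A B : Module.End ℝ V) :
    siteOp k A * siteOp l B = siteOp l B * siteOp k A := by
  refine PiTensorProduct.ext ?_
  ext v
  simp [siteOp_tprod, h, h.symm, Function.update_comm h]

/-- The sum over the tensor factors in `K` of the operators acting as `A` on one factor. -/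
def sumOp (K : Finset (Fin r)) : Module.End ℝ V →ₗ[ℝ] Module.End ℝ (⨂[ℝ]^r V) :=
  ∑ k ∈ K, siteOp k

theorem sumOp_apply (K : Finset (Fin r)) (A : Module.End ℝ V) :
    sumOp K A = ∑ k ∈ K, siteOp k A := by
  simp [sumOp]

/-- Operators on different factors commute, so only the terms with equal indices survive. An
arbitrary set `K` of factors is allowed because the ballot property below uses these relations on
initial segments. -/
theorem sumOp_lie (K : Finset (Fin r)) (A B : Module.End ℝ V) :
    sumOp K A * sumOp K B - sumOp K B * sumOp K A = sumOp K (A * B - B * A) := by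
  simp only [sumOp_apply, map_sub, Finset.sum_mul_sum]
  have h : ∑ i ∈ K, ∑ j ∈ K, siteOp i B * siteOp j A = ∑ j ∈ K, ∑ i ∈ K, siteOp i B * siteOp j A :=
    Finset.sum_comm
  rw [h, ← Finset.sum_sub_distrib, ← Finset.sum_sub_distrib]
  refine Finset.sum_congr rfl fun k hk => ?_
  rw [← Finset.sum_sub_distrib, Finset.sum_eq_single k]
  · simp [siteOp_mul_same]
  · intro l _ hl
    rw [siteOp_commute (V := V) hl.symm, sub_self]
  · exact fun h => absurd hk h

theorem permAct_tprod (σ : Equiv.Perm (Fin r)) (v : Fin r → V) :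
    permAct V σ (PiTensorProduct.tprod ℝ v) = PiTensorProduct.tprod ℝ fun i => v (σ.symm i) := by
  simp [permAct, PiTensorProduct.reindex_tprod]

theorem permAct_mul (σ τ : Equiv.Perm (Fin r)) :
    permAct V σ * permAct V τ = permAct V (σ * τ) := by
  refine PiTensorProduct.ext ?_
  ext v
  simp [permAct_tprod, Equiv.Perm.mul_def]

theorem permAct_mul_siteOp (σ : Equiv.Perm (Fin r)) (k : Fin r) (A : Module.End ℝ V) :
    permAct V σ * siteOp k A = siteOp (σ k) A * permAct V σ := by
  refine PiTensorProduct.ext ?_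
  ext v
  simp only [LinearMap.compMultilinearMap_apply, Module.End.mul_apply, siteOp_tprod, permAct_tprod]
  congr 1
  ext l
  by_cases h : l = σ k
  · subst h
    rw [Function.update_self, Equiv.symm_apply_apply, Function.update_self]
  · have : σ.symm l ≠ k := fun h' => h (by simp [← h'])
    simp [h, this]

theorem permAct_mul_sumOp (σ : Equiv.Perm (Fin r)) (A : Module.End ℝ V) :
    permAct V σ * sumOp Finset.univ A = sumOp Finset.univ A * permAct V σ := by
  simp only [sumOp_apply, Finset.mul_sum, Finset.sum_mul, permAct_mul_siteOp]
  exact Equiv.sum_comp σ fun k => siteOp k A * permAct V σ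

/-! ### Expansion of the group action in one parameter -/

/-- The tensor power of `1 + t A` expands over the sets of factors on which `t A` is chosen; the
sets of size `j` form the coefficient of `t ^ j`, and the singletons give the derivation. The range
`r + 2` contains the exponent 1 even for `r = 0`. -/
theorem exists_expansion (r : ℕ) (A : Module.End ℝ V) :
    ∃ y : ℕ → Module.End ℝ (⨂[ℝ]^r V), y 1 = sumOp Finset.univ A ∧
      ∀ t : ℝ, PiTensorProduct.map (fun _ => (1 : Module.End ℝ V) + t • A) =
        ∑ j ∈ Finset.range (r + 2), t ^ j • y j := by
  classical
  let M := PiTensorProduct.mapMultilinear ℝ (fun _ : Fin r => V) fun _ => V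
  refine ⟨fun j => ∑ s : Finset (Fin r) with s.card = j,
    M (s.piecewise (fun _ => A) fun _ => 1), ?_, fun t => ?_⟩
  · rw [sumOp_apply]
    symm
    refine Finset.sum_bij (fun k _ => {k}) (by simp) (by simp) ?_ ?_
    · intro s hs
      obtain ⟨a, rfl⟩ := Finset.card_eq_one.1 (Finset.mem_filter.1 hs).2
      exact ⟨a, by simp⟩
    · intro k _
      rw [siteOp, MultilinearMap.toLinearMap_apply, Finset.piecewise_singleton]
      rfl
  · have h := M.map_add_univ (fun _ => t • A) (fun _ => 1)
    have h2 : PiTensorProduct.map (fun _ => (1 : Module.End ℝ V) + t • A) =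
        M ((fun _ => t • A) + fun _ => 1) := by
      simp only [M, PiTensorProduct.mapMultilinear_apply]
      congr 1
      ext i : 1
      simp [add_comm]
    rw [h2, h]
    have h3 : ∀ s : Finset (Fin r), M (s.piecewise (fun _ => t • A) fun _ => 1) =
        t ^ s.card • M (s.piecewise (fun _ => A) fun _ => 1) := by
      intro s
      have := M.map_piecewise_smul (fun _ => t) (s.piecewise (fun _ => A) fun _ => 1) s
      rw [Finset.prod_const] at this
      rw [← this]
      congr 1
      ext i : 1
      by_cases hi : i ∈ s <;> simp [hi]
    simp only [h3, Finset.smul_sum]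
    rw [← Finset.sum_fiberwise_of_maps_to (s := Finset.univ) (t := Finset.range (r + 2))
      (g := Finset.card)]
    · refine Finset.sum_congr rfl fun j _ => Finset.sum_congr rfl fun s hs => ?_
      rw [(Finset.mem_filter.1 hs).2]
    · intro s _
      have := s.card_le_univ
      simp at this ⊢
      omega

/-- Modulo `S`, every linear functional turns the sum into a real polynomial with infinitely many
roots. -/
theorem coeff_mem_of_infinite {M : Type*} [AddCommGroup M] [Module ℝ M] (S : Submodule ℝ M)
    (N : ℕ) (y : ℕ → M) {s : Set ℝ} (hs : s.Infinite)
    (h : ∀ t ∈ s, ∑ j ∈ Finset.range N, t ^ j • y j ∈ S) : ∀ j < N, y j ∈ S := by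
  intro j hj
  rw [← Submodule.Quotient.mk_eq_zero, ← Module.forall_dual_apply_eq_zero_iff ℝ]
  intro φ
  let p : Polynomial ℝ :=
    ∑ j ∈ Finset.range N, Polynomial.monomial j (φ (Submodule.Quotient.mk (y j)))
  have hp : p = 0 := by
    refine Polynomial.eq_zero_of_infinite_isRoot p (hs.mono fun t ht => ?_)
    have := (Submodule.Quotient.mk_eq_zero S).2 (h t ht)
    have h2 := congrArg φ this
    rw [← Submodule.mkQ_apply] at h2
    simp only [map_sum, map_smul, Submodule.mkQ_apply, map_zero, smul_eq_mul] at h2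
    simp only [p, Set.mem_ofPred_eq, Polynomial.IsRoot.def, Polynomial.eval_finsetSum,
      Polynomial.eval_monomial]
    rw [← h2]
    exact Finset.sum_congr rfl fun _ _ => mul_comm _ _
  have := congrArg (fun q => Polynomial.coeff q j) hp
  simpa [p, Polynomial.finsetSum_coeff, Polynomial.coeff_monomial, hj] using this

/-- A space stable under the group elements `1 + t A` (acting on two tensor powers at once) is
stable under the infinitesimal action of `A`. -/
theorem sumOp_mem_of_map_mem {r' : ℕ} (Γ : Submodule ℝ ((⨂[ℝ]^r V) × (⨂[ℝ]^r' V')))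
    (A : Module.End ℝ V) (A' : Module.End ℝ V') {s : Set ℝ} (hs : s.Infinite)
    (h : ∀ t ∈ s, ∀ x ∈ Γ, (PiTensorProduct.map (fun _ => (1 : Module.End ℝ V) + t • A) x.1,
      PiTensorProduct.map (fun _ => (1 : Module.End ℝ V') + t • A') x.2) ∈ Γ) :
    ∀ x ∈ Γ, (sumOp Finset.univ A x.1, sumOp Finset.univ A' x.2) ∈ Γ := by
  intro x hx
  obtain ⟨y, hy1, hy⟩ := exists_expansion r A
  obtain ⟨y', hy1', hy'⟩ := exists_expansion r' A'
  -- The two expansions have different lengths; both are padded with zeros to a common one. The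
  -- coefficient at exponent 1 is the claim.
  let z : ℕ → (⨂[ℝ]^r V) × (⨂[ℝ]^r' V') := fun j =>
    (if j < r + 2 then y j x.1 else 0, if j < r' + 2 then y' j x.2 else 0)
  have key := coeff_mem_of_infinite Γ (r + r' + 2) z hs (fun t ht => by
    have h0 := h t ht x hx
    rw [hy, hy'] at h0
    convert h0 using 1
    rw [Prod.ext_iff]
    constructor
    · rw [Prod.fst_sum]
      simp only [z, LinearMap.sum_apply, LinearMap.smul_apply, Prod.smul_fst]
      rw [← Finset.sum_subset (Finset.range_mono (by omega : r + 2 ≤ r + r' + 2))]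
      · refine Finset.sum_congr rfl fun j hj => ?_
        rw [if_pos (Finset.mem_range.1 hj)]
      · intro j _ hj
        rw [if_neg (by simpa using hj), smul_zero]
    · rw [Prod.snd_sum]
      simp only [z, LinearMap.sum_apply, LinearMap.smul_apply, Prod.smul_snd]
      rw [← Finset.sum_subset (Finset.range_mono (by omega : r' + 2 ≤ r + r' + 2))]
      · refine Finset.sum_congr rfl fun j hj => ?_
        rw [if_pos (Finset.mem_range.1 hj)]
      · intro j _ hj
        rw [if_neg (by simpa using hj), smul_zero]) 1 (by omega)
  simpa [z, hy1, hy1'] using key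

/-! ### Coordinates -/

variable (b : Basis (Fin d) ℝ V)

/-- The coordinates of a tensor in the basis of products of vectors of `b`. -/
def coords : (⨂[ℝ]^r V) ≃ₗ[ℝ] ((Fin r → Fin d) → ℝ) :=
  (Basis.piTensorProduct fun _ => b).equivFun

/-- The product of basis vectors given by a word. -/
def word (w : Fin r → Fin d) : ⨂[ℝ]^r V := PiTensorProduct.tprod ℝ fun k => b (w k)

theorem coords_tprod (v : Fin r → V) (w : Fin r → Fin d) :
    coords b (PiTensorProduct.tprod ℝ v) w = ∏ k, b.repr (v k) (w k) := by
  simp [coords]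

theorem coords_word (w u : Fin r → Fin d) :
    coords b (word b w) u = if u = w then 1 else 0 := by
  simp [word, coords_tprod, Finsupp.single_apply, Fintype.prod_ite_zero, ← funext_iff, eq_comm]

theorem word_hom_ext {M : Type*} [AddCommGroup M] [Module ℝ M] {f g : (⨂[ℝ]^r V) →ₗ[ℝ] M}
    (h : ∀ w : Fin r → Fin d, f (word b w) = g (word b w)) : f = g :=
  (Basis.piTensorProduct fun _ => b).ext fun w => by simpa [word] using h w

theorem coords_ext {x y : ⨂[ℝ]^r V} (h : ∀ w, coords b x w = coords b y w) : x = y :=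
  (coords b).injective (funext h)

theorem exists_coords_ne_zero {x : ⨂[ℝ]^r V} (hx : x ≠ 0) : ∃ w, coords b x w ≠ 0 := by
  by_contra! h
  exact hx (coords_ext b fun w => by simp [h w])

theorem sum_coords_smul_word (x : ⨂[ℝ]^r V) : ∑ w, coords b x w • word b w = x := by
  refine coords_ext b fun w => ?_
  simp [coords_word]

theorem coords_permAct (σ : Equiv.Perm (Fin r)) (x : ⨂[ℝ]^r V) (w : Fin r → Fin d) :
    coords b (permAct V σ x) w = coords b x (w ∘ σ) := by
  have : (LinearMap.proj w ∘ₗ (coords b).toLinearMap) ∘ₗ permAct V σ =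
      LinearMap.proj (w ∘ σ) ∘ₗ (coords b).toLinearMap := by
    refine PiTensorProduct.ext ?_
    ext v
    simp only [LinearMap.compMultilinearMap_apply, LinearMap.comp_apply, permAct_tprod,
      LinearEquiv.coe_coe, LinearMap.proj_apply, coords_tprod]
    rw [← Equiv.prod_comp σ]
    refine Finset.prod_congr rfl fun k _ => ?_
    rw [Equiv.symm_apply_apply, Function.comp_apply]
  exact LinearMap.congr_fun this x

theorem permAct_word (σ : Equiv.Perm (Fin r)) (w : Fin r → Fin d) :
    permAct V σ (word b w) = word b (w ∘ σ.symm) := by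
  rw [word, permAct_tprod]; rfl

/-- The matrix unit `E_ij`: it maps `b j` to `b i`. -/
def unit (i j : Fin d) : Module.End ℝ V := (b.coord j).smulRight (b i)

theorem unit_apply_basis (i j k : Fin d) : unit b i j (b k) = if k = j then b i else 0 := by
  by_cases h : k = j
  · subst h; simp [unit]
  · simp [unit, h]

theorem unit_mul_unit (i j k l : Fin d) :
    unit b i j * unit b k l = if j = k then unit b i l else 0 := by
  refine b.ext fun m => ?_
  by_cases h : m = l
  · subst h
    by_cases hjk : j = k
    · subst hjk; simp [unit_apply_basis]
    · simp [unit_apply_basis, hjk, Ne.symm hjk]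
  · by_cases hjk : j = k <;> simp [unit_apply_basis, h, hjk]

theorem siteOp_word (k : Fin r) (i j : Fin d) (w : Fin r → Fin d) :
    siteOp k (unit b i j) (word b w) =
      if w k = j then word b (Function.update w k i) else 0 := by
  rw [word, siteOp_tprod, unit_apply_basis]
  split_ifs with h
  · rw [word]
    congr 1
    ext l
    by_cases hl : l = k
    · subst hl; simp
    · simp [hl]
  · exact MultilinearMap.map_update_zero _ _ _

theorem coords_siteOp (k : Fin r) (i j : Fin d) (x : ⨂[ℝ]^r V) (w : Fin r → Fin d) :
    coords b (siteOp k (unit b i j) x) w =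
      if w k = i then coords b x (Function.update w k j) else 0 := by
  have : (LinearMap.proj w ∘ₗ (coords b).toLinearMap) ∘ₗ siteOp k (unit b i j) =
      (if w k = i then (1 : ℝ) else 0) •
        LinearMap.proj (Function.update w k j) ∘ₗ (coords b).toLinearMap := by
    refine word_hom_ext b fun u => ?_
    simp only [LinearMap.comp_apply, siteOp_word, LinearEquiv.coe_coe, LinearMap.proj_apply,
      LinearMap.smul_apply, coords_word]
    by_cases h1 : u k = j
    · by_cases h2 : w k = i
      · have : (w = Function.update u k i) ↔ (Function.update w k j = u) := by
          constructor
          · rintro rfl; simp [← h1]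
          · rintro rfl; simp [← h2]
        simp [h1, h2, coords_word, this]
      · have : w ≠ Function.update u k i := by rintro rfl; simp at h2
        simp [h1, h2, coords_word, this]
    · have : Function.update w k j ≠ u := by rintro rfl; simp at h1
      simp [h1, this]
  have h := LinearMap.congr_fun this x
  simp only [LinearMap.comp_apply, LinearEquiv.coe_coe, LinearMap.proj_apply, LinearMap.smul_apply,
    smul_eq_mul, ite_mul, one_mul, zero_mul] at h
  exact h

theorem coords_sumOp (K : Finset (Fin r)) (i j : Fin d) (x : ⨂[ℝ]^r V) (w : Fin r → Fin d) :
    coords b (sumOp K (unit b i j) x) w =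
      ∑ k ∈ K, if w k = i then coords b x (Function.update w k j) else 0 := by
  simp [sumOp_apply, LinearMap.sum_apply, coords_siteOp]

theorem sumOp_unit_lie (K : Finset (Fin r)) (i j k l : Fin d) (x : ⨂[ℝ]^r V) :
    sumOp K (unit b i j) (sumOp K (unit b k l) x) =
      sumOp K (unit b k l) (sumOp K (unit b i j) x) +
        ((if j = k then sumOp K (unit b i l) x else 0) -
          if l = i then sumOp K (unit b k j) x else 0) := by
  have h := LinearMap.congr_fun (sumOp_lie K (unit b i j) (unit b k l)) x
  rw [unit_mul_unit, unit_mul_unit, map_sub] at h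
  simp only [LinearMap.sub_apply, Module.End.mul_apply] at h
  rw [sub_eq_iff_eq_add'] at h
  rw [h]
  congr 2
  · split_ifs <;> simp
  · split_ifs <;> simp

/-- The number of occurrences of a letter in a word. -/
def content (w : Fin r → Fin d) (i : Fin d) : ℕ := (Finset.univ.filter fun k => w k = i).card

theorem coords_sumOp_diag (K : Finset (Fin r)) (i : Fin d) (x : ⨂[ℝ]^r V) (w : Fin r → Fin d) :
    coords b (sumOp K (unit b i i) x) w = (K.filter fun k => w k = i).card * coords b x w := by
  rw [coords_sumOp, ← Finset.sum_filter, Finset.sum_congr rfl (g := fun _ => coords b x w)]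
  · simp
  · intro k hk
    rw [← (Finset.mem_filter.1 hk).2, Function.update_eq_self]

/-- The Euclidean scalar product for which the words are orthonormal. -/
def form : LinearMap.BilinForm ℝ (⨂[ℝ]^r V) :=
  LinearMap.mk₂ ℝ (fun x y => ∑ w, coords b x w * coords b y w)
    (fun x x' y => by simp [add_mul, Finset.sum_add_distrib])
    (fun c x y => by simp [mul_assoc, Finset.mul_sum])
    (fun x y y' => by simp [mul_add, Finset.sum_add_distrib])
    (fun c x y => by simp [mul_left_comm, Finset.mul_sum])

theorem form_apply (x y : ⨂[ℝ]^r V) : form b x y = ∑ w, coords b x w * coords b y w := rfl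

theorem form_comm (x y : ⨂[ℝ]^r V) : form b x y = form b y x := by
  simp [form_apply, mul_comm]

theorem form_self_pos {x : ⨂[ℝ]^r V} (hx : x ≠ 0) : 0 < form b x x := by
  obtain ⟨w, hw⟩ := exists_coords_ne_zero b hx
  exact Finset.sum_pos' (fun _ _ => mul_self_nonneg _) ⟨w, Finset.mem_univ _, mul_self_pos.2 hw⟩

theorem eq_zero_of_form_self {x : ⨂[ℝ]^r V} (hx : form b x x = 0) : x = 0 := by
  by_contra h
  exact (form_self_pos b h).ne' hx

theorem form_permAct (σ : Equiv.Perm (Fin r)) (x y : ⨂[ℝ]^r V) :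
    form b (permAct V σ x) y = form b x (permAct V σ⁻¹ y) := by
  simp only [form_apply, coords_permAct]
  rw [← (Equiv.arrowCongr σ (Equiv.refl (Fin d))).sum_comp]
  refine Finset.sum_congr rfl fun w _ => ?_
  have h : (Equiv.arrowCongr σ (Equiv.refl (Fin d))) w ∘ σ = w := by
    ext k
    simp [Equiv.arrowCongr]
  rw [h]
  rfl

theorem form_siteOp (k : Fin r) (i j : Fin d) (x y : ⨂[ℝ]^r V) :
    form b (siteOp k (unit b i j) x) y = form b x (siteOp k (unit b j i) y) := by
  simp only [form_apply, coords_siteOp, ite_mul, zero_mul, mul_ite, mul_zero]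
  rw [← Finset.sum_filter, ← Finset.sum_filter]
  refine Finset.sum_bij' (fun w _ => Function.update w k j) (fun w _ => Function.update w k i)
    ?_ ?_ ?_ ?_ ?_
  · simp
  · simp
  · intro w hw; simp at hw; simp [← hw]
  · intro w hw; simp at hw; simp [← hw]
  · intro w hw; simp at hw; simp [← hw]

/-- This adjointness makes complements of stable spaces stable, and it turns commutation relations
into statements about squared lengths. -/
theorem form_sumOp (K : Finset (Fin r)) (i j : Fin d) (x y : ⨂[ℝ]^r V) :
    form b (sumOp K (unit b i j) x) y = form b x (sumOp K (unit b j i) y) := by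
  simp [sumOp_apply, LinearMap.sum_apply, form_siteOp]

end

end TensorSignature

namespace TensorSignature

noncomputable section

open Module

variable {V : Type*} [AddCommGroup V] [Module ℝ V] {r d : ℕ} (b : Basis (Fin d) ℝ V)

/-! ### Weights -/

/-- The tensors of weight `κ`. -/
def wt (κ : Fin d → ℕ) : Submodule ℝ (⨂[ℝ]^r V) where
  carrier := {x | ∀ w, coords b x w ≠ 0 → content w = κ}
  zero_mem' := by simp
  add_mem' := by
    intro x y hx hy w hw
    by_cases h : coords b x w = 0
    · exact hy w fun h' => hw (by simp [h, h'])
    · exact hx w h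
  smul_mem' := by
    intro c x hx w hw
    exact hx w fun h => hw (by simp [h])

theorem mem_wt {κ : Fin d → ℕ} {x : ⨂[ℝ]^r V} :
    x ∈ wt b κ ↔ ∀ w, coords b x w ≠ 0 → content w = κ := Iff.rfl

theorem word_mem_wt (w : Fin r → Fin d) : word b w ∈ wt b (content w) := by
  intro u hu
  rw [coords_word] at hu
  by_cases h : u = w
  · rw [h]
  · simp [h] at hu

theorem coords_diag (i : Fin d) (x : ⨂[ℝ]^r V) (w : Fin r → Fin d) :
    coords b (sumOp Finset.univ (unit b i i) x) w = content w i * coords b x w :=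
  coords_sumOp_diag b _ i x w

theorem mem_wt_iff {κ : Fin d → ℕ} {x : ⨂[ℝ]^r V} :
    x ∈ wt b κ ↔ ∀ i, sumOp Finset.univ (unit b i i) x = (κ i : ℝ) • x := by
  constructor
  · intro h i
    refine coords_ext b fun w => ?_
    rw [coords_diag, map_smul, Pi.smul_apply, smul_eq_mul]
    by_cases hw : coords b x w = 0
    · simp [hw]
    · rw [h w hw]
  · intro h w hw
    ext i
    have := congrArg (fun y => coords b y w) (h i)
    simp only [coords_diag, map_smul, Pi.smul_apply, smul_eq_mul] at this
    exact_mod_cast mul_right_cancel₀ hw this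

theorem sum_content (w : Fin r → Fin d) : ∑ i, content w i = r := by
  have := Finset.card_eq_sum_card_fiberwise (f := w) (s := Finset.univ) (t := Finset.univ)
    (fun _ _ => Finset.mem_univ _)
  simpa [content] using this.symm

theorem sum_weight {κ : Fin d → ℕ} {x : ⨂[ℝ]^r V} (hx : x ∈ wt b κ) (h0 : x ≠ 0) :
    ∑ i, κ i = r := by
  obtain ⟨w, hw⟩ := exists_coords_ne_zero b h0
  rw [← hx w hw, sum_content]

theorem weight_unique {κ κ' : Fin d → ℕ} {x : ⨂[ℝ]^r V} (hx : x ∈ wt b κ) (hx' : x ∈ wt b κ')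
    (h0 : x ≠ 0) : κ = κ' := by
  obtain ⟨w, hw⟩ := exists_coords_ne_zero b h0
  rw [← hx w hw, hx' w hw]

theorem content_update {w : Fin r → Fin d} {k : Fin r} {i j : Fin d} (hk : w k = i) :
    content w + Pi.single j 1 = content (Function.update w k j) + Pi.single i 1 := by
  ext l
  have h1 : ∀ u : Fin r → Fin d, content u l =
      ∑ m ∈ Finset.univ.erase k, (if u m = l then 1 else 0) + if u k = l then 1 else 0 := by
    intro u
    rw [Finset.sum_erase_add _ _ (Finset.mem_univ k), content, Finset.card_filter]
  simp only [Pi.add_apply, h1, Function.update_self, hk, Pi.single_apply]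
  rw [Finset.sum_congr rfl (g := fun m => if w m = l then 1 else 0) (s₁ := Finset.univ.erase k)
    (f := fun m => if Function.update w k j m = l then 1 else 0)]
  · simp only [eq_comm (a := l)]
    omega
  · intro m hm
    rw [Function.update_of_ne (Finset.ne_of_mem_erase hm)]

theorem sumOp_mem_wt {κ κ' : Fin d → ℕ} {i j : Fin d} {x : ⨂[ℝ]^r V} (hx : x ∈ wt b κ)
    (h : κ' + Pi.single j 1 = κ + Pi.single i 1) :
    sumOp Finset.univ (unit b i j) x ∈ wt b κ' := by
  intro w hw
  rw [coords_sumOp] at hw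
  obtain ⟨k, _, hk⟩ := Finset.exists_ne_zero_of_sum_ne_zero hw
  have hk1 : w k = i := by by_contra h; simp [h] at hk
  rw [if_pos hk1] at hk
  have := content_update (j := j) hk1
  rw [hx _ hk, ← h] at this
  exact add_right_cancel this

theorem exists_wt_of_sumOp_ne_zero {κ : Fin d → ℕ} {i j : Fin d} {x : ⨂[ℝ]^r V}
    (hx : x ∈ wt b κ) (h : sumOp Finset.univ (unit b i j) x ≠ 0) :
    ∃ κ' : Fin d → ℕ, κ' + Pi.single j 1 = κ + Pi.single i 1 := by
  obtain ⟨w, hw⟩ := exists_coords_ne_zero b h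
  rw [coords_sumOp] at hw
  obtain ⟨k, _, hk⟩ := Finset.exists_ne_zero_of_sum_ne_zero hw
  have hk1 : w k = i := by by_contra h; simp [h] at hk
  rw [if_pos hk1] at hk
  exact ⟨content w, by rw [content_update (j := j) hk1, hx _ hk]⟩

/-- Induction on the number of words in the support. If two of them, `w` and `u`, differ in the
count of the letter `i`, then applying `E_ii` minus the count in `w` removes `w` from the support,
keeps `u`, and adds no word. -/
theorem exists_weight_vector {S : Submodule ℝ (⨂[ℝ]^r V)} (h0 : S ≠ ⊥)
    (hS : ∀ i, ∀ x ∈ S, sumOp Finset.univ (unit b i i) x ∈ S) :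
    ∃ κ, ∃ x ∈ S, x ≠ 0 ∧ x ∈ wt b κ := by
  classical
  suffices H : ∀ N : ℕ, ∀ x ∈ S, x ≠ 0 →
      (Finset.univ.filter fun w => coords b x w ≠ 0).card ≤ N →
      ∃ κ, ∃ x ∈ S, x ≠ 0 ∧ x ∈ wt b κ by
    obtain ⟨x, hx, hx0⟩ := Submodule.exists_mem_ne_zero_of_ne_bot h0
    exact H _ x hx hx0 le_rfl
  intro N
  induction N with
  | zero =>
    intro x _ hx0 hN
    obtain ⟨w, hw⟩ := exists_coords_ne_zero b hx0
    simp at hN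
    exact absurd hN (fun h => hw (@h w))
  | succ N ih =>
    intro x hx hx0 hN
    obtain ⟨w, hw⟩ := exists_coords_ne_zero b hx0
    by_cases hκ : x ∈ wt b (content w)
    · exact ⟨_, x, hx, hx0, hκ⟩
    · rw [mem_wt] at hκ
      push Not at hκ
      obtain ⟨u, hu, hne⟩ := hκ
      obtain ⟨i, hi⟩ := Function.ne_iff.1 hne
      set y := sumOp Finset.univ (unit b i i) x - (content w i : ℝ) • x with hy
      have hc : ∀ v, coords b y v = ((content v i : ℝ) - content w i) * coords b x v := by
        intro v
        simp [hy, coords_diag, sub_mul]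
      refine ih y (S.sub_mem (hS i x hx) (S.smul_mem _ hx)) ?_ ?_
      · rintro h
        have := hc u
        rw [h] at this
        simp only [map_zero, Pi.zero_apply, zero_eq_mul, hu, or_false, sub_eq_zero] at this
        exact hi (by exact_mod_cast this)
      · refine Nat.le_of_lt_succ (lt_of_lt_of_le (Finset.card_lt_card ?_) hN)
        rw [Finset.ssubset_iff_of_subset]
        · exact ⟨w, by simpa using hw, by simp [hc]⟩
        · intro v hv
          simp only [Finset.mem_filter, Finset.mem_univ, true_and, hc] at hv ⊢
          exact right_ne_zero_of_mul hv

/-! ### Highest weight vectors -/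

/-- The tensors annihilated by the raising operators for the first `m` basis vectors. -/
def hw (m : ℕ) : Submodule ℝ (⨂[ℝ]^r V) where
  carrier := {x | ∀ i j : Fin d, i < j → (j : ℕ) < m → sumOp Finset.univ (unit b i j) x = 0}
  zero_mem' := by simp
  add_mem' := by
    intro x y hx hy i j hij hj
    rw [map_add, hx i j hij hj, hy i j hij hj, add_zero]
  smul_mem' := by
    intro c x hx i j hij hj
    rw [map_smul, hx i j hij hj, smul_zero]

theorem mem_hw {m : ℕ} {x : ⨂[ℝ]^r V} : x ∈ hw b m ↔
    ∀ i j : Fin d, i < j → (j : ℕ) < m → sumOp Finset.univ (unit b i j) x = 0 := Iff.rfl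

/-- Stability under the infinitesimal action of the matrices in the first `m` basis vectors. -/
def GlStable (m : ℕ) (S : Submodule ℝ (⨂[ℝ]^r V)) : Prop :=
  ∀ i j : Fin d, (i : ℕ) < m → (j : ℕ) < m → ∀ x ∈ S, sumOp Finset.univ (unit b i j) x ∈ S

variable {b}

theorem GlStable.inf {m : ℕ} {S S' : Submodule ℝ (⨂[ℝ]^r V)} (h : GlStable b m S)
    (h' : GlStable b m S') : GlStable b m (S ⊓ S') :=
  fun i j hi hj x hx => ⟨h i j hi hj x hx.1, h' i j hi hj x hx.2⟩

variable (b)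

theorem sum_sumOp_diag (x : ⨂[ℝ]^r V) :
    ∑ i, sumOp Finset.univ (unit b i i) x = (r : ℝ) • x := by
  refine coords_ext b fun w => ?_
  rw [map_sum, Finset.sum_apply]
  simp only [coords_diag, map_smul, Pi.smul_apply, smul_eq_mul]
  rw [← Finset.sum_mul]
  congr 1
  exact_mod_cast sum_content w

variable {b}

/-- All diagonal operators together act as the scalar `r`. So if only one index lies outside the
first `m`, its diagonal operator comes for free; this allows `GL(d-1)`-stable spaces to be split by
full `d`-weights. -/
theorem GlStable.diag {m : ℕ} (hm : d ≤ m + 1) {S : Submodule ℝ (⨂[ℝ]^r V)}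
    (h : GlStable b m S) (i : Fin d) : ∀ x ∈ S, sumOp Finset.univ (unit b i i) x ∈ S := by
  intro x hx
  by_cases hi : (i : ℕ) < m
  · exact h i i hi hi x hx
  · have h1 := sum_sumOp_diag b x
    rw [← Finset.sum_erase_add _ _ (Finset.mem_univ i)] at h1
    rw [← eq_sub_iff_add_eq'] at h1
    rw [h1]
    refine S.sub_mem (S.smul_mem _ hx) (S.sum_mem fun j hj => ?_)
    have hj' : (j : ℕ) < m := by
      have h2 : (j : ℕ) ≠ i := fun h => Finset.ne_of_mem_erase hj (Fin.ext h)
      have := j.2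
      have := i.2
      omega
    exact h j j hj' hj' x hx

variable (b)

/-- The height `∑ (d - l) κ_l` grows by `j - i > 0` under `E_ij` and is at most `d * r`, so raising
terminates. Only diagonal and raising operators have to preserve `S`, which is what the generated
spaces in the branching argument provide. -/
theorem exists_hw_vector {m : ℕ} {S : Submodule ℝ (⨂[ℝ]^r V)} (h0 : S ≠ ⊥)
    (hS : ∀ i, ∀ x ∈ S, sumOp Finset.univ (unit b i i) x ∈ S)
    (hS' : ∀ i j : Fin d, i < j → (j : ℕ) < m → ∀ x ∈ S, sumOp Finset.univ (unit b i j) x ∈ S) :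
    ∃ κ, ∃ x ∈ S, x ≠ 0 ∧ x ∈ hw b m ∧ x ∈ wt b κ := by
  let H : (Fin d → ℕ) → ℕ := fun κ => ∑ l, (d - l) * κ l
  have hadd : ∀ κ κ', H (κ + κ') = H κ + H κ' := fun κ κ' => by
    simp [H, mul_add, Finset.sum_add_distrib]
  have hsingle : ∀ i, H (Pi.single i 1) = d - i := fun i => by
    simp [H, Pi.single_apply]
  have hbound : ∀ κ, ∀ x ∈ wt (r := r) b κ, x ≠ 0 → H κ ≤ d * r := fun κ x hx hx0 => by
    rw [← sum_weight b hx hx0, Finset.mul_sum]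
    exact Finset.sum_le_sum fun l _ => Nat.mul_le_mul_right _ (Nat.sub_le _ _)
  suffices main : ∀ N : ℕ, ∀ κ, ∀ x ∈ S, x ≠ 0 → x ∈ wt b κ → d * r - H κ ≤ N →
      ∃ κ, ∃ x ∈ S, x ≠ 0 ∧ x ∈ hw b m ∧ x ∈ wt b κ by
    obtain ⟨κ, x, hx, hx0, hκ⟩ := exists_weight_vector b h0 hS
    exact main _ κ x hx hx0 hκ le_rfl
  intro N
  induction N with
  | zero =>
    intro κ x hx hx0 hκ hN
    refine ⟨κ, x, hx, hx0, fun i j hij hj => ?_, hκ⟩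
    by_contra hne
    obtain ⟨κ', hκ'⟩ := exists_wt_of_sumOp_ne_zero b hκ hne
    have h1 := hbound κ' _ (sumOp_mem_wt b hκ hκ') hne
    have h2 := congrArg H hκ'
    rw [hadd, hadd, hsingle, hsingle] at h2
    have h3 : (i : ℕ) < j := hij
    have := j.2
    omega
  | succ N ih =>
    intro κ x hx hx0 hκ hN
    by_cases hh : x ∈ hw b m
    · exact ⟨κ, x, hx, hx0, hh, hκ⟩
    · rw [mem_hw] at hh
      push Not at hh
      obtain ⟨i, j, hij, hj, hne⟩ := hh
      obtain ⟨κ', hκ'⟩ := exists_wt_of_sumOp_ne_zero b hκ hne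
      have h1 := hbound κ' _ (sumOp_mem_wt b hκ hκ') hne
      refine ih κ' _ (hS' i j hij hj x hx) hne (sumOp_mem_wt b hκ hκ') ?_
      have h2 := congrArg H hκ'
      rw [hadd, hadd, hsingle, hsingle] at h2
      have h3 : (i : ℕ) < j := hij
      have := j.2
      omega

theorem GlStable.exists_hw_vector {m : ℕ} (hm : d ≤ m + 1) {S : Submodule ℝ (⨂[ℝ]^r V)}
    (h : GlStable b m S) (h0 : S ≠ ⊥) : ∃ κ, ∃ x ∈ S, x ≠ 0 ∧ x ∈ hw b m ∧ x ∈ wt b κ :=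
  TensorSignature.exists_hw_vector b h0 (h.diag hm) fun i j hij hj =>
    h i j ((show (i : ℕ) < j from hij).trans hj) hj

/-! ### Complements -/

theorem mem_orthogonal {S : Submodule ℝ (⨂[ℝ]^r V)} {x : ⨂[ℝ]^r V} :
    x ∈ (form b).orthogonal S ↔ ∀ y ∈ S, form b y x = 0 := Iff.rfl

theorem GlStable.orthogonal {m : ℕ} {S : Submodule ℝ (⨂[ℝ]^r V)} (h : GlStable b m S) :
    GlStable b m ((form b).orthogonal S) := by
  intro i j hi hj x hx
  rw [mem_orthogonal] at hx ⊢
  intro y hy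
  rw [← form_sumOp]
  exact hx _ (h j i hj hi y hy)

theorem form_isRefl : (form (r := r) b).IsRefl := fun x y h => by rwa [form_comm]

theorem finite_of_basis {d : ℕ} (b : Basis (Fin d) ℝ V) : FiniteDimensional ℝ (⨂[ℝ]^r V) :=
  Module.Finite.of_basis (Basis.piTensorProduct fun _ => b)

theorem isCompl_orthogonal (S : Submodule ℝ (⨂[ℝ]^r V)) : IsCompl S ((form b).orthogonal S) := by
  have := finite_of_basis (r := r) b
  refine LinearMap.BilinForm.isCompl_orthogonal_of_restrict_nondegenerate (form_isRefl b) ?_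
  constructor <;>
  · intro x hx
    exact Subtype.ext (eq_zero_of_form_self b (hx x))

theorem sup_inf_orthogonal {S M : Submodule ℝ (⨂[ℝ]^r V)} (h : S ≤ M) :
    S ⊔ (M ⊓ (form b).orthogonal S) = M := by
  rw [inf_comm, ← sup_inf_assoc_of_le _ h, (isCompl_orthogonal b S).sup_eq_top, top_inf_eq]

theorem eq_of_inf_orthogonal_eq_bot {S M : Submodule ℝ (⨂[ℝ]^r V)} (h : S ≤ M)
    (h0 : M ⊓ (form b).orthogonal S = ⊥) : S = M := by
  rw [← sup_inf_orthogonal b h, h0, sup_bot_eq]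

/-- A nonzero stable subspace contains a highest weight vector, hence `v`. If its complement in `M`
were nonzero as well, it would also contain `v`, and `v` would be orthogonal to itself. -/
theorem GlStable.eq_bot_or_eq {m : ℕ} (hm : d ≤ m + 1) {M : Submodule ℝ (⨂[ℝ]^r V)}
    (hM : GlStable b m M) (v : ⨂[ℝ]^r V)
    (hv : ∀ κ, ∀ x ∈ M, x ∈ hw b m → x ∈ wt b κ → ∃ c : ℝ, x = c • v)
    {S : Submodule ℝ (⨂[ℝ]^r V)} (hSM : S ≤ M) (hS : GlStable b m S) : S = ⊥ ∨ S = M := by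
  have key : ∀ S' ≤ M, GlStable b m S' → S' ≠ ⊥ → v ∈ S' ∧ v ≠ 0 := by
    intro S' hle hst h0
    obtain ⟨κ, x, hx, hx0, hxh, hxκ⟩ := hst.exists_hw_vector b hm h0
    obtain ⟨c, rfl⟩ := hv κ x (hle hx) hxh hxκ
    have hc : c ≠ 0 := fun h => hx0 (by simp [h])
    exact ⟨(S'.smul_mem_iff hc).1 hx, fun h => hx0 (by simp [h])⟩
  by_cases h0 : S = ⊥
  · exact Or.inl h0
  · right
    refine eq_of_inf_orthogonal_eq_bot b hSM ?_
    by_contra h1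
    obtain ⟨h2, h3⟩ := key _ inf_le_left (hM.inf (hS.orthogonal b)) h1
    obtain ⟨h4, _⟩ := key S hSM hS h0
    exact form_self_pos b h3 |>.ne' (h2.2 v h4)

/-! ### From the group to its infinitesimal action -/

theorem isUnit_one_add_smul_unit (i j : Fin d) {t : ℝ} (ht : t ≠ -1) :
    IsUnit ((1 : Module.End ℝ V) + t • unit b i j) := by
  have h1 : 1 + t ≠ 0 := fun h => ht (by linarith)
  have key : ∀ s s' : ℝ, ((1 : Module.End ℝ V) + s • unit b i j) * (1 + s' • unit b i j) =
      1 + (s + s' + if j = i then s * s' else 0) • unit b i j := by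
    intro s s'
    rw [mul_add, add_mul, add_mul, smul_mul_smul_comm, unit_mul_unit]
    by_cases h : j = i
    · subst h; simp [add_smul, add_assoc]
    · simp [h, add_smul, add_assoc]
  by_cases h : j = i
  -- A diagonal unit is idempotent, so the inverse parameter `s'` solves `t + s' + t s' = 0`; an
  -- off-diagonal unit squares to zero, and `-t` works.
  · refine isUnit_iff_exists.2 ⟨1 + (-t / (1 + t)) • unit b i j, ?_, ?_⟩ <;>
    · rw [key, if_pos h]
      convert add_zero _
      convert zero_smul ℝ _
      field_simp
      ring
  · refine isUnit_iff_exists.2 ⟨1 + (-t) • unit b i j, ?_, ?_⟩ <;>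
    · rw [key, if_neg h]
      convert add_zero _
      convert zero_smul ℝ _
      ring

theorem infinite_ne_neg_one : {t : ℝ | t ≠ -1}.Infinite :=
  (Set.finite_singleton (-1 : ℝ)).infinite_compl

theorem glStable_of_tensorRep {S : Submodule ℝ (⨂[ℝ]^r V)}
    (h : ∀ g, ∀ x ∈ S, tensorRep V r g x ∈ S) (m : ℕ) : GlStable b m S := by
  intro i j _ _ x hx
  -- The general statement concerns pairs of tensors; the second component is taken to be zero.
  refine (sumOp_mem_of_map_mem (S.prod (⊥ : Submodule ℝ (⨂[ℝ]^0 V))) (unit b i j) 0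
    infinite_ne_neg_one ?_ (x, 0) ⟨hx, rfl⟩).1
  rintro t ht ⟨x, y⟩ ⟨hx, hy⟩
  obtain ⟨g, hg⟩ := isUnit_one_add_smul_unit b i j ht
  refine ⟨?_, ?_⟩
  · have := h g x hx
    rwa [tensorRep, MonoidHom.coe_mk, OneHom.coe_mk, hg] at this
  · rw [(show y = 0 from hy)]
    simp

end

end TensorSignature

namespace TensorSignature

noncomputable section

open Module

variable {V : Type*} [AddCommGroup V] [Module ℝ V] {r d : ℕ} {lam : YoungDiagram}

/-! ### Tableaux -/

/-- The row of the box with entry `k`. -/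
def rowOf (T : lam.cells ≃ Fin r) (k : Fin r) : ℕ := (T.symm k : ℕ × ℕ).1

/-- The column of the box with entry `k`. -/
def colOf (T : lam.cells ≃ Fin r) (k : Fin r) : ℕ := (T.symm k : ℕ × ℕ).2

/-- The permutations preserving the rows of a tableau. -/
def rowPerms (T : lam.cells ≃ Fin r) : Finset (Equiv.Perm (Fin r)) :=
  Finset.univ.filter fun p => ∀ i, rowOf T (p i) = rowOf T i

/-- The permutations preserving the columns of a tableau. -/
def colPerms (T : lam.cells ≃ Fin r) : Finset (Equiv.Perm (Fin r)) :=
  Finset.univ.filter fun q => ∀ i, colOf T (q i) = colOf T i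

variable (V) in
/-- The sum of the row permutations. -/
def rowSym (T : lam.cells ≃ Fin r) : Module.End ℝ (⨂[ℝ]^r V) := ∑ p ∈ rowPerms T, permAct V p

variable (V) in
/-- The alternating sum of the column permutations. -/
def colAlt (T : lam.cells ≃ Fin r) : Module.End ℝ (⨂[ℝ]^r V) :=
  ∑ q ∈ colPerms T, ((Equiv.Perm.sign q : ℤ) : ℝ) • permAct V q

theorem youngSymmetrizer_eq (T : lam.cells ≃ Fin r) :
    youngSymmetrizer V T = rowSym V T * colAlt V T := rfl

variable (T : lam.cells ≃ Fin r)

theorem eq_of_row_col {k l : Fin r} (h1 : rowOf T k = rowOf T l) (h2 : colOf T k = colOf T l) :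
    k = l :=
  T.symm.injective (Subtype.ext (Prod.ext h1 h2))

theorem row_col_mem (k : Fin r) : (rowOf T k, colOf T k) ∈ lam := (T.symm k).2

theorem exists_row_col {i j : ℕ} (h : (i, j) ∈ lam) : ∃ k, rowOf T k = i ∧ colOf T k = j :=
  ⟨T ⟨(i, j), h⟩, by simp [rowOf], by simp [colOf]⟩

theorem mem_rowPerms {p : Equiv.Perm (Fin r)} :
    p ∈ rowPerms T ↔ ∀ i, rowOf T (p i) = rowOf T i := by simp [rowPerms]

theorem mem_colPerms {p : Equiv.Perm (Fin r)} :
    p ∈ colPerms T ↔ ∀ i, colOf T (p i) = colOf T i := by simp [colPerms]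

theorem inv_mem_rowPerms {p : Equiv.Perm (Fin r)} (hp : p ∈ rowPerms T) : p⁻¹ ∈ rowPerms T := by
  rw [mem_rowPerms] at *
  intro i
  conv_rhs => rw [← p.apply_symm_apply i, hp]
  rfl

theorem inv_mem_colPerms {p : Equiv.Perm (Fin r)} (hp : p ∈ colPerms T) : p⁻¹ ∈ colPerms T := by
  rw [mem_colPerms] at *
  intro i
  conv_rhs => rw [← p.apply_symm_apply i, hp]
  rfl

theorem mul_mem_rowPerms {p q : Equiv.Perm (Fin r)} (hp : p ∈ rowPerms T) (hq : q ∈ rowPerms T) :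
    p * q ∈ rowPerms T := by
  rw [mem_rowPerms] at *
  intro i
  rw [Equiv.Perm.mul_apply, hp, hq]

theorem mul_mem_colPerms {p q : Equiv.Perm (Fin r)} (hp : p ∈ colPerms T) (hq : q ∈ colPerms T) :
    p * q ∈ colPerms T := by
  rw [mem_colPerms] at *
  intro i
  rw [Equiv.Perm.mul_apply, hp, hq]

theorem one_mem_rowPerms : (1 : Equiv.Perm (Fin r)) ∈ rowPerms T := by simp [mem_rowPerms]

theorem one_mem_colPerms : (1 : Equiv.Perm (Fin r)) ∈ colPerms T := by simp [mem_colPerms]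

theorem rowSym_mul_permAct {p : Equiv.Perm (Fin r)} (hp : p ∈ rowPerms T) :
    rowSym V T * permAct V p = rowSym V T := by
  simp only [rowSym, Finset.sum_mul, permAct_mul]
  refine Finset.sum_equiv (Equiv.mulRight p) (fun q => ?_) fun q _ => rfl
  exact ⟨fun h => mul_mem_rowPerms T h hp, fun h => by
    simpa using mul_mem_rowPerms T h (inv_mem_rowPerms T hp)⟩

theorem colAlt_mul_permAct {p : Equiv.Perm (Fin r)} (hp : p ∈ colPerms T) :
    colAlt V T * permAct V p = ((Equiv.Perm.sign p : ℤ) : ℝ) • colAlt V T := by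
  simp only [colAlt, Finset.sum_mul, smul_mul_assoc, permAct_mul, Finset.smul_sum, smul_smul]
  refine Finset.sum_equiv (Equiv.mulRight p) (fun q => ?_) fun q _ => ?_
  · exact ⟨fun h => mul_mem_colPerms T h hp, fun h => by
      simpa using mul_mem_colPerms T h (inv_mem_colPerms T hp)⟩
  · congr 1
    simp only [Equiv.coe_mulRight, Equiv.Perm.sign_mul, Units.val_mul]
    norm_cast
    rw [mul_comm, mul_assoc, Int.units_mul_self, mul_one]

theorem rowSym_mul_rowSym : rowSym V T * rowSym V T = ((rowPerms T).card : ℝ) • rowSym V T := by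
  conv_lhs => arg 2; rw [rowSym]
  rw [Finset.mul_sum, Finset.sum_congr rfl fun p hp => rowSym_mul_permAct T hp, Finset.sum_const,
    Nat.cast_smul_eq_nsmul]

theorem card_rowPerms_pos : (0 : ℝ) < (rowPerms T).card := by
  exact_mod_cast Finset.card_pos.2 ⟨1, one_mem_rowPerms T⟩

theorem card_colPerms_pos : (0 : ℝ) < (colPerms T).card := by
  exact_mod_cast Finset.card_pos.2 ⟨1, one_mem_colPerms T⟩

theorem rowSym_mul_sumOp (A : Module.End ℝ V) :
    rowSym V T * sumOp Finset.univ A = sumOp Finset.univ A * rowSym V T := by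
  simp only [rowSym, Finset.sum_mul, Finset.mul_sum, permAct_mul_sumOp]

theorem colAlt_mul_sumOp (A : Module.End ℝ V) :
    colAlt V T * sumOp Finset.univ A = sumOp Finset.univ A * colAlt V T := by
  simp only [colAlt, Finset.sum_mul, Finset.mul_sum, smul_mul_assoc, permAct_mul_sumOp,
    mul_smul_comm]

theorem rowSym_sumOp (A : Module.End ℝ V) (x : ⨂[ℝ]^r V) :
    rowSym V T (sumOp Finset.univ A x) = sumOp Finset.univ A (rowSym V T x) :=
  LinearMap.congr_fun (rowSym_mul_sumOp T A) x

theorem colAlt_sumOp (A : Module.End ℝ V) (x : ⨂[ℝ]^r V) :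
    colAlt V T (sumOp Finset.univ A x) = sumOp Finset.univ A (colAlt V T x) :=
  LinearMap.congr_fun (colAlt_mul_sumOp T A) x

theorem youngSymmetrizer_sumOp (A : Module.End ℝ V) (x : ⨂[ℝ]^r V) :
    youngSymmetrizer V T (sumOp Finset.univ A x) =
      sumOp Finset.univ A (youngSymmetrizer V T x) := by
  rw [youngSymmetrizer_eq, Module.End.mul_apply, colAlt_sumOp, rowSym_sumOp]; rfl

variable (b : Basis (Fin d) ℝ V)

theorem form_rowSym (x y : ⨂[ℝ]^r V) : form b (rowSym V T x) y = form b x (rowSym V T y) := by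
  simp only [rowSym, LinearMap.sum_apply, map_sum, form_permAct]
  refine Finset.sum_equiv (Equiv.inv _) (fun p => ?_) fun p _ => rfl
  exact ⟨fun h => inv_mem_rowPerms T h, fun h => by simpa using inv_mem_rowPerms T h⟩

theorem form_colAlt (x y : ⨂[ℝ]^r V) : form b (colAlt V T x) y = form b x (colAlt V T y) := by
  simp only [colAlt, LinearMap.sum_apply, map_sum, LinearMap.smul_apply, map_smul, form_permAct]
  refine Finset.sum_equiv (Equiv.inv _) (fun p => ?_) fun p _ => ?_
  · exact ⟨fun h => inv_mem_colPerms T h, fun h => by simpa using inv_mem_colPerms T h⟩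
  · simp

/-- Preservation of highest weight vectors by operators commuting with the infinitesimal action. -/
theorem map_mem_hw {f : Module.End ℝ (⨂[ℝ]^r V)}
    (hf : ∀ A x, f (sumOp Finset.univ A x) = sumOp Finset.univ A (f x)) {m : ℕ} {x : ⨂[ℝ]^r V}
    (hx : x ∈ hw b m) : f x ∈ hw b m := by
  intro i j hij hj
  rw [← hf, hx i j hij hj, map_zero]

theorem map_mem_wt {f : Module.End ℝ (⨂[ℝ]^r V)}
    (hf : ∀ A x, f (sumOp Finset.univ A x) = sumOp Finset.univ A (f x)) {κ : Fin d → ℕ}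
    {x : ⨂[ℝ]^r V} (hx : x ∈ wt b κ) : f x ∈ wt b κ := by
  rw [mem_wt_iff] at *
  intro i
  rw [← hf, hx i, map_smul]

/-- The transposition of `k` and `l` fixes the word but reverses the sign of its antisymmetrization.
-/
theorem colAlt_word_eq_zero {w : Fin r → Fin d} {k l : Fin r} (hkl : k ≠ l)
    (hcol : colOf T k = colOf T l) (hw : w k = w l) : colAlt V T (word b w) = 0 := by
  have hs : Equiv.swap k l ∈ colPerms T := by
    rw [mem_colPerms]
    intro i
    rcases Equiv.swap_apply_eq_iff.1 (rfl : Equiv.swap k l i = Equiv.swap k l i) with _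
    by_cases hik : i = k
    · subst hik; rw [Equiv.swap_apply_left, hcol]
    · by_cases hil : i = l
      · subst hil; rw [Equiv.swap_apply_right, hcol]
      · rw [Equiv.swap_apply_of_ne_of_ne hik hil]
  have h1 : permAct V (Equiv.swap k l) (word b w) = word b w := by
    rw [permAct_word]
    congr 1
    ext i : 1
    rw [Function.comp_apply, Equiv.symm_swap]
    by_cases hik : i = k
    · subst hik; rw [Equiv.swap_apply_left, hw]
    · by_cases hil : i = l
      · subst hil; rw [Equiv.swap_apply_right, hw]
      · rw [Equiv.swap_apply_of_ne_of_ne hik hil]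
  have h2 := LinearMap.congr_fun (colAlt_mul_permAct (V := V) T hs) (word b w)
  rw [Module.End.mul_apply, h1, Equiv.Perm.sign_swap hkl, LinearMap.smul_apply] at h2
  set y := colAlt V T (word b w)
  have h3 : (2 : ℝ) • y = 0 := by
    rw [two_smul]
    nth_rewrite 1 [h2]
    simp
  exact (smul_eq_zero.1 h3).resolve_left two_ne_zero

theorem coords_colAlt_word (w u : Fin r → Fin d) :
    coords b (colAlt V T (word b w)) u =
      ∑ q ∈ colPerms T, if u ∘ q = w then ((Equiv.Perm.sign q : ℤ) : ℝ) else 0 := by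
  simp only [colAlt, LinearMap.sum_apply, map_sum, Finset.sum_apply, LinearMap.smul_apply,
    map_smul, Pi.smul_apply, coords_permAct, coords_word, smul_eq_mul, mul_ite, mul_one, mul_zero]

/-- A sufficient condition for the column antisymmetrization of a word to be a highest weight
vector. -/
theorem colAlt_word_mem_hw {w : Fin r → Fin d} {m : ℕ}
    (h : ∀ k : Fin r, ∀ i j : Fin d, i < j → (j : ℕ) < m → w k = j →
      ∃ l, colOf T l = colOf T k ∧ w l = i) : colAlt V T (word b w) ∈ hw b m := by
  intro i j hij hj
  rw [← colAlt_sumOp, sumOp_apply, LinearMap.sum_apply, map_sum]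
  refine Finset.sum_eq_zero fun k _ => ?_
  rw [siteOp_word]
  split_ifs with hk
  · obtain ⟨l, hl, hli⟩ := h k i j hij hj hk
    have hlk : l ≠ k := by rintro rfl; exact hij.ne (hli.symm.trans hk)
    refine colAlt_word_eq_zero T b hlk hl ?_
    rw [Function.update_self, Function.update_of_ne hlk, hli]
  · exact map_zero _

/-! ### The word of a tableau -/

theorem rowOf_lt (k : Fin r) : rowOf T k < lam.colLen 0 := by
  rw [← YoungDiagram.mem_iff_lt_colLen]
  exact lam.up_left_mem le_rfl (Nat.zero_le _) (row_col_mem T k)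

/-- The word whose `k`-th letter is the row of `k`. -/
def rowWord (h : lam.colLen 0 ≤ d) (k : Fin r) : Fin d := ⟨rowOf T k, (rowOf_lt T k).trans_le h⟩

theorem card_row (i : ℕ) : (Finset.univ.filter fun k => rowOf T k = i).card = lam.rowLen i := by
  rw [YoungDiagram.rowLen_eq_card]
  refine Finset.card_bij (fun k _ => (rowOf T k, colOf T k)) ?_ ?_ ?_
  · intro k hk
    rw [YoungDiagram.mem_row_iff]
    exact ⟨row_col_mem T k, by simpa using hk⟩
  · intro k _ l _ h
    exact eq_of_row_col T (Prod.ext_iff.1 h).1 (Prod.ext_iff.1 h).2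
  · rintro ⟨a, c⟩ h
    rw [YoungDiagram.mem_row_iff] at h
    obtain ⟨k, hk1, hk2⟩ := exists_row_col T h.1
    exact ⟨k, by simpa [hk1] using h.2, by rw [hk1, hk2]⟩

theorem card_col (j : ℕ) : (Finset.univ.filter fun k => colOf T k = j).card = lam.colLen j := by
  rw [YoungDiagram.colLen_eq_card]
  refine Finset.card_bij (fun k _ => (rowOf T k, colOf T k)) ?_ ?_ ?_
  · intro k hk
    rw [YoungDiagram.mem_col_iff]
    exact ⟨row_col_mem T k, by simpa using hk⟩
  · intro k _ l _ h
    exact eq_of_row_col T (Prod.ext_iff.1 h).1 (Prod.ext_iff.1 h).2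
  · rintro ⟨a, c⟩ h
    rw [YoungDiagram.mem_col_iff] at h
    obtain ⟨k, hk1, hk2⟩ := exists_row_col T h.1
    exact ⟨k, by simpa [hk2] using h.2, by rw [hk1, hk2]⟩

/-- The row lengths of a diagram as a weight. -/
def shapeWt (d : ℕ) (lam : YoungDiagram) (i : Fin d) : ℕ := lam.rowLen i

theorem content_rowWord (h : lam.colLen 0 ≤ d) : content (rowWord T h) = shapeWt d lam := by
  ext i
  rw [shapeWt, ← card_row T, content]
  simp [rowWord, Fin.ext_iff]

theorem colAlt_rowWord_mem_hw (h : lam.colLen 0 ≤ d) (m : ℕ) :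
    colAlt V T (word b (rowWord T h)) ∈ hw b m := by
  refine colAlt_word_mem_hw T b fun k i j hij _ hk => ?_
  have hk' : rowOf T k = j := by rw [← hk]; rfl
  obtain ⟨l, hl1, hl2⟩ := exists_row_col T (lam.up_left_mem
    (show (i : ℕ) ≤ rowOf T k by rw [hk']; exact hij.le) le_rfl (row_col_mem T k))
  exact ⟨l, hl2, Fin.ext hl1⟩

/-! ### Dominance -/

/-- Distinct letters below `i` in column `j` number at most `i` and at most the column length, and
the tableau word attains the minimum of the two. Summed over the columns, this is the dominance
inequality `card_lt_le`. -/
theorem card_lt_inter_col_le {w : Fin r → Fin d}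
    (hinj : ∀ k l, colOf T k = colOf T l → w k = w l → k = l) (i j : ℕ) :
    ((Finset.univ.filter fun k => (w k : ℕ) < i).filter fun k => colOf T k = j).card ≤
      ((Finset.univ.filter fun k => rowOf T k < i).filter fun k => colOf T k = j).card := by
  have h1 : min i (lam.colLen j) ≤
      ((Finset.univ.filter fun k => rowOf T k < i).filter fun k => colOf T k = j).card := by
    have hmem : ∀ a ∈ Finset.range (min i (lam.colLen j)), (a, j) ∈ lam := fun a ha =>
      YoungDiagram.mem_iff_lt_colLen.2 (by simp at ha; exact ha.2)
    rw [← Finset.card_range (min i (lam.colLen j))]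
    have hsub : Finset.range (min i (lam.colLen j)) ⊆
        ((Finset.univ.filter fun k => rowOf T k < i).filter fun k => colOf T k = j).image
          (rowOf T) := by
      intro a ha
      obtain ⟨k, hk1, hk2⟩ := exists_row_col T (hmem a ha)
      simp at ha
      simp only [Finset.mem_image, Finset.mem_filter, Finset.mem_univ, true_and]
      exact ⟨k, ⟨by omega, hk2⟩, hk1⟩
    exact (Finset.card_le_card hsub).trans Finset.card_image_le
  refine le_trans (le_min ?_ ?_) h1
  · rw [← Finset.card_range i]
    refine Finset.card_le_card_of_injOn (fun k => (w k : ℕ)) (fun k hk => ?_) fun k hk l hl h => ?_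
    · simp at hk; simpa using hk.1
    · simp at hk hl
      exact hinj k l (hk.2.trans hl.2.symm) (Fin.ext h)
  · rw [← card_col T]
    exact Finset.card_le_card (Finset.filter_subset_filter _ (Finset.filter_subset _ _))

theorem card_lt_le {w : Fin r → Fin d}
    (hinj : ∀ k l, colOf T k = colOf T l → w k = w l → k = l) (i : ℕ) :
    (Finset.univ.filter fun k => (w k : ℕ) < i).card ≤
      (Finset.univ.filter fun k => rowOf T k < i).card := by
  rw [Finset.card_eq_sum_card_fiberwise (f := colOf T) (t := Finset.univ.image (colOf T))
    (fun _ _ => by simp), Finset.card_eq_sum_card_fiberwise (f := colOf T)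
    (s := Finset.univ.filter fun k => rowOf T k < i) (t := Finset.univ.image (colOf T))
    (fun _ _ => by simp)]
  exact Finset.sum_le_sum fun j _ => card_lt_inter_col_le T hinj i j

theorem card_lt_eq_sum (w : Fin r → Fin d) (i : ℕ) :
    (Finset.univ.filter fun k => (w k : ℕ) < i).card =
      ∑ a ∈ Finset.univ.filter (fun a : Fin d => (a : ℕ) < i), content w a := by
  rw [Finset.card_eq_sum_card_fiberwise (f := w) (t := Finset.univ.filter fun a : Fin d => (a : ℕ) < i)
    (fun k hk => by simpa using hk)]
  refine Finset.sum_congr rfl fun a ha => ?_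
  rw [content, Finset.filter_filter]
  congr 1
  ext k
  simp only [Finset.mem_filter, Finset.mem_univ, true_and] at ha ⊢
  exact ⟨fun h => h.2, fun h => ⟨by rw [h]; exact ha, h⟩⟩

theorem content_eq_of_card_lt {w u : Fin r → Fin d}
    (h : ∀ i : ℕ, (Finset.univ.filter fun k => (w k : ℕ) < i).card =
      (Finset.univ.filter fun k => (u k : ℕ) < i).card) : content w = content u := by
  have key : ∀ (v : Fin r → Fin d) (i : Fin d), content v i +
      (Finset.univ.filter fun k => (v k : ℕ) < i).card =
      (Finset.univ.filter fun k => (v k : ℕ) < i + 1).card := by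
    intro v i
    rw [content, ← Finset.card_union_of_disjoint]
    · congr 1
      ext k
      simp only [Finset.mem_union, Finset.mem_filter, Finset.mem_univ, true_and, Fin.ext_iff]
      omega
    · rw [Finset.disjoint_filter]
      intro k _ h1 h2
      simp [h1] at h2
  ext i
  have h1 := key w i
  have h2 := key u i
  rw [h, h] at h1
  omega

/-- A word with the content of the tableau word and without repetitions in columns is a column
permutation of the tableau word. -/
theorem exists_colPerm {w : Fin r → Fin d} (h : lam.colLen 0 ≤ d)
    (hinj : ∀ k l, colOf T k = colOf T l → w k = w l → k = l)
    (hcont : content w = content (rowWord T h)) :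
    ∃ q ∈ colPerms T, w = rowWord T h ∘ q := by
  -- Equal contents force equality in the summed dominance inequality, hence in every column. Taking
  -- the length of column `j` as the bound shows that all letters of `w` in column `j` are below
  -- that length.
  have hmem : ∀ k, ((w k : ℕ), colOf T k) ∈ lam := by
    intro k
    rw [YoungDiagram.mem_iff_lt_colLen]
    set j := colOf T k with hj
    have h1 : (Finset.univ.filter fun k => (w k : ℕ) < lam.colLen j).card =
        (Finset.univ.filter fun k => rowOf T k < lam.colLen j).card := by
      rw [card_lt_eq_sum, hcont, ← card_lt_eq_sum]; rfl
    rw [Finset.card_eq_sum_card_fiberwise (f := colOf T) (t := Finset.univ.image (colOf T))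
      (fun _ _ => by simp), Finset.card_eq_sum_card_fiberwise (f := colOf T)
      (s := Finset.univ.filter fun k => rowOf T k < lam.colLen j)
      (t := Finset.univ.image (colOf T)) (fun _ _ => by simp)] at h1
    have h2 := (Finset.sum_eq_sum_iff_of_le fun j' _ =>
      card_lt_inter_col_le T hinj (lam.colLen j) j').1 h1 j (by simp [hj])
    have h3 : ((Finset.univ.filter fun k => rowOf T k < lam.colLen j).filter
        fun k => colOf T k = j) = Finset.univ.filter fun k => colOf T k = j := by
      ext l
      simp only [Finset.mem_filter, Finset.mem_univ, true_and, and_iff_right_iff_imp]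
      rintro hl
      rw [← YoungDiagram.mem_iff_lt_colLen, ← hl]
      exact row_col_mem T l
    rw [h3] at h2
    have h4 := Finset.eq_of_subset_of_card_le
      (Finset.filter_subset_filter (fun k => colOf T k = j)
        (Finset.filter_subset (fun k => (w k : ℕ) < lam.colLen j) Finset.univ)) h2.ge
    have h5 : k ∈ Finset.univ.filter fun k => colOf T k = j := by simp [hj]
    rw [← h4] at h5
    simpa using (Finset.mem_filter.1 h5).1
  -- The required permutation sends `k` to the entry in the same column whose row is the letter `w
  -- k`.
  choose f hf1 hf2 using fun k => exists_row_col T (hmem k)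
  have hfinj : Function.Injective f := by
    intro k l hkl
    refine hinj k l ?_ (Fin.ext ?_)
    · rw [← hf2, hkl, hf2]
    · rw [← hf1, hkl, hf1]
  refine ⟨Equiv.ofBijective f (Finite.injective_iff_bijective.1 hfinj), ?_, ?_⟩
  · rw [mem_colPerms]
    exact hf2
  · ext k
    exact (hf1 k).symm

end

end TensorSignature

namespace TensorSignature

noncomputable section

open Module

variable {V : Type*} [AddCommGroup V] [Module ℝ V] {r d : ℕ} (b : Basis (Fin d) ℝ V)

/-! ### Leading words of highest weight vectors -/

theorem toColex_lt_of {u w : Fin r → Fin d} (k : Fin r) (h : ∀ l, k < l → u l = w l)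
    (hk : u k < w k) : toColex u < toColex w :=
  ⟨k, fun l hl => h l hl, hk⟩

/-- `w` is the leading word of `x` in the colexicographic order. -/
def IsLeading (x : ⨂[ℝ]^r V) (w : Fin r → Fin d) : Prop :=
  coords b x w ≠ 0 ∧ ∀ u, coords b x u ≠ 0 → toColex u ≤ toColex w

theorem exists_isLeading {x : ⨂[ℝ]^r V} (hx : x ≠ 0) : ∃ w, IsLeading b x w := by
  classical
  obtain ⟨w0, hw0⟩ := exists_coords_ne_zero b hx
  obtain ⟨w, hw, hmax⟩ := Finset.exists_max_image
    (Finset.univ.filter fun w => coords b x w ≠ 0) (fun w => toColex w) ⟨w0, by simpa using hw0⟩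
  exact ⟨w, by simpa using hw, fun u hu => hmax u (by simpa using hu)⟩

/-- In every initial segment of the word, smaller letters are at least as frequent. -/
def IsBallot (w : Fin r → Fin d) : Prop :=
  ∀ s : ℕ, ∀ i j : Fin d, i < j →
    ((Finset.univ.filter fun k : Fin r => (k : ℕ) < s).filter fun k => w k = j).card ≤
      ((Finset.univ.filter fun k : Fin r => (k : ℕ) < s).filter fun k => w k = i).card

-- Let `y` be the part of `x` made of the words that agree with `w` from position `s` on. The
-- operator `E_ij` restricted to the first `s` positions kills `y`, and all words of `y` have the
-- same letter counts `c` in these positions. Hence the squared length of the restricted `E_ji y` is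
-- `(c i - c j)` times that of `y`, and it is nonnegative.
variable {b} in
theorem IsLeading.isBallot {x : ⨂[ℝ]^r V} {w : Fin r → Fin d} (hw : IsLeading b x w)
    {κ : Fin d → ℕ} (hx : x ∈ TensorSignature.hw b d) (hκ : x ∈ wt b κ) : IsBallot w := by
  classical
  intro s i j hij
  set K := Finset.univ.filter fun k : Fin r => (k : ℕ) < s with hK
  let P : (Fin r → Fin d) → Prop := fun u => ∀ l : Fin r, s ≤ l → u l = w l
  let y : ⨂[ℝ]^r V := (coords b).symm fun u => if P u then coords b x u else 0
  have hy : ∀ u, coords b y u = if P u then coords b x u else 0 := fun u => by simp [y]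
  have hP : ∀ u (k : Fin r) (a : Fin d), k ∈ K → (P (Function.update u k a) ↔ P u) := by
    intro u k a hk
    refine forall_congr' fun l => imp_congr_right fun hl => ?_
    rw [Function.update_of_ne]
    rintro rfl
    simp [hK] at hk
    omega
  -- The coefficient of `E_ij x` at a word `u` of this kind vanishes. A contribution from a position
  -- `k ≥ s` would be a coefficient of `x` at a word that agrees with `w` after `k` and has `j > i =
  -- w k` at `k`, which is larger than the leading word. So the positions in `K` alone sum to zero.
  have hE : sumOp K (unit b i j) y = 0 := by
    refine coords_ext b fun u => ?_
    rw [coords_sumOp, map_zero, Pi.zero_apply]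
    by_cases hu : P u
    · have h1 := congrArg (fun z => coords b z u) (hx i j hij j.2)
      simp only [coords_sumOp, map_zero, Pi.zero_apply] at h1
      rw [← Finset.sum_filter_add_sum_filter_not Finset.univ (fun k : Fin r => (k : ℕ) < s)] at h1
      rw [Finset.sum_eq_zero (s := Finset.univ.filter fun k : Fin r => ¬ (k : ℕ) < s)] at h1
      · rw [add_zero] at h1
        refine Eq.trans (Finset.sum_congr rfl fun k hk => ?_) h1
        rw [hy, if_pos ((hP u k j hk).2 hu)]
      · intro k hk
        have hk' : s ≤ (k : ℕ) := by simpa using hk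
        split_ifs with hki
        · by_contra hne
          refine absurd (hw.2 _ hne) (not_le.2 (toColex_lt_of k (fun l hl => ?_) ?_))
          · have hl' : (k : ℕ) < l := hl
            rw [Function.update_of_ne hl.ne', hu l (by omega)]
          · rw [Function.update_self, ← hu k hk', hki]
            exact hij
        · rfl
    · refine Finset.sum_eq_zero fun k hk => ?_
      rw [hy, if_neg (fun h => hu ((hP u k j hk).1 h)), ite_self]
  set c : Fin d → ℕ := fun a => (K.filter fun k => w k = a).card with hc
  have hprefix : ∀ u, coords b y u ≠ 0 → ∀ a, (K.filter fun k => u k = a).card = c a := by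
    intro u hu a
    rw [hy] at hu
    have hPu : P u := by by_contra h; simp [h] at hu
    rw [if_pos hPu] at hu
    have h1 : content u a = content w a := by rw [hκ u hu, hκ w hw.1]
    have h2 : ∀ v : Fin r → Fin d, content v a = (K.filter fun k => v k = a).card +
        ((Finset.univ.filter fun k : Fin r => ¬ (k : ℕ) < s).filter fun k => v k = a).card := by
      intro v
      rw [content, hK, Finset.filter_comm, Finset.filter_comm (p := fun k : Fin r => ¬ (k : ℕ) < s),
        Finset.card_filter_add_card_filter_not]
    rw [h2, h2] at h1
    have h3 : ((Finset.univ.filter fun k : Fin r => ¬ (k : ℕ) < s).filter fun k => u k = a) =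
        ((Finset.univ.filter fun k : Fin r => ¬ (k : ℕ) < s).filter fun k => w k = a) := by
      refine Finset.filter_congr fun k hk => ?_
      rw [hPu k (by simpa using hk)]
    rw [h3] at h1
    simp only [hc]
    omega
  have hdiag : ∀ a, sumOp K (unit b a a) y = (c a : ℝ) • y := by
    intro a
    refine coords_ext b fun u => ?_
    rw [coords_sumOp_diag, map_smul, Pi.smul_apply, smul_eq_mul]
    by_cases hu : coords b y u = 0
    · simp [hu]
    · rw [hprefix u hu]
  have hy0 : y ≠ 0 := by
    intro h
    have := hy w
    rw [h, if_pos (fun _ _ => rfl)] at this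
    exact hw.1 (by simpa using this.symm)
  -- Since `E_ij y = 0`, the commutator gives `E_ij E_ji y = (c i - c j) y`.
  have hlie := sumOp_unit_lie b K i j j i y
  rw [hE, map_zero, zero_add, if_pos rfl, if_pos rfl, hdiag, hdiag] at hlie
  have h0 : 0 ≤ form b (sumOp K (unit b j i) y) (sumOp K (unit b j i) y) :=
    Finset.sum_nonneg fun _ _ => mul_self_nonneg _
  rw [form_sumOp, hlie, map_sub, map_smul, map_smul, ← sub_smul, smul_eq_mul] at h0
  have h1 := nonneg_of_mul_nonneg_left h0 (form_self_pos b hy0)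
  have h2 : (c j : ℝ) ≤ c i := by linarith
  exact_mod_cast h2

theorem IsBallot.content_anti {w : Fin r → Fin d} (h : IsBallot w) {i j : Fin d} (hij : i ≤ j) :
    content w j ≤ content w i := by
  rcases hij.eq_or_lt with rfl | hij
  · rfl
  · simpa [content] using h r i j hij

/-- The box of the tableau associated with a ballot word. -/
def boxOf (w : Fin r → Fin d) (k : Fin r) : ℕ × ℕ :=
  (w k, (Finset.univ.filter fun l => l < k ∧ w l = w k).card)

theorem boxOf_lt {w : Fin r → Fin d} {k k' : Fin r} (h : k < k') (hw : w k = w k') :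
    (boxOf w k).2 < (boxOf w k').2 := by
  change (Finset.univ.filter fun l => l < k ∧ w l = w k).card <
    (Finset.univ.filter fun l => l < k' ∧ w l = w k').card
  refine Finset.card_lt_card ((Finset.ssubset_iff_of_subset fun l hl => ?_).2
    ⟨k, Finset.mem_filter.2 ⟨Finset.mem_univ _, h, hw⟩,
      fun hk => lt_irrefl _ (Finset.mem_filter.1 hk).2.1⟩)
  simp only [Finset.mem_filter, Finset.mem_univ, true_and] at hl ⊢
  exact ⟨hl.1.trans h, hl.2.trans hw⟩

theorem boxOf_injective (w : Fin r → Fin d) : Function.Injective (boxOf w) := by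
  intro k k' h
  have hw : w k = w k' := Fin.ext (Prod.ext_iff.1 h).1
  rcases lt_trichotomy k k' with hlt | heq | hlt
  · exact absurd (Prod.ext_iff.1 h).2 (boxOf_lt hlt hw).ne
  · exact heq
  · exact absurd (Prod.ext_iff.1 h).2 (boxOf_lt hlt hw.symm).ne'

theorem mem_image_boxOf (w : Fin r → Fin d) (i j : ℕ) :
    (i, j) ∈ Finset.univ.image (boxOf w) ↔ ∃ h : i < d, j < content w ⟨i, h⟩ := by
  have key : ∀ a : Fin d, ((Finset.univ.filter fun k => w k = a).image fun k => (boxOf w k).2) =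
      Finset.range (content w a) := by
    intro a
    refine Finset.eq_of_subset_of_card_le ?_ ?_
    · intro c hc
      simp only [Finset.mem_image, Finset.mem_filter, Finset.mem_univ, true_and] at hc
      obtain ⟨k, rfl, rfl⟩ := hc
      rw [Finset.mem_range]
      change (Finset.univ.filter fun l => l < k ∧ w l = w k).card <
        (Finset.univ.filter fun l => w l = w k).card
      refine Finset.card_lt_card ((Finset.ssubset_iff_of_subset fun l hl => ?_).2
        ⟨k, Finset.mem_filter.2 ⟨Finset.mem_univ _, rfl⟩,
          fun hk => lt_irrefl _ (Finset.mem_filter.1 hk).2.1⟩)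
      simp only [Finset.mem_filter, Finset.mem_univ, true_and] at hl ⊢
      exact hl.2
    · rw [Finset.card_range, Finset.card_image_of_injOn]
      · rfl
      · intro k hk k' hk' h
        simp only [Finset.coe_filter, Finset.mem_univ, true_and, Set.mem_ofPred_eq] at hk hk'
        exact boxOf_injective w (Prod.ext (congrArg Fin.val (hk.trans hk'.symm)) h)
  constructor
  · intro h
    obtain ⟨k, _, hk⟩ := Finset.mem_image.1 h
    have hki : (w k : ℕ) = i := (Prod.ext_iff.1 hk).1
    subst hki
    refine ⟨(w k).2, ?_⟩
    rw [← Finset.mem_range, ← key]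
    exact Finset.mem_image.2 ⟨k, by simp, (Prod.ext_iff.1 hk).2⟩
  · rintro ⟨h, hj⟩
    rw [← Finset.mem_range, ← key] at hj
    obtain ⟨k, hk, hkj⟩ := Finset.mem_image.1 hj
    have hk' : w k = ⟨i, h⟩ := by simpa using hk
    exact Finset.mem_image.2 ⟨k, Finset.mem_univ _, Prod.ext (by rw [boxOf, hk']) hkj⟩

/-- The Young diagram associated with a ballot word. -/
def ballotShape (w : Fin r → Fin d) (hw : IsBallot w) : YoungDiagram where
  cells := Finset.univ.image (boxOf w)
  isLowerSet := by
    rintro ⟨i, j⟩ ⟨i', j'⟩ ⟨hi, hj⟩ h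
    simp only [Finset.mem_coe, mem_image_boxOf] at h ⊢
    obtain ⟨h1, h2⟩ := h
    exact ⟨lt_of_le_of_lt hi h1, lt_of_le_of_lt hj (h2.trans_le (hw.content_anti hi))⟩

theorem mem_ballotShape {w : Fin r → Fin d} (hw : IsBallot w) {i j : ℕ} :
    (i, j) ∈ ballotShape w hw ↔ ∃ h : i < d, j < content w ⟨i, h⟩ := mem_image_boxOf w i j

theorem colLen_ballotShape {w : Fin r → Fin d} (hw : IsBallot w) :
    (ballotShape w hw).colLen 0 ≤ d := by
  by_contra! h
  rw [← YoungDiagram.mem_iff_lt_colLen, mem_ballotShape] at h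
  exact lt_irrefl _ h.1

/-- The standard tableau associated with a ballot word. -/
def ballotTableau (w : Fin r → Fin d) (hw : IsBallot w) : (ballotShape w hw).cells ≃ Fin r :=
  (Equiv.ofBijective (fun k => (⟨boxOf w k, Finset.mem_image_of_mem _ (Finset.mem_univ k)⟩ :
    (ballotShape w hw).cells)) ⟨fun k k' h => boxOf_injective w (congrArg Subtype.val h), by
      rintro ⟨c, hc⟩
      obtain ⟨k, _, hk⟩ := Finset.mem_image.1 hc
      exact ⟨k, Subtype.ext hk⟩⟩).symm

theorem rowWord_ballotTableau {w : Fin r → Fin d} (hw : IsBallot w) :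
    rowWord (ballotTableau w hw) (colLen_ballotShape hw) = w := rfl

theorem colOf_ballotTableau {w : Fin r → Fin d} (hw : IsBallot w) (k : Fin r) :
    colOf (ballotTableau w hw) k = (Finset.univ.filter fun l => l < k ∧ w l = w k).card := rfl

/-- The tableau is standard along its columns. If `l` came before `k`, the prefix ending at `l`
would contain more letters `w l` than their common column index, hence by the ballot condition as
many smaller letters `w k`, all before `k`, contradicting the column of `k`. -/
theorem IsBallot.lt_of_lt {w : Fin r → Fin d} (hw : IsBallot w) {k l : Fin r}
    (hcol : colOf (ballotTableau w hw) k = colOf (ballotTableau w hw) l) (h : w k < w l) :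
    k < l := by
  rw [colOf_ballotTableau, colOf_ballotTableau] at hcol
  by_contra! hle
  have hlk : l < k := lt_of_le_of_ne hle (by rintro rfl; exact lt_irrefl _ h)
  have h1 := hw ((l : ℕ) + 1) _ _ h
  have h2 : (Finset.univ.filter fun m => m < l ∧ w m = w l).card <
      ((Finset.univ.filter fun m : Fin r => (m : ℕ) < l + 1).filter fun m => w m = w l).card := by
    refine Finset.card_lt_card ((Finset.ssubset_iff_of_subset fun m hm => ?_).2
      ⟨l, by simp, by simp⟩)
    simp only [Finset.mem_filter, Finset.mem_univ, true_and, Fin.lt_def] at hm ⊢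
    exact ⟨by omega, hm.2⟩
  have h3 : ((Finset.univ.filter fun m : Fin r => (m : ℕ) < l + 1).filter
      fun m => w m = w k).card ≤ (Finset.univ.filter fun m => m < k ∧ w m = w k).card := by
    refine Finset.card_le_card fun m hm => ?_
    simp only [Finset.mem_filter, Finset.mem_univ, true_and, Fin.lt_def] at hm hlk ⊢
    exact ⟨by omega, hm.2⟩
  omega

/-- At positions above the last one, `k`, where `w ∘ q` and `w` differ, `q` is the identity. So `q k
< k` in the same column, and standardness makes the letter at `k` drop. -/
theorem comp_le_of_colPerm {w : Fin r → Fin d} (hw : IsBallot w) {q : Equiv.Perm (Fin r)}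
    (hq : q ∈ colPerms (ballotTableau w hw)) : toColex (w ∘ q) ≤ toColex w := by
  by_cases h : ∃ k, w (q k) ≠ w k
  · obtain ⟨k, hk, hmax⟩ := Finset.exists_max_image
      (Finset.univ.filter fun k => w (q k) ≠ w k) id (by simpa [Finset.filter_nonempty_iff] using h)
    have hk : w (q k) ≠ w k := by simpa using hk
    have hfix : ∀ l, k < l → w (q l) = w l := by
      intro l hl
      by_contra hne
      exact absurd (hmax l (by simpa using hne)) (not_le.2 hl)
    have hcol := (mem_colPerms _).1 hq
    have hfix' : ∀ l, k < l → q l = l := fun l hl =>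
      eq_of_row_col (ballotTableau w hw) (congrArg Fin.val (hfix l hl)) (hcol l)
    have hqk : q k < k := by
      rcases lt_trichotomy (q k) k with h1 | h1 | h1
      · exact h1
      · exact absurd (by rw [h1]) hk
      · exact absurd (q.injective (hfix' _ h1)) (fun h => hk (by rw [h]))
    refine le_of_lt (toColex_lt_of k hfix ?_)
    · rcases lt_or_gt_of_ne hk with h1 | h1
      · exact h1
      · exact absurd (hw.lt_of_lt (hcol k).symm h1) (not_lt.2 hqk.le)
  · push Not at h
    exact le_of_eq (congrArg toColex (funext h))

/-- The words that occur are column permutations of `w`, none larger than `w`. The word `w` itself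
arises only from the identity, since row and column determine an entry. -/
theorem isLeading_ballot {w : Fin r → Fin d} (hw : IsBallot w) :
    IsLeading b (colAlt V (ballotTableau w hw) (word b w)) w ∧
      coords b (colAlt V (ballotTableau w hw) (word b w)) w = 1 := by
  have h1 : coords b (colAlt V (ballotTableau w hw) (word b w)) w = 1 := by
    rw [coords_colAlt_word, Finset.sum_eq_single 1]
    · simp
    · intro q hq hne
      rw [if_neg]
      intro h
      refine hne (Equiv.ext fun k => ?_)
      exact eq_of_row_col (ballotTableau w hw) (congrArg Fin.val (congrFun h k))
        ((mem_colPerms _).1 hq k)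
    · exact fun h => absurd (one_mem_colPerms _) h
  refine ⟨⟨by rw [h1]; exact one_ne_zero, fun u hu => ?_⟩, h1⟩
  rw [coords_colAlt_word] at hu
  obtain ⟨q, hq, hne⟩ := Finset.exists_ne_zero_of_sum_ne_zero hu
  have huq : u ∘ q = w := by by_contra h; simp [h] at hne
  have : u = w ∘ ⇑q⁻¹ := by
    rw [← huq]
    ext k
    simp
  rw [this]
  exact comp_le_of_colPerm hw (inv_mem_colPerms _ hq)

/-- The column antisymmetrized words of the tableaux whose shape has the given row lengths. -/
def polytabloids (κ : Fin d → ℕ) : Set (⨂[ℝ]^r V) :=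
  {x | ∃ (lam : YoungDiagram) (h : lam.colLen 0 ≤ d) (T : lam.cells ≃ Fin r),
    shapeWt d lam = κ ∧ x = colAlt V T (word b (rowWord T h))}

/-- Well-founded induction on the leading word: it is a ballot word, so subtracting a multiple of
the antisymmetrized word of its tableau leaves a vector of the same kind with a smaller leading
word. -/
theorem hw_inf_wt_le_span (κ : Fin d → ℕ) :
    hw b d ⊓ wt b κ ≤ Submodule.span ℝ (polytabloids (r := r) b κ) := by
  suffices H : ∀ w0 : Colex (Fin r → Fin d), ∀ x ∈ hw b d ⊓ wt b κ,
      (∀ u, coords b x u ≠ 0 → toColex u ≤ w0) →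
      x ∈ Submodule.span ℝ (polytabloids (r := r) b κ) by
    intro x hx
    by_cases h0 : x = 0
    · rw [h0]; exact Submodule.zero_mem _
    · obtain ⟨w, hw⟩ := exists_isLeading b h0
      exact H (toColex w) x hx hw.2
  intro w0
  induction w0 using WellFoundedLT.induction with
  | ind w0 ih =>
    intro x hx hw0
    by_cases h0 : x = 0
    · rw [h0]; exact Submodule.zero_mem _
    obtain ⟨w, hlead⟩ := exists_isLeading b h0
    have hb := hlead.isBallot hx.1 hx.2
    obtain ⟨hg, hg1⟩ := isLeading_ballot b hb
    set g := colAlt V (ballotTableau w hb) (word b w) with hgdef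
    have hcw : content w = κ := hx.2 w hlead.1
    have hgmem : g ∈ hw b d ⊓ wt b κ := by
      refine ⟨?_, ?_⟩
      · exact colAlt_rowWord_mem_hw (ballotTableau w hb) b (colLen_ballotShape hb) d
      · exact map_mem_wt b (colAlt_sumOp _) (hcw ▸ word_mem_wt b w)
    have hgp : g ∈ polytabloids b κ :=
      ⟨ballotShape w hb, colLen_ballotShape hb, ballotTableau w hb, by
        rw [← content_rowWord (ballotTableau w hb) (colLen_ballotShape hb),
          rowWord_ballotTableau, hcw], rfl⟩
    have hx' : x = (x - coords b x w • g) + coords b x w • g := by simp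
    rw [hx']
    refine Submodule.add_mem _ ?_ (Submodule.smul_mem _ _ (Submodule.subset_span hgp))
    set y := x - coords b x w • g with hy
    have hyw : coords b y w = 0 := by simp [hy, hg1]
    have hys : ∀ u, coords b y u ≠ 0 → toColex u < toColex w := by
      intro u hu
      refine lt_of_le_of_ne ?_ ?_
      · by_cases hxu : coords b x u = 0
        · refine hg.2 u fun hgu => hu ?_
          simp [hy, hxu, hgu]
        · exact hlead.2 u hxu
      · intro h
        rw [toColex_inj.1 h] at hu
        exact hu hyw
    by_cases hy0 : y = 0
    · rw [hy0]; exact Submodule.zero_mem _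
    obtain ⟨w1, hw1⟩ := exists_isLeading b hy0
    exact ih (toColex w1) ((hys w1 hw1.1).trans_le (hw0 w hlead.1)) y
      (Submodule.sub_mem _ hx (Submodule.smul_mem _ _ hgmem)) hw1.2

/-- A nonzero vector cannot be orthogonal to a spanning set of a space that contains it. -/
theorem exists_shape_of_hw {κ : Fin d → ℕ} {x : ⨂[ℝ]^r V} (hx : x ∈ hw b d) (hκ : x ∈ wt b κ)
    (h0 : x ≠ 0) : ∃ (lam : YoungDiagram) (h : lam.colLen 0 ≤ d) (T : lam.cells ≃ Fin r),
    shapeWt d lam = κ ∧ form b x (colAlt V T (word b (rowWord T h))) ≠ 0 := by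
  by_contra! hcon
  refine h0 (eq_zero_of_form_self b ?_)
  have : ∀ y ∈ Submodule.span ℝ (polytabloids (r := r) b κ), form b x y = 0 := by
    intro y hy
    induction hy using Submodule.span_induction with
    | mem y hy =>
      obtain ⟨lam, h, T, h1, rfl⟩ := hy
      exact hcon lam h T h1
    | zero => simp
    | add y z _ _ hy hz => simp [hy, hz]
    | smul c y _ hy => simp [hy]
  exact this x (hw_inf_wt_le_span b κ ⟨hx, hκ⟩)

end

end TensorSignature

namespace TensorSignature

noncomputable section

open Module

/-! ### Irreducibility and equivalence of subrepresentations -/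

section General

variable {G U : Type*} [Group G] [AddCommGroup U] [Module ℝ U] {ρ : Representation ℝ G U}

theorem isIrreducible_iff (M : Subrepresentation ρ) :
    M.toRepresentation.IsIrreducible ↔ M.toSubmodule ≠ ⊥ ∧ ∀ S ≤ M.toSubmodule,
      (∀ g, ∀ x ∈ S, ρ g x ∈ S) → S = ⊥ ∨ S = M.toSubmodule := by
  constructor
  · intro h
    refine ⟨fun h0 => ?_, fun S hS hg => ?_⟩
    · refine (bot_ne_top (α := Subrepresentation M.toRepresentation)) ?_
      refine Subrepresentation.toSubmodule_injective ?_
      change (⊥ : Submodule ℝ M.toSubmodule) = ⊤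
      rw [eq_comm, Submodule.eq_bot_iff]
      rintro ⟨x, hx⟩ _
      rw [h0] at hx
      exact Subtype.ext hx
    · let τ : Subrepresentation M.toRepresentation :=
        ⟨S.comap M.toSubmodule.subtype, fun g x hx => hg g _ hx⟩
      rcases eq_bot_or_eq_top τ with hτ | hτ
      · left
        have : S.comap M.toSubmodule.subtype = ⊥ := congrArg Subrepresentation.toSubmodule hτ
        rw [Submodule.eq_bot_iff] at this ⊢
        intro x hx
        exact congrArg Subtype.val (this ⟨x, hS hx⟩ hx)
      · right
        have : S.comap M.toSubmodule.subtype = ⊤ := congrArg Subrepresentation.toSubmodule hτ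
        refine le_antisymm hS fun x hx => ?_
        have h1 : (⟨x, hx⟩ : M.toSubmodule) ∈ S.comap M.toSubmodule.subtype := by
          rw [this]; trivial
        exact h1
  · rintro ⟨h0, h⟩
    have hne : (⊥ : Subrepresentation M.toRepresentation) ≠ ⊤ := by
      intro heq
      have h1 : (⊥ : Submodule ℝ M.toSubmodule) = ⊤ :=
        congrArg Subrepresentation.toSubmodule heq
      refine h0 ((Submodule.eq_bot_iff _).2 fun x hx => ?_)
      have h2 : (⟨x, hx⟩ : M.toSubmodule) ∈ (⊥ : Submodule ℝ M.toSubmodule) := by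
        rw [h1]; trivial
      exact congrArg Subtype.val h2
    have : Nontrivial (Subrepresentation M.toRepresentation) := ⟨⟨_, _, hne⟩⟩
    refine ⟨fun τ => ?_⟩
    have hstab : ∀ g, ∀ x ∈ τ.toSubmodule.map M.toSubmodule.subtype,
        ρ g x ∈ τ.toSubmodule.map M.toSubmodule.subtype := by
      rintro g _ ⟨x, hx, rfl⟩
      exact ⟨M.toRepresentation g x, τ.apply_mem_toSubmodule g hx, rfl⟩
    rcases h (τ.toSubmodule.map M.toSubmodule.subtype) (Submodule.map_subtype_le _ _) hstab with
      hτ | hτ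
    · left
      refine Subrepresentation.toSubmodule_injective ?_
      change τ.toSubmodule = ⊥
      refine (Submodule.eq_bot_iff _).2 fun x hx => Subtype.ext ?_
      have h1 : (x : U) ∈ τ.toSubmodule.map M.toSubmodule.subtype := ⟨x, hx, rfl⟩
      rw [hτ] at h1
      exact h1
    · right
      refine Subrepresentation.toSubmodule_injective ?_
      change τ.toSubmodule = ⊤
      refine eq_top_iff.2 fun x _ => ?_
      have h1 : (x : U) ∈ τ.toSubmodule.map M.toSubmodule.subtype := by rw [hτ]; exact x.2
      obtain ⟨y, hy, hyx⟩ := h1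
      rwa [← Subtype.ext hyx]

/-- Two subrepresentations are equivalent if an equivariant linear map carries one bijectively
onto the other. -/
theorem nonempty_equiv_of_map {U' : Type*} [AddCommGroup U'] [Module ℝ U']
    {ρ' : Representation ℝ G U'} (M : Subrepresentation ρ) (M' : Subrepresentation ρ')
    (f : U →ₗ[ℝ] U') (hf : ∀ g, ∀ x ∈ M.toSubmodule, f (ρ g x) = ρ' g (f x))
    (hinj : ∀ x ∈ M.toSubmodule, f x = 0 → x = 0)
    (hmap : M.toSubmodule.map f = M'.toSubmodule) :
    Nonempty (M.toRepresentation.Equiv M'.toRepresentation) := by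
  let e0 : M.toSubmodule →ₗ[ℝ] M'.toSubmodule :=
    f.restrict fun x hx => hmap ▸ Submodule.mem_map_of_mem hx
  have hbij : Function.Bijective e0 := by
    constructor
    · rw [← LinearMap.ker_eq_bot, LinearMap.ker_eq_bot']
      rintro ⟨x, hx⟩ h
      exact Subtype.ext (hinj x hx (congrArg Subtype.val h))
    · rintro ⟨y, hy⟩
      rw [← hmap] at hy
      obtain ⟨x, hx, rfl⟩ := hy
      exact ⟨⟨x, hx⟩, rfl⟩
  refine ⟨Representation.Equiv.mk (LinearEquiv.ofBijective e0 hbij) fun g => ?_⟩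
  ext x
  exact hf g x x.2

end General

variable {V : Type*} [AddCommGroup V] [Module ℝ V] {r d : ℕ} (b : Basis (Fin d) ℝ V)
variable {lam : YoungDiagram} (T : lam.cells ≃ Fin r)

/-! ### The image of a Young symmetrizer -/

/-- Write `y = z + u` with `z` in `H` and `u` orthogonal to it. Then `c u` lies in `H`, so its
squared length `⟨u, c' (c u)⟩` is zero. This lifts highest weight vectors in the image of a
symmetrizer to highest weight vectors. -/
theorem exists_mem_eq_of_adjoint {c c' : Module.End ℝ (⨂[ℝ]^r V)}
    (hadj : ∀ x y, form b (c x) y = form b x (c' y)) {H : Submodule ℝ (⨂[ℝ]^r V)}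
    (hc : ∀ x ∈ H, c x ∈ H) (hc' : ∀ x ∈ H, c' x ∈ H) {y : ⨂[ℝ]^r V} (hy : c y ∈ H) :
    ∃ z ∈ H, c z = c y := by
  obtain ⟨z, hz, u, hu, rfl⟩ := Submodule.mem_sup.1
    (show y ∈ H ⊔ (form b).orthogonal H by
      rw [(isCompl_orthogonal b H).sup_eq_top]; trivial)
  refine ⟨z, hz, ?_⟩
  have h1 : c u ∈ H := by
    have := H.sub_mem hy (hc z hz)
    rwa [map_add, add_sub_cancel_left] at this
  have h2 : c u = 0 := by
    refine eq_zero_of_form_self b ?_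
    rw [hadj, form_comm]
    rw [form_comm]
    rw [form_comm]
    exact hu _ (hc' _ h1)
  rw [map_add, h2, add_zero]

/-- If `f ∘ p ∘ q = f` then `q = 1`, so no sign ever enters and the coefficient counts the row
permutations fixing `f`. The set `S` is everything for a tableau word; in the branching it consists
of the boxes of the smaller diagram, and the time letter fills at most one further box per column.
-/
theorem coords_youngSymmetrizer_word_pos {f : Fin r → Fin d} (S : Fin r → Prop)
    (h1 : ∀ k, S k → (f k : ℕ) = rowOf T k) (h2 : ∀ k l, ¬ S k → S l → f k ≠ f l)
    (h3 : ∀ k l, ¬ S k → ¬ S l → colOf T k = colOf T l → k = l) :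
    0 < coords b (youngSymmetrizer V T (word b f)) f := by
  have key : ∀ p ∈ rowPerms T, ∀ q ∈ colPerms T, (f ∘ p) ∘ q = f → q = 1 := by
    intro p hp q hq h
    rw [← inv_eq_one]
    have hq' := (mem_colPerms T).1 (inv_mem_colPerms T hq)
    rw [mem_rowPerms] at hp
    have heq : ∀ k, f (p k) = f (q⁻¹ k) := by
      intro k
      have := congrFun h (q⁻¹ k)
      simpa using this
    have hor : ∀ k, q⁻¹ k = k ∨ ¬ S (q⁻¹ k) := by
      intro k
      by_cases hS : S (q⁻¹ k)
      · left
        have hpk : S (p k) := by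
          by_contra hn
          exact h2 _ _ hn hS (heq k)
        refine eq_of_row_col T ?_ (hq' k)
        rw [← h1 _ hS, ← heq, h1 _ hpk, hp]
      · exact Or.inr hS
    ext k
    rcases hor k with hk | hk
    · simp [hk]
    · have : q⁻¹ (q⁻¹ k) = q⁻¹ k := by
        rcases hor (q⁻¹ k) with h' | h'
        · exact h'
        · exact h3 _ _ h' hk (hq' _)
      rw [q⁻¹.injective this]
      rfl
  rw [youngSymmetrizer_eq, Module.End.mul_apply]
  have hexp : coords b (rowSym V T (colAlt V T (word b f))) f =
      ∑ p ∈ rowPerms T, if f ∘ p = f then 1 else 0 := by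
    simp only [rowSym, LinearMap.sum_apply, map_sum, Finset.sum_apply, coords_permAct]
    refine Finset.sum_congr rfl fun p hp => ?_
    rw [coords_colAlt_word, Finset.sum_eq_single 1]
    · simp
    · intro q hq hne
      rw [if_neg fun h => hne (key p hp q hq h)]
    · exact fun h => absurd (one_mem_colPerms T) h
  rw [hexp]
  refine Finset.sum_pos' (fun p _ => by split_ifs <;> norm_num) ⟨1, one_mem_rowPerms T, ?_⟩
  simp

theorem youngSymmetrizer_rowWord_ne_zero (h : lam.colLen 0 ≤ d) :
    youngSymmetrizer V T (word b (rowWord T h)) ≠ 0 := by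
  intro h0
  have := coords_youngSymmetrizer_word_pos b T (f := rowWord T h) (fun _ => True)
    (fun _ _ => rfl) (fun _ _ h => absurd trivial h) (fun _ _ h => absurd trivial h)
  rw [h0] at this
  simp at this

theorem rowSym_rowWord (h : lam.colLen 0 ≤ d) :
    rowSym V T (word b (rowWord T h)) = ((rowPerms T).card : ℝ) • word b (rowWord T h) := by
  rw [rowSym, LinearMap.sum_apply, Finset.sum_congr rfl (g := fun _ => word b (rowWord T h)),
    Finset.sum_const, Nat.cast_smul_eq_nsmul]
  intro p hp
  rw [permAct_word]
  congr 1
  ext k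
  exact (mem_rowPerms T).1 (inv_mem_rowPerms T hp) k

/-- If row symmetrization does not kill the column antisymmetrization of the word of a second
tableau, then the shape of the first tableau is dominated by the shape of the second. -/
theorem injOn_of_rowSym_colAlt_ne_zero {lam' : YoungDiagram} (T' : lam'.cells ≃ Fin r)
    (h : rowSym V T * colAlt V T' ≠ 0) :
    ∀ k l, colOf T' k = colOf T' l → rowOf T k = rowOf T l → k = l := by
  intro k l hcol hrow
  by_contra hkl
  refine h ?_
  have hp : Equiv.swap k l ∈ rowPerms T := by
    rw [mem_rowPerms]
    intro i
    by_cases hik : i = k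
    · subst hik; rw [Equiv.swap_apply_left, hrow]
    · by_cases hil : i = l
      · subst hil; rw [Equiv.swap_apply_right, hrow]
      · rw [Equiv.swap_apply_of_ne_of_ne hik hil]
  have hq : Equiv.swap k l ∈ colPerms T' := by
    rw [mem_colPerms]
    intro i
    by_cases hik : i = k
    · subst hik; rw [Equiv.swap_apply_left, hcol]
    · by_cases hil : i = l
      · subst hil; rw [Equiv.swap_apply_right, hcol]
      · rw [Equiv.swap_apply_of_ne_of_ne hik hil]
  have hleft : permAct V (Equiv.swap k l) * colAlt V T' = (-1 : ℝ) • colAlt V T' := by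
    simp only [colAlt, Finset.mul_sum, mul_smul_comm, permAct_mul, Finset.smul_sum, smul_smul]
    refine Finset.sum_equiv (Equiv.mulLeft (Equiv.swap k l)) (fun q => ?_) fun q _ => ?_
    · exact ⟨fun h => mul_mem_colPerms T' hq h, fun h => by
        simpa using mul_mem_colPerms T' hq h⟩
    · congr 1
      simp [Equiv.Perm.sign_mul, Equiv.Perm.sign_swap hkl]
  have h1 : rowSym V T * colAlt V T' = (-1 : ℝ) • (rowSym V T * colAlt V T') := by
    conv_lhs => rw [← rowSym_mul_permAct T hp, mul_assoc, hleft, mul_smul_comm]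
  refine LinearMap.ext fun x => ?_
  have h3 := LinearMap.congr_fun h1 x
  rw [LinearMap.smul_apply] at h3
  set y := (rowSym V T * colAlt V T') x
  have h2 : (2 : ℝ) • y = 0 := by
    rw [two_smul]
    nth_rewrite 1 [h3]
    simp
  exact (smul_eq_zero.1 h2).resolve_left two_ne_zero

/-- The highest weight vectors in the image of a Young symmetrizer. -/
theorem hw_range (h : lam.colLen 0 ≤ d) {x : ⨂[ℝ]^r V}
    (hx : x ∈ LinearMap.range (youngSymmetrizer V T)) (h0 : x ≠ 0) {κ : Fin d → ℕ}
    (hhw : x ∈ hw b d) (hκ : x ∈ wt b κ) :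
    κ = shapeWt d lam ∧ ∃ c : ℝ, x = c • youngSymmetrizer V T (word b (rowWord T h)) := by
  obtain ⟨y, rfl⟩ := hx
  -- The adjoint of row symmetrization after column antisymmetrization is the same pair in the
  -- opposite order, and both preserve highest weight vectors of weight `κ`.
  obtain ⟨z, ⟨hz1, hz2⟩, hzy⟩ := exists_mem_eq_of_adjoint b (c := youngSymmetrizer V T)
    (c' := colAlt V T * rowSym V T) (H := hw b d ⊓ wt b κ) (y := y)
    (fun x y => by
      rw [youngSymmetrizer_eq, Module.End.mul_apply, form_rowSym, form_colAlt]; rfl)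
    (fun x hx => ⟨map_mem_hw b (youngSymmetrizer_sumOp T) hx.1,
      map_mem_wt b (youngSymmetrizer_sumOp T) hx.2⟩)
    (fun x hx => ⟨map_mem_hw b (colAlt_sumOp T) (map_mem_hw b (rowSym_sumOp T) hx.1),
      map_mem_wt b (colAlt_sumOp T) (map_mem_wt b (rowSym_sumOp T) hx.2)⟩) ⟨hhw, hκ⟩
  rw [← hzy] at h0 ⊢
  rw [youngSymmetrizer_eq, Module.End.mul_apply] at h0 ⊢
  have hinj : ∀ w : Fin r → Fin d, colAlt V T (word b w) ≠ 0 →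
      ∀ k l, colOf T k = colOf T l → w k = w l → k = l := by
    intro w hw k l hcol hkl
    by_contra hne
    exact hw (colAlt_word_eq_zero T b hne hcol hkl)
  have hcz : colAlt V T z ≠ 0 := fun h => h0 (by rw [h, map_zero])
  have hz : colAlt V T z = ∑ w, coords b z w • colAlt V T (word b w) := by
    conv_lhs => rw [← sum_coords_smul_word b z, map_sum]
    simp only [map_smul]
  -- Two opposite dominance relations. A word of `z` that survives antisymmetrization shows that
  -- `lam` dominates `κ`; an antisymmetrized tableau word of row lengths `κ` that survives the row
  -- symmetrizer of `T` shows that `κ` dominates `lam`.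
  have hcont : content (rowWord T h) = κ := by
    obtain ⟨w, _, hwne⟩ := Finset.exists_ne_zero_of_sum_ne_zero (hz ▸ hcz)
    have hw1 : content w = κ := hz2 w fun h => hwne (by rw [h, zero_smul])
    have hw2 := card_lt_le T (hinj w fun h => hwne (by rw [h, smul_zero]))
    have hspan := hw_inf_wt_le_span b κ (x := colAlt V T z) (
      ⟨map_mem_hw b (colAlt_sumOp T) hz1, map_mem_wt b (colAlt_sumOp T) hz2⟩)
    obtain ⟨lam', h', T', hκ', hne⟩ : ∃ (lam' : YoungDiagram) (h' : lam'.colLen 0 ≤ d)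
        (T' : lam'.cells ≃ Fin r), shapeWt d lam' = κ ∧
        rowSym V T (colAlt V T' (word b (rowWord T' h'))) ≠ 0 := by
      by_contra! hcon
      refine h0 ?_
      have hle : Submodule.span ℝ (polytabloids (r := r) b κ) ≤ LinearMap.ker (rowSym V T) := by
        rw [Submodule.span_le]
        rintro _ ⟨lam', h', T', h1, rfl⟩
        exact hcon lam' h' T' h1
      exact hle hspan
    have h3 := card_lt_le T' (w := rowWord T h) fun k l hcol hrow =>
      injOn_of_rowSym_colAlt_ne_zero (V := V) T T' (fun h => hne (LinearMap.congr_fun h _)) k l hcol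
        (congrArg Fin.val hrow)
    rw [← hw1]
    refine content_eq_of_card_lt fun i => le_antisymm ?_ (hw2 i)
    refine (h3 i).trans (le_of_eq ?_)
    have h4 : content (rowWord T' h') = content w := by rw [content_rowWord, hκ', hw1]
    rw [card_lt_eq_sum, ← h4, ← card_lt_eq_sum]
    rfl
  refine ⟨by rw [← hcont, content_rowWord], ?_⟩
  -- A surviving word of this content is a column permutation of the tableau word, so its
  -- antisymmetrization is the same vector up to sign.
  have hmult : ∀ w, ∃ c : ℝ, coords b z w • colAlt V T (word b w) =
      c • colAlt V T (word b (rowWord T h)) := by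
    intro w
    by_cases hw : coords b z w = 0
    · exact ⟨0, by simp [hw]⟩
    by_cases hw' : colAlt V T (word b w) = 0
    · exact ⟨0, by simp [hw']⟩
    obtain ⟨q, hq, rfl⟩ := exists_colPerm T h (hinj w hw') ((hz2 w hw).trans hcont.symm)
    have h1 : word b (rowWord T h ∘ q) = permAct V q⁻¹ (word b (rowWord T h)) := by
      rw [permAct_word]; rfl
    have h2 := LinearMap.congr_fun (colAlt_mul_permAct (V := V) T (inv_mem_colPerms T hq))
      (word b (rowWord T h))
    rw [Module.End.mul_apply, LinearMap.smul_apply] at h2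
    rw [h1, h2, smul_smul]
    exact ⟨_, rfl⟩
  choose c hc using hmult
  refine ⟨∑ w, c w, ?_⟩
  rw [hz, Finset.sum_congr rfl fun w _ => hc w, ← Finset.sum_smul, map_smul]
  rfl

theorem youngSymmetrizer_tensorRep (g : LinearMap.GeneralLinearGroup ℝ V) (x : ⨂[ℝ]^r V) :
    youngSymmetrizer V T (tensorRep V r g x) = tensorRep V r g (youngSymmetrizer V T x) :=
  (LinearMap.congr_fun (tensorRep_mul_youngSymmetrizer V T g) x).symm

theorem _root_.Subrepresentation.glStable {b : Basis (Fin d) ℝ V}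
    (M : Subrepresentation (tensorRep V r)) (m : ℕ) :
    GlStable b m M.toSubmodule :=
  glStable_of_tensorRep b (fun g _ hx => M.apply_mem_toSubmodule g hx) m

include b in
theorem isIrreducible_youngSubrep (h : lam.colLen 0 ≤ d) :
    (youngSubrep V T).toRepresentation.IsIrreducible := by
  rw [isIrreducible_iff]
  refine ⟨fun h0 => ?_, fun S hS hg => ?_⟩
  · have : youngSymmetrizer V T (word b (rowWord T h)) ∈ (youngSubrep V T).toSubmodule := ⟨_, rfl⟩
    rw [h0] at this
    exact youngSymmetrizer_rowWord_ne_zero b T h this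
  · refine ((youngSubrep V T).glStable (b := b) d).eq_bot_or_eq b (Nat.le_succ d)
      (youngSymmetrizer V T (word b (rowWord T h))) ?_ hS (glStable_of_tensorRep b hg d)
    intro κ x hx hhw hκ
    by_cases h0 : x = 0
    · exact ⟨0, by simp [h0]⟩
    · exact (hw_range b T h hx h0 hhw hκ).2

include b in
/-- Every irreducible space of tensors is mapped isomorphically by a Young symmetrizer. -/
theorem exists_youngSymmetrizer (M : Subrepresentation (tensorRep V r))
    (hM : M.toRepresentation.IsIrreducible) :
    ∃ (lam : YoungDiagram) (_ : lam.colLen 0 ≤ d) (T : lam.cells ≃ Fin r),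
      (∀ x ∈ M.toSubmodule, youngSymmetrizer V T x = 0 → x = 0) ∧
      M.toSubmodule.map (youngSymmetrizer V T) = LinearMap.range (youngSymmetrizer V T) := by
  rw [isIrreducible_iff] at hM
  obtain ⟨κ, x, hx, hx0, hhw, hκ⟩ := (M.glStable (b := b) d).exists_hw_vector b (Nat.le_succ d) hM.1
  obtain ⟨lam, h, T, -, hne⟩ := exists_shape_of_hw b hhw hκ hx0
  -- Moving the symmetrizer to the other side, where the tableau word is already row symmetric,
  -- leaves a positive multiple of the nonzero product with the antisymmetrized word.
  have hcx : youngSymmetrizer V T x ≠ 0 := by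
    intro h0
    have h1 : form b (youngSymmetrizer V T x) (word b (rowWord T h)) = 0 := by rw [h0]; simp
    rw [youngSymmetrizer_eq, Module.End.mul_apply, form_rowSym, rowSym_rowWord, form_colAlt,
      map_smul, map_smul, smul_eq_mul] at h1
    exact hne ((mul_eq_zero.1 h1).resolve_left (card_rowPerms_pos T).ne')
  refine ⟨lam, h, T, ?_, ?_⟩
  · rcases hM.2 (M.toSubmodule ⊓ LinearMap.ker (youngSymmetrizer V T)) inf_le_left
      (fun g y hy => ⟨M.apply_mem_toSubmodule g hy.1, LinearMap.mem_ker.2 <| by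
        rw [ youngSymmetrizer_tensorRep, LinearMap.mem_ker.1 hy.2,
          map_zero]⟩) with h1 | h1
    · intro y hy hy0
      have : y ∈ M.toSubmodule ⊓ LinearMap.ker (youngSymmetrizer V T) := ⟨hy, hy0⟩
      rwa [h1] at this
    · rw [← h1] at hx
      exact absurd hx.2 hcx
  · rcases ((isIrreducible_iff _).1 (isIrreducible_youngSubrep b T h)).2
      (M.toSubmodule.map (youngSymmetrizer V T)) (by rintro _ ⟨y, -, rfl⟩; exact ⟨y, rfl⟩)
      (by
        rintro g _ ⟨y, hy, rfl⟩
        exact ⟨tensorRep V r g y, M.apply_mem_toSubmodule g hy,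
          youngSymmetrizer_tensorRep T g y⟩) with h1 | h1
    · have : youngSymmetrizer V T x ∈ M.toSubmodule.map (youngSymmetrizer V T) :=
        Submodule.mem_map_of_mem hx
      rw [h1] at this
      exact absurd this hcx
    · exact h1

theorem card_eq_of_tableau (T : lam.cells ≃ Fin r) : lam.card = r := by
  have := Fintype.card_congr T
  simpa using this

theorem hasShape_of_map (M : Subrepresentation (tensorRep V r)) (T : lam.cells ≃ Fin r)
    (hinj : ∀ x ∈ M.toSubmodule, youngSymmetrizer V T x = 0 → x = 0)
    (hmap : M.toSubmodule.map (youngSymmetrizer V T) = LinearMap.range (youngSymmetrizer V T)) :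
    HasShape M.toRepresentation lam := by
  obtain rfl := card_eq_of_tableau T
  exact ⟨T, nonempty_equiv_of_map M (youngSubrep V T) (youngSymmetrizer V T)
    (fun g x _ => youngSymmetrizer_tensorRep T g x) hinj hmap⟩

/-! ### Uniqueness of the type -/

/-- The graph of an equivariant map is stable under the group acting on both tensor powers at once,
hence under the infinitesimal action. -/
theorem intertwining_sumOp {r' : ℕ} {M : Subrepresentation (tensorRep V r)}
    {M' : Subrepresentation (tensorRep V r')}
    (φ : M.toRepresentation.IntertwiningMap M'.toRepresentation) (i j : Fin d)
    (x : M.toSubmodule) : ∃ y : M.toSubmodule,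
      (y : ⨂[ℝ]^r V) = sumOp Finset.univ (unit b i j) (x : ⨂[ℝ]^r V) ∧
      (φ y : ⨂[ℝ]^r' V) = sumOp Finset.univ (unit b i j) (φ x : ⨂[ℝ]^r' V) := by
  let Γ : Submodule ℝ ((⨂[ℝ]^r V) × (⨂[ℝ]^r' V)) :=
    LinearMap.range (M.toSubmodule.subtype.prod (M'.toSubmodule.subtype ∘ₗ φ.toLinearMap))
  obtain ⟨y, hy⟩ := sumOp_mem_of_map_mem Γ (unit b i j) (unit b i j) infinite_ne_neg_one (by
    rintro t ht _ ⟨y, rfl⟩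
    obtain ⟨g, hg⟩ := isUnit_one_add_smul_unit b i j ht
    refine ⟨M.toRepresentation g y, ?_⟩
    refine Prod.ext ?_ ?_
    · change PiTensorProduct.map (fun _ => (g : Module.End ℝ V)) (y : ⨂[ℝ]^r V) = _
      rw [hg]; rfl
    · change ((φ (M.toRepresentation g y) : M'.toSubmodule) : ⨂[ℝ]^r' V) = _
      rw [φ.isIntertwining]
      change PiTensorProduct.map (fun _ => (g : Module.End ℝ V)) (φ y : ⨂[ℝ]^r' V) = _
      rw [hg]; rfl) _ ⟨x, rfl⟩
  exact ⟨y, (Prod.ext_iff.1 hy).1, (Prod.ext_iff.1 hy).2⟩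

/-- The scalar 2 detects the rank, so equivalent nonzero spaces of tensors have equal rank. -/
theorem tensorRep_two (x : ⨂[ℝ]^r V) :
    tensorRep V r (LinearMap.GeneralLinearGroup.ofLinearEquiv
      (LinearEquiv.smulOfNeZero ℝ V (2 : ℝ) two_ne_zero)) x = (2 : ℝ) ^ r • x := by
  have : tensorRep V r (LinearMap.GeneralLinearGroup.ofLinearEquiv
      (LinearEquiv.smulOfNeZero ℝ V (2 : ℝ) two_ne_zero)) = (2 : ℝ) ^ r • 1 := by
    refine PiTensorProduct.ext ?_
    ext v
    have := (PiTensorProduct.tprod ℝ (s := fun _ : Fin r => V)).map_smul_univ (fun _ => (2 : ℝ)) v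
    rw [Finset.prod_const, Finset.card_univ, Fintype.card_fin] at this
    simp only [tensorRep, LinearMap.compMultilinearMap_apply, MonoidHom.coe_mk, OneHom.coe_mk,
      PiTensorProduct.map_tprod, LinearMap.smul_apply, Module.End.one_apply]
    exact this
  rw [this]
  simp

-- A column with more than `d` boxes has a repeated letter in every word.
include b in
theorem colAlt_eq_zero_of_lt_colLen (h : d < lam.colLen 0) : colAlt V T = 0 := by
  refine word_hom_ext b fun w => ?_
  obtain ⟨k, hk, l, hl, hne, heq⟩ := Finset.exists_ne_map_eq_of_card_lt_of_maps_to
    (s := Finset.univ.filter fun k => colOf T k = 0) (t := Finset.univ) (f := w)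
    (by rw [card_col, Finset.card_univ, Fintype.card_fin]; exact h) (fun _ _ => by simp)
  simp at hk hl
  exact colAlt_word_eq_zero T b hne (hk.trans hl.symm) heq

theorem eq_of_shapeWt_eq {lam lam' : YoungDiagram} (h : lam.colLen 0 ≤ d)
    (h' : lam'.colLen 0 ≤ d) (heq : shapeWt d lam = shapeWt d lam') : lam = lam' := by
  have key : ∀ {lam lam' : YoungDiagram}, lam.colLen 0 ≤ d →
      shapeWt d lam = shapeWt d lam' → lam ≤ lam' := by
    rintro lam lam' h heq ⟨i, j⟩ hij
    have hi : i < d := lt_of_lt_of_le (YoungDiagram.mem_iff_lt_colLen.1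
      (lam.up_left_mem le_rfl (Nat.zero_le j) hij)) h
    rw [YoungDiagram.mem_iff_lt_rowLen] at hij ⊢
    have := congrFun heq ⟨i, hi⟩
    simp only [shapeWt] at this
    omega
  exact le_antisymm (key h heq) (key h' heq.symm)

variable {b} in
include b in
/-- The shape of a nonzero space of tensors has the row lengths given by the weight of a highest
weight vector. -/
theorem HasShape.shapeWt_eq {M : Subrepresentation (tensorRep V r)} {lam' : YoungDiagram}
    (hM : HasShape M.toRepresentation lam') {κ : Fin d → ℕ} {x : ⨂[ℝ]^r V}
    (hx : x ∈ M.toSubmodule) (h0 : x ≠ 0) (hhw : x ∈ hw b d) (hκ : x ∈ wt b κ) :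
    lam'.card = r ∧ lam'.colLen 0 ≤ d ∧ shapeWt d lam' = κ := by
  obtain ⟨T, ⟨θ⟩⟩ := hM
  have hθ0 : ∀ y : M.toSubmodule, (θ y : ⨂[ℝ]^lam'.card V) = 0 → y = 0 := by
    intro y hy
    exact θ.toLinearEquiv.map_eq_zero_iff.1 (Subtype.ext hy)
  set x' : M.toSubmodule := ⟨x, hx⟩ with hx'
  have hx'0 : (θ x' : ⨂[ℝ]^lam'.card V) ≠ 0 := fun h => h0 (congrArg Subtype.val (hθ0 x' h))
  have hcard : lam'.card = r := by
    set g := LinearMap.GeneralLinearGroup.ofLinearEquiv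
      (LinearEquiv.smulOfNeZero ℝ V (2 : ℝ) two_ne_zero)
    have h1 : M.toRepresentation g x' = (2 : ℝ) ^ r • x' := Subtype.ext (tensorRep_two x)
    have h2 : ((youngSubrep V T).toRepresentation g (θ x') : (youngSubrep V T).toSubmodule) =
        (2 : ℝ) ^ lam'.card • θ x' := Subtype.ext (tensorRep_two _)
    have h3 := θ.toIntertwiningMap.isIntertwining _ _ g x'
    rw [h1, map_smul] at h3
    have h4 : (2 : ℝ) ^ r • (θ x' : ⨂[ℝ]^lam'.card V) = (2 : ℝ) ^ lam'.card • (θ x' : _) :=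
      congrArg Subtype.val (h3.trans h2)
    have h5 := smul_left_injective ℝ hx'0 h4
    exact (Nat.pow_right_injective le_rfl (by exact_mod_cast h5)).symm
  have hlen : lam'.colLen 0 ≤ d := by
    by_contra! h
    obtain ⟨y, hy⟩ := (θ x').2
    rw [youngSymmetrizer_eq, colAlt_eq_zero_of_lt_colLen b T h, mul_zero] at hy
    exact hx'0 hy.symm
  refine ⟨hcard, hlen, ?_⟩
  -- The equivalence carries the highest weight vector to one of the same weight in the image of the
  -- symmetrizer, where that weight is known.
  refine ((hw_range b T hlen (θ x').2 hx'0 (κ := κ) ?_ ?_).1).symm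
  · intro i j hij hj
    obtain ⟨y, hy1, hy2⟩ := intertwining_sumOp b θ.toIntertwiningMap i j x'
    rw [hhw i j hij hj] at hy1
    have : y = 0 := Subtype.ext hy1
    rw [this, map_zero] at hy2
    exact hy2.symm
  · rw [mem_wt_iff] at hκ ⊢
    intro i
    obtain ⟨y, hy1, hy2⟩ := intertwining_sumOp b θ.toIntertwiningMap i i x'
    rw [hκ i] at hy1
    have : y = (κ i : ℝ) • x' := Subtype.ext hy1
    rw [this, map_smul] at hy2
    exact hy2.symm

end

end TensorSignature

namespace TensorSignature

noncomputable section

open Module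

variable {V : Type*} [AddCommGroup V] [Module ℝ V] {r d n : ℕ}

/-! ### Weight projections and spaces generated by lists of operators -/

section WeightProjection

variable (b : Basis (Fin d) ℝ V)

/-- The projection to the tensors of weight `κ`. -/
def wtProj (κ : Fin d → ℕ) : Module.End ℝ (⨂[ℝ]^r V) :=
  (coords b).symm.toLinearMap ∘ₗ
    LinearMap.pi (fun w => (if content w = κ then (1 : ℝ) else 0) • LinearMap.proj w) ∘ₗ
      (coords b).toLinearMap

theorem coords_wtProj (κ : Fin d → ℕ) (x : ⨂[ℝ]^r V) (w : Fin r → Fin d) :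
    coords b (wtProj b κ x) w = if content w = κ then coords b x w else 0 := by
  simp only [wtProj, LinearMap.comp_apply, LinearEquiv.coe_coe, LinearEquiv.apply_symm_apply,
    LinearMap.pi_apply, LinearMap.smul_apply, LinearMap.proj_apply, smul_eq_mul, ite_mul, one_mul,
    zero_mul]

theorem wtProj_of_mem {κ : Fin d → ℕ} {x : ⨂[ℝ]^r V} (hx : x ∈ wt b κ) : wtProj b κ x = x := by
  refine coords_ext b fun w => ?_
  rw [coords_wtProj]
  split_ifs with h
  · rfl
  · by_contra hne
    exact h (hx w (Ne.symm hne))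

theorem wtProj_of_mem_of_ne {κ κ' : Fin d → ℕ} {x : ⨂[ℝ]^r V} (hx : x ∈ wt b κ') (h : κ' ≠ κ) :
    wtProj b κ x = 0 := by
  refine coords_ext b fun w => ?_
  rw [coords_wtProj, map_zero, Pi.zero_apply]
  split_ifs with hw
  · by_contra hne
    exact h ((hx w hne).symm.trans hw)
  · rfl

theorem mem_span_inter_wt {s : Set (⨂[ℝ]^r V)} (hs : ∀ x ∈ s, ∃ κ, x ∈ wt b κ) {κ : Fin d → ℕ}
    {v : ⨂[ℝ]^r V} (hv : v ∈ Submodule.span ℝ s) (hκ : v ∈ wt b κ) :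
    v ∈ Submodule.span ℝ (s ∩ {x | x ∈ wt b κ}) := by
  rw [← wtProj_of_mem b hκ]
  have : (Submodule.span ℝ s).map (wtProj b κ) ≤ Submodule.span ℝ (s ∩ {x | x ∈ wt b κ}) := by
    rw [Submodule.map_span, Submodule.span_le]
    rintro _ ⟨x, hx, rfl⟩
    obtain ⟨κ', hκ'⟩ := hs x hx
    by_cases h : κ' = κ
    · subst h
      rw [wtProj_of_mem b hκ']
      exact Submodule.subset_span ⟨hx, hκ'⟩
    · rw [wtProj_of_mem_of_ne b hκ' h]
      exact Submodule.zero_mem _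
  exact this (Submodule.mem_map_of_mem hv)

/-! ### Products of commuting operators applied to a vector -/

/-- The product of the operators with indices in a list. -/
def listOp (X : Fin n → Module.End ℝ (⨂[ℝ]^r V)) (L : List (Fin n)) : Module.End ℝ (⨂[ℝ]^r V) :=
  (L.map X).prod

theorem listOp_cons (X : Fin n → Module.End ℝ (⨂[ℝ]^r V)) (i : Fin n) (L : List (Fin n))
    (x : ⨂[ℝ]^r V) : listOp X (i :: L) x = X i (listOp X L x) := rfl

theorem listOp_perm {X : Fin n → Module.End ℝ (⨂[ℝ]^r V)} (hX : ∀ i j, Commute (X i) (X j))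
    {L L' : List (Fin n)} (h : ∀ i, L.count i = L'.count i) : listOp X L = listOp X L' := by
  refine ((List.perm_iff_count.2 h).map X).prod_eq' ?_
  rw [List.pairwise_map]
  exact List.pairwise_of_forall fun i j => hX i j

/-- The space generated by a vector under a family of operators. -/
def orbitSpan (X : Fin n → Module.End ℝ (⨂[ℝ]^r V)) (x : ⨂[ℝ]^r V) : Submodule ℝ (⨂[ℝ]^r V) :=
  Submodule.span ℝ (Set.range fun L => listOp X L x)

theorem map_mem_orbitSpan (X : Fin n → Module.End ℝ (⨂[ℝ]^r V)) {x y : ⨂[ℝ]^r V} (i : Fin n)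
    (hy : y ∈ orbitSpan X x) : X i y ∈ orbitSpan X x := by
  have : orbitSpan X x ≤ (orbitSpan X x).comap (X i) := by
    conv_lhs => rw [orbitSpan]
    rw [Submodule.span_le]
    rintro _ ⟨L, rfl⟩
    exact Submodule.subset_span ⟨i :: L, rfl⟩
  exact this hy

theorem self_mem_orbitSpan (X : Fin n → Module.End ℝ (⨂[ℝ]^r V)) (x : ⨂[ℝ]^r V) :
    x ∈ orbitSpan X x := Submodule.subset_span ⟨[], rfl⟩

theorem orbitSpan_le {X : Fin n → Module.End ℝ (⨂[ℝ]^r V)} {x : ⨂[ℝ]^r V}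
    {S : Submodule ℝ (⨂[ℝ]^r V)} (hx : x ∈ S) (hS : ∀ i, ∀ y ∈ S, X i y ∈ S) :
    orbitSpan X x ≤ S := by
  rw [orbitSpan, Submodule.span_le]
  rintro _ ⟨L, rfl⟩
  induction L with
  | nil => exact hx
  | cons i L ih => exact hS i _ ih

/-- Moving `E` past one generator costs a multiple of another generator, so `E` can be pushed
through any product until it meets `x`, which it kills. -/
theorem orbitSpan_stable {X : Fin n → Module.End ℝ (⨂[ℝ]^r V)} {x : ⨂[ℝ]^r V}
    {E : Module.End ℝ (⨂[ℝ]^r V)} (hx : E x = 0)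
    (hE : ∀ k y, ∃ l, ∃ c : ℝ, E (X k y) = X k (E y) + c • X l y) :
    ∀ y ∈ orbitSpan X x, E y ∈ orbitSpan X x := by
  have : orbitSpan X x ≤ (orbitSpan X x).comap E := by
    conv_lhs => rw [orbitSpan]
    rw [Submodule.span_le]
    rintro _ ⟨L, rfl⟩
    induction L with
    | nil =>
      change E x ∈ orbitSpan X x
      rw [hx]; exact Submodule.zero_mem _
    | cons i L ih =>
      change E (X i (listOp X L x)) ∈ orbitSpan X x
      obtain ⟨l, c, h⟩ := hE i (listOp X L x)
      rw [h]
      exact Submodule.add_mem _ (map_mem_orbitSpan X i ih) (Submodule.smul_mem _ _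
        (map_mem_orbitSpan X l (Submodule.subset_span ⟨L, rfl⟩)))
  exact this

/-- Weights have natural number entries, so a product that would need a negative entry vanishes; the
weight is recorded additively to avoid truncated subtraction. -/
theorem listOp_mem_wt (p q : Fin n → Fin d) {κ : Fin d → ℕ} {x : ⨂[ℝ]^r V} (hx : x ∈ wt b κ)
    (L : List (Fin n)) :
    listOp (fun i => sumOp Finset.univ (unit b (p i) (q i))) L x = 0 ∨
    ∃ κ', listOp (fun i => sumOp Finset.univ (unit b (p i) (q i))) L x ∈ wt b κ' ∧
      κ' + (L.map fun i => Pi.single (q i) 1).sum = κ + (L.map fun i => Pi.single (p i) 1).sum := by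
  induction L with
  | nil => exact Or.inr ⟨κ, hx, by simp⟩
  | cons i L ih =>
    by_cases h0 : listOp (fun i => sumOp Finset.univ (unit b (p i) (q i))) (i :: L) x = 0
    · exact Or.inl h0
    rcases ih with h | ⟨κ', h1, h2⟩
    · left
      rw [listOp_cons, h, map_zero]
    · obtain ⟨κ'', h3⟩ := exists_wt_of_sumOp_ne_zero b h1 h0
      refine Or.inr ⟨κ'', sumOp_mem_wt b h1 h3, ?_⟩
      rw [List.map_cons, List.map_cons, List.sum_cons, List.sum_cons, ← add_assoc, h3,
        add_right_comm, h2]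
      abel

/-- A nonzero weight vector in the space generated by a weight vector `x` is a combination of
products of operators applied to `x` that have the right weight. -/
theorem mem_span_listOp (p q : Fin n → Fin d) {κ κ' : Fin d → ℕ} {x v : ⨂[ℝ]^r V}
    (hx : x ∈ wt b κ) (hv : v ∈ orbitSpan (fun i => sumOp Finset.univ (unit b (p i) (q i))) x)
    (hv' : v ∈ wt b κ') :
    v ∈ Submodule.span ℝ {y | ∃ L : List (Fin n),
      y = listOp (fun i => sumOp Finset.univ (unit b (p i) (q i))) L x ∧ 
      κ' + (L.map fun i => Pi.single (q i) 1).sum =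
        κ + (L.map fun i => Pi.single (p i) 1).sum} := by
  have h := mem_span_inter_wt b (s := Set.range fun L =>
    listOp (fun i => sumOp Finset.univ (unit b (p i) (q i))) L x) (by
      rintro _ ⟨L, rfl⟩
      rcases listOp_mem_wt b p q hx L with h | ⟨κ', h, -⟩
      · exact ⟨κ, by simp only [h]; exact Submodule.zero_mem _⟩
      · exact ⟨κ', h⟩) hv hv'
  refine (Submodule.span_le.2 ?_) h
  rintro _ ⟨⟨L, rfl⟩, hL⟩
  simp only at hL
  by_cases h0 : listOp (fun i => sumOp Finset.univ (unit b (p i) (q i))) L x = 0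
  · simp only [h0]; exact Submodule.zero_mem _
  · rcases listOp_mem_wt b p q hx L with h | ⟨κ'', h1, h2⟩
    · exact absurd h h0
    · rw [weight_unique b h1 hL h0] at h2
      exact Submodule.subset_span ⟨L, rfl, h2⟩

end WeightProjection

theorem sum_single_eq (p : Fin n → Fin d) (L : List (Fin n)) (a : Fin d) :
    (L.map fun i => (Pi.single (p i) 1 : Fin d → ℕ)).sum a = L.countP fun i => p i = a := by
  induction L with
  | nil => simp
  | cons i L ih =>
    rw [List.map_cons, List.sum_cons, Pi.add_apply, ih, List.countP_cons, add_comm]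
    congr 1
    by_cases h : p i = a
    · subst h; simp
    · simp [h, Ne.symm h]

/-! ### Branching: weights of the highest weight vectors -/

variable (b : Basis (Fin (n + 1)) ℝ V) {lam : YoungDiagram} (T : lam.cells ≃ Fin r)

theorem range_glStable (m : ℕ) : GlStable b m (LinearMap.range (youngSymmetrizer V T)) :=
  (youngSubrep V T).glStable m

/-- The raising operators from the last basis vector. -/
def raiseLast (i : Fin n) : Module.End ℝ (⨂[ℝ]^r V) :=
  sumOp Finset.univ (unit b i.castSucc (Fin.last n))

/-- The lowering operators to the last basis vector. -/
def lowerLast (i : Fin n) : Module.End ℝ (⨂[ℝ]^r V) :=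
  sumOp Finset.univ (unit b (Fin.last n) i.castSucc)

theorem raiseLast_commute (i j : Fin n) :
    Commute (raiseLast (r := r) b i) (raiseLast b j) := by
  refine LinearMap.ext fun x => ?_
  have := sumOp_unit_lie b Finset.univ i.castSucc (Fin.last n) j.castSucc (Fin.last n) x
  rw [if_neg (Fin.castSucc_lt_last j).ne', if_neg (Fin.castSucc_lt_last i).ne', sub_zero,
    add_zero] at this
  exact this

theorem diag_mem_orbitSpan (p q : Fin n → Fin (n + 1)) {κ : Fin (n + 1) → ℕ} {x : ⨂[ℝ]^r V}
    (hx : x ∈ wt b κ) (i : Fin (n + 1)) :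
    ∀ y ∈ orbitSpan (fun i => sumOp Finset.univ (unit b (p i) (q i))) x,
      sumOp Finset.univ (unit b i i) y ∈
        orbitSpan (fun i => sumOp Finset.univ (unit b (p i) (q i))) x := by
  have : orbitSpan (fun i => sumOp Finset.univ (unit b (p i) (q i))) x ≤
      (orbitSpan (fun i => sumOp Finset.univ (unit b (p i) (q i))) x).comap
        (sumOp Finset.univ (unit b i i)) := by
    conv_lhs => rw [orbitSpan]
    rw [Submodule.span_le]
    rintro _ ⟨L, rfl⟩
    change sumOp Finset.univ (unit b i i) (listOp (fun i => sumOp Finset.univ (unit b (p i) (q i))) L x) ∈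
      orbitSpan (fun i => sumOp Finset.univ (unit b (p i) (q i))) x
    rcases listOp_mem_wt b p q hx L with h | ⟨κ', h, -⟩
    · rw [h, map_zero]; exact Submodule.zero_mem _
    · rw [(mem_wt_iff b).1 h i]
      exact Submodule.smul_mem _ _ (Submodule.subset_span ⟨L, rfl⟩)
  exact this

/-- The operators turning time into space generate from `x` a space stable under every raising
operator of `gl(n+1)`. It therefore contains a `GL(n+1)` highest weight vector, which is unique up
to a factor. Comparison of weights fixes how often each operator is used, and since the operators
commute, these counts determine the product. -/
theorem exists_raise (h : lam.colLen 0 ≤ n + 1) {κ : Fin (n + 1) → ℕ} {x : ⨂[ℝ]^r V}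
    (hx : x ∈ LinearMap.range (youngSymmetrizer V T)) (h0 : x ≠ 0) (hhw : x ∈ hw b n)
    (hκ : x ∈ wt b κ) : ∃ (L : List (Fin n)) (c : ℝ),
      youngSymmetrizer V T (word b (rowWord T h)) = c • listOp (raiseLast b) L x ∧
      ∀ j : Fin n, κ j.castSucc + L.count j = lam.rowLen j := by
  have hstab := range_glStable b T (n + 1)
  have hle : orbitSpan (raiseLast b) x ≤ LinearMap.range (youngSymmetrizer V T) :=
    orbitSpan_le hx fun i y hy => hstab _ _ i.castSucc.2 (Fin.last n).2 y hy
  have hne : orbitSpan (raiseLast b) x ≠ ⊥ := fun hbot => h0 (by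
    have := self_mem_orbitSpan (raiseLast b) x
    rwa [hbot] at this)
  obtain ⟨κ', y, hy, hy0, hyhw, hyκ⟩ := exists_hw_vector b (m := n + 1) hne
    (diag_mem_orbitSpan b _ _ hκ) (by
      intro i j hij _ y hy
      obtain ⟨i, rfl⟩ := Fin.exists_castSucc_eq.2 (Fin.ne_last_of_lt hij)
      rcases Fin.eq_castSucc_or_eq_last j with ⟨j, rfl⟩ | rfl
      · refine orbitSpan_stable (hhw _ _ hij j.2) (fun k z => ?_) y hy
        have := sumOp_unit_lie b Finset.univ i.castSucc j.castSucc k.castSucc (Fin.last n) z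
        rw [if_neg (Fin.castSucc_lt_last i).ne', sub_zero] at this
        refine ⟨i, if j.castSucc = k.castSucc then 1 else 0, ?_⟩
        rw [raiseLast, this, raiseLast]
        split_ifs <;> simp
      · exact map_mem_orbitSpan _ i hy)
  obtain ⟨rfl, c, hc⟩ := hw_range b T h (hle hy) hy0 hyhw hyκ
  have hspan := mem_span_listOp b _ _ hκ hy hyκ
  have hcount : ∀ L : List (Fin n), shapeWt (n + 1) lam +
      (L.map fun _ => (Pi.single (Fin.last n) 1 : Fin (n + 1) → ℕ)).sum =
      κ + (L.map fun i => (Pi.single i.castSucc 1 : Fin (n + 1) → ℕ)).sum →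
      ∀ j : Fin n, κ j.castSucc + L.count j = lam.rowLen j := by
    intro L hL j
    have h1 := congrFun hL j.castSucc
    rw [Pi.add_apply, Pi.add_apply, sum_single_eq, sum_single_eq (fun i => i.castSucc)] at h1
    rw [List.countP_eq_zero.2 (by simp [(Fin.castSucc_lt_last j).ne']), add_zero] at h1
    rw [List.count]
    simp only [Fin.castSucc_inj] at h1
    exact h1.symm
  -- If no list had the required counts, the nonzero vector `y` would lie in the span of the empty
  -- set.
  have hex : ∃ L : List (Fin n), ∀ j : Fin n, κ j.castSucc + L.count j = lam.rowLen j := by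
    by_contra! hcon
    refine hy0 ?_
    have hempty : {z | ∃ L : List (Fin n), z = listOp (raiseLast b) L x ∧
        shapeWt (n + 1) lam + (L.map fun _ => (Pi.single (Fin.last n) 1 : Fin (n + 1) → ℕ)).sum =
        κ + (L.map fun i => (Pi.single i.castSucc 1 : Fin (n + 1) → ℕ)).sum} = ∅ := by
      rw [Set.eq_empty_iff_forall_notMem]
      rintro z ⟨L, -, hL⟩
      obtain ⟨j, hj⟩ := hcon L
      exact hj (hcount L hL j)
    have := hspan
    erw [hempty, Submodule.span_empty] at this
    exact this
  obtain ⟨L, hL⟩ := hex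
  have hy' : ∃ a : ℝ, a • listOp (raiseLast b) L x = y := by
    rw [← Submodule.mem_span_singleton]
    refine Submodule.span_mono ?_ hspan
    rintro z ⟨L', rfl, hL'⟩
    rw [Set.mem_singleton_iff]
    refine LinearMap.congr_fun (listOp_perm (raiseLast_commute b) fun i => ?_) x
    have h1 := hcount L' hL' i
    have h2 := hL i
    omega
  obtain ⟨a, ha⟩ := hy'
  have hc0 : c ≠ 0 := fun hc0 => hy0 (by rw [hc, hc0, zero_smul])
  refine ⟨L, c⁻¹ * a, ?_, hL⟩
  rw [mul_smul, ha, hc, inv_smul_smul₀ hc0]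

/-- The product of raising operators depends only on the weight, so it is the same for all vectors
concerned. A combination of `x` and `y` that it kills must be zero, because a nonzero one would be
raised to the nonzero highest weight vector. -/
theorem branch_unique (h : lam.colLen 0 ≤ n + 1) {κ : Fin (n + 1) → ℕ} {x y : ⨂[ℝ]^r V}
    (hx : x ∈ LinearMap.range (youngSymmetrizer V T)) (hx0 : x ≠ 0) (hxhw : x ∈ hw b n)
    (hxκ : x ∈ wt b κ) (hy : y ∈ LinearMap.range (youngSymmetrizer V T)) (hyhw : y ∈ hw b n)
    (hyκ : y ∈ wt b κ) : ∃ c : ℝ, y = c • x := by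
  by_cases hy0 : y = 0
  · exact ⟨0, by simp [hy0]⟩
  obtain ⟨L, a, ha, hL⟩ := exists_raise b T h hx hx0 hxhw hxκ
  have key : ∀ z ∈ LinearMap.range (youngSymmetrizer V T), z ≠ 0 → z ∈ hw b n → z ∈ wt b κ →
      ∃ c : ℝ, youngSymmetrizer V T (word b (rowWord T h)) = c • listOp (raiseLast b) L z := by
    intro z hz hz0 hzhw hzκ
    obtain ⟨L', c, hc, hL'⟩ := exists_raise b T h hz hz0 hzhw hzκ
    refine ⟨c, ?_⟩
    rw [hc, listOp_perm (raiseLast_commute b) (L' := L)]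
    intro i
    have h1 := hL' i
    have h2 := hL i
    omega
  have hv := youngSymmetrizer_rowWord_ne_zero b T h
  obtain ⟨c, hc⟩ := key y hy hy0 hyhw hyκ
  have hc0 : c ≠ 0 := fun h' => hv (by rw [hc, h', zero_smul])
  have hz : c • y - a • x = 0 := by
    by_contra hne
    obtain ⟨e, he⟩ := key (c • y - a • x)
      (Submodule.sub_mem _ (Submodule.smul_mem _ _ hy) (Submodule.smul_mem _ _ hx)) hne
      (Submodule.sub_mem _ (Submodule.smul_mem _ _ hyhw) (Submodule.smul_mem _ _ hxhw))
      (Submodule.sub_mem _ (Submodule.smul_mem _ _ hyκ) (Submodule.smul_mem _ _ hxκ))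
    rw [map_sub, map_smul, map_smul, ← hc, ← ha, sub_self, smul_zero] at he
    exact hv he
  refine ⟨c⁻¹ * a, ?_⟩
  rw [mul_smul, ← sub_eq_zero.1 hz, inv_smul_smul₀ hc0]

/-- The basis with the last vector moved to the first place. -/
def rotBasis : Basis (Fin (n + 1)) ℝ V := b.reindex (finRotate (n + 1))

theorem unit_rotBasis (i j : Fin (n + 1)) :
    unit (rotBasis b) i j =
      unit b ((finRotate (n + 1)).symm i) ((finRotate (n + 1)).symm j) := by
  rw [unit, unit, rotBasis, Basis.reindex_apply]
  congr 1

theorem rotate_symm_zero : (finRotate (n + 1)).symm 0 = Fin.last n := by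
  rw [← finRotate_last, Equiv.symm_apply_apply]

theorem rotate_symm_succ (i : Fin n) : (finRotate (n + 1)).symm i.succ = i.castSucc := by
  rw [Equiv.symm_apply_eq]
  ext
  rw [coe_finRotate_of_ne_last (Fin.castSucc_lt_last i).ne]
  simp

/-- Raising into space only increases spatial weights, up to the rows of `lam`: the upper bound.
With the time vector ordered first, the operators turning space into time become raising operators;
they only decrease spatial weights and end at the highest weight for the rotated order, whose entry
at `j` is row `j + 1`. -/
theorem branch_bounds (h : lam.colLen 0 ≤ n + 1) {κ : Fin (n + 1) → ℕ} {x : ⨂[ℝ]^r V}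
    (hx : x ∈ LinearMap.range (youngSymmetrizer V T)) (h0 : x ≠ 0) (hhw : x ∈ hw b n)
    (hκ : x ∈ wt b κ) (j : Fin n) :
    κ j.castSucc ≤ lam.rowLen j ∧ lam.rowLen (j + 1) ≤ κ j.castSucc := by
  constructor
  · obtain ⟨L, _, _, hL⟩ := exists_raise b T h hx h0 hhw hκ
    rw [← hL j]
    exact Nat.le_add_right _ _
  · have hstab := range_glStable b T (n + 1)
    have hle : orbitSpan (lowerLast b) x ≤ LinearMap.range (youngSymmetrizer V T) :=
      orbitSpan_le hx fun i y hy => hstab _ _ (Fin.last n).2 i.castSucc.2 y hy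
    have hne : orbitSpan (lowerLast b) x ≠ ⊥ := fun hbot => h0 (by
      have := self_mem_orbitSpan (lowerLast b) x
      rwa [hbot] at this)
    obtain ⟨κ', y, hy, hy0, hyhw, hyκ⟩ := exists_hw_vector (rotBasis b) (m := n + 1) hne
      (fun i => by
        rw [unit_rotBasis]
        exact diag_mem_orbitSpan b _ _ hκ _) (by
        intro i j hij _ y hy
        rw [unit_rotBasis]
        obtain ⟨j, rfl⟩ := Fin.exists_succ_eq.2 (Fin.ne_zero_of_lt hij)
        rw [rotate_symm_succ]
        rcases Fin.eq_zero_or_eq_succ i with rfl | ⟨i, rfl⟩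
        · rw [rotate_symm_zero]
          exact map_mem_orbitSpan _ j hy
        · rw [rotate_symm_succ]
          refine orbitSpan_stable (hhw _ _ (Fin.castSucc_lt_castSucc_iff.2
            (Fin.succ_lt_succ_iff.1 hij)) j.2) (fun k z => ?_) y hy
          have := sumOp_unit_lie b Finset.univ i.castSucc j.castSucc (Fin.last n) k.castSucc z
          rw [if_neg (Fin.castSucc_lt_last j).ne, zero_sub] at this
          refine ⟨j, if k.castSucc = i.castSucc then -1 else 0, ?_⟩
          rw [lowerLast, this, lowerLast]
          split_ifs <;> simp)
    obtain ⟨rfl, -⟩ := hw_range (rotBasis b) T h (hle hy) hy0 hyhw hyκ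
    -- Back in the original order, time carries row 0 and the space index `j` carries row `j + 1`.
    have hyκ' : y ∈ wt b (fun i => shapeWt (n + 1) lam (finRotate (n + 1) i)) := by
      rw [mem_wt_iff] at hyκ ⊢
      intro i
      have := hyκ (finRotate (n + 1) i)
      rwa [unit_rotBasis, Equiv.symm_apply_apply] at this
    have hspan := mem_span_listOp b _ _ hκ hy hyκ'
    have hex : ∃ L : List (Fin n),
        (fun i => shapeWt (n + 1) lam (finRotate (n + 1) i)) +
          (L.map fun i => (Pi.single i.castSucc 1 : Fin (n + 1) → ℕ)).sum =
        κ + (L.map fun _ => (Pi.single (Fin.last n) 1 : Fin (n + 1) → ℕ)).sum := by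
      by_contra! hcon
      refine hy0 ?_
      refine (Submodule.span_le (p := (⊥ : Submodule ℝ (⨂[ℝ]^r V)))).2 ?_ hspan
      rintro z ⟨L, -, hL⟩
      exact absurd hL (hcon L)
    obtain ⟨L, hL⟩ := hex
    have h1 := congrFun hL j.castSucc
    rw [Pi.add_apply, Pi.add_apply, sum_single_eq (fun _ => Fin.last n),
      List.countP_eq_zero.2 (by simp [(Fin.castSucc_lt_last j).ne']), add_zero] at h1
    rw [← h1]
    refine le_trans (le_of_eq ?_) (Nat.le_add_right _ _)
    rw [← rotate_symm_succ, Equiv.apply_symm_apply, shapeWt, Fin.val_succ]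

end

end TensorSignature

namespace TensorSignature

noncomputable section

open Module

/-! ### Column antisymmetrization of the highest weight vector -/

section ColumnRow

variable {V : Type*} [AddCommGroup V] [Module ℝ V] {r d : ℕ}

/-- All words of this content are antisymmetrized to multiples of one vector, whence `a`. If `a`
were zero, adjointness of both symmetrizers would make the highest weight vector orthogonal to
itself. -/
theorem exists_colAlt_youngSymmetrizer_eq (b : Basis (Fin d) ℝ V) {lam : YoungDiagram}
    (T : lam.cells ≃ Fin r) (h : lam.colLen 0 ≤ d) : ∃ a : ℝ, a ≠ 0 ∧
      colAlt V T (youngSymmetrizer V T (word b (rowWord T h))) =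
        a • colAlt V T (word b (rowWord T h)) := by
  set e := word b (rowWord T h) with he
  set x := youngSymmetrizer V T e with hx
  have hxwt : x ∈ wt b (shapeWt d lam) := by
    refine map_mem_wt b (youngSymmetrizer_sumOp T) ?_
    rw [← content_rowWord T h]
    exact word_mem_wt b _
  have hspan : colAlt V T x ∈ Submodule.span ℝ {colAlt V T e} := by
    rw [← sum_coords_smul_word b x, map_sum]
    refine Submodule.sum_mem _ fun w _ => ?_
    rw [map_smul]
    by_cases hw : coords b x w = 0
    · rw [hw, zero_smul]
      exact Submodule.zero_mem _
    refine Submodule.smul_mem _ _ ?_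
    by_cases hinj : ∀ k l, colOf T k = colOf T l → w k = w l → k = l
    · obtain ⟨q, hq, rfl⟩ := exists_colPerm T h hinj ((hxwt w hw).trans (content_rowWord T h).symm)
      have h1 : word b (rowWord T h ∘ q) = permAct V q⁻¹ e := by
        rw [he, permAct_word]; rfl
      rw [h1, ← Module.End.mul_apply, colAlt_mul_permAct T (inv_mem_colPerms T hq)]
      exact Submodule.smul_mem _ _ (Submodule.mem_span_singleton_self _)
    · push Not at hinj
      obtain ⟨k, l, hc, hkl, hne⟩ := hinj
      rw [colAlt_word_eq_zero T b hne hc hkl]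
      exact Submodule.zero_mem _
  obtain ⟨a, ha⟩ := Submodule.mem_span_singleton.1 hspan
  refine ⟨a, ?_, ha.symm⟩
  rintro rfl
  rw [zero_smul] at ha
  have h1 : form b e (colAlt V T x) = 0 := by rw [← ha, map_zero]
  rw [← form_colAlt] at h1
  have h2 : form b x x = 0 := by
    have h3 : x = rowSym V T (colAlt V T e) := rfl
    have h4 : rowSym V T x = ((rowPerms T).card : ℝ) • x := by
      rw [h3]
      exact LinearMap.congr_fun (rowSym_mul_rowSym T) (colAlt V T e)
    have h5 : form b (rowSym V T (colAlt V T e)) x = 0 := by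
      rw [form_rowSym, h4, map_smul, h1, smul_zero]
    exact h5
  exact youngSymmetrizer_rowWord_ne_zero b T h (eq_zero_of_form_self b h2)

end ColumnRow

/-! ### Tensors with prescribed time components -/

/-- The standard basis of `ℝ^n`. -/
abbrev spaceBasis (n : ℕ) : Basis (Fin n) ℝ (Fin n → ℝ) := Pi.basisFun ℝ (Fin n)

/-- The standard basis of spacetime, the time vector being the last one. -/
def stBasis (n : ℕ) : Basis (Fin (n + 1)) ℝ (Spacetime n) :=
  ((spaceBasis n).prod (Basis.singleton (Fin 1) ℝ)).reindex finSumFinEquiv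

theorem stBasis_castSucc {n : ℕ} (i : Fin n) : stBasis n i.castSucc = (Pi.single i 1, 0) := by
  have : finSumFinEquiv.symm i.castSucc = Sum.inl i := by
    rw [Equiv.symm_apply_eq]; rfl
  rw [stBasis, Basis.reindex_apply, this, Basis.prod_apply]
  simp

theorem stBasis_last (n : ℕ) : stBasis n (Fin.last n) = (0, 1) := by
  have : finSumFinEquiv.symm (Fin.last n) = Sum.inr 0 := by
    rw [Equiv.symm_apply_eq]; rfl
  rw [stBasis, Basis.reindex_apply, this, Basis.prod_apply]
  simp

variable {n r m : ℕ}

theorem extend_update {α β γ : Type*} [DecidableEq α] [DecidableEq β] {f : α → β}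
    (hf : Function.Injective f) (g : α → γ) (e : β → γ) (a : α) (x : γ) :
    Function.extend f (Function.update g a x) e = Function.update (Function.extend f g e) (f a) x := by
  ext k
  by_cases hk : ∃ l, f l = k
  · obtain ⟨l, rfl⟩ := hk
    rw [hf.extend_apply]
    by_cases h : l = a
    · subst h; simp
    · rw [Function.update_of_ne h, Function.update_of_ne (hf.ne h), hf.extend_apply]
  · rw [Function.extend_apply' _ _ _ hk, Function.update_of_ne, Function.extend_apply' _ _ _ hk]
    rintro rfl
    exact hk ⟨a, rfl⟩

/-- Put the vectors `v` at the places given by `f`, and the time vector at all other places. -/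
def placeVec (f : Fin m → Fin r) (v : Fin m → Fin n → ℝ) : Fin r → Spacetime n :=
  Function.extend f (fun a => (v a, 0)) fun _ => (0, 1)

/-- Spatial tensors as spacetime tensors: the given places are filled from a spatial tensor, and
all others with the time vector. -/
def place (f : Fin m → Fin r) (hf : Function.Injective f) :
    (⨂[ℝ]^m (Fin n → ℝ)) →ₗ[ℝ] (⨂[ℝ]^r (Spacetime n)) :=
  PiTensorProduct.lift
    { toFun := fun v => PiTensorProduct.tprod ℝ (placeVec f v)
      map_update_add' := by
        intro _ v a x y
        have key : ∀ z, placeVec f (Function.update v a z) =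
            Function.update (placeVec f v) (f a) (z, 0) := by
          intro z
          rw [placeVec, placeVec, ← extend_update hf]
          congr 1
          ext k : 1
          by_cases h : k = a
          · subst h; simp
          · simp [h]
        rw [key, key, key, ← MultilinearMap.map_update_add]
        simp
      map_update_smul' := by
        intro _ v a c x
        have key : ∀ z, placeVec f (Function.update v a z) =
            Function.update (placeVec f v) (f a) (z, 0) := by
          intro z
          rw [placeVec, placeVec, ← extend_update hf]
          congr 1
          ext k : 1
          by_cases h : k = a
          · subst h; simp
          · simp [h]
        rw [key, key, ← MultilinearMap.map_update_smul]
        simp }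

variable (f : Fin m → Fin r) (hf : Function.Injective f)

theorem place_tprod (v : Fin m → Fin n → ℝ) : place f hf (PiTensorProduct.tprod ℝ v) =
    PiTensorProduct.tprod ℝ (placeVec f v) := by
  rw [place, PiTensorProduct.lift.tprod]; rfl

theorem spatialRep_place (g : LinearMap.GeneralLinearGroup ℝ (Fin n → ℝ))
    (x : ⨂[ℝ]^m (Fin n → ℝ)) :
    place f hf (tensorRep _ m g x) = spatialRep n r g (place f hf x) := by
  have : place f hf ∘ₗ tensorRep _ m g = spatialRep n r g ∘ₗ place (n := n) f hf := by
    refine PiTensorProduct.ext ?_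
    refine MultilinearMap.ext fun v => ?_
    change place f hf (PiTensorProduct.map _ (PiTensorProduct.tprod ℝ v)) =
      PiTensorProduct.map _ (place f hf (PiTensorProduct.tprod ℝ v))
    rw [place_tprod, PiTensorProduct.map_tprod, PiTensorProduct.map_tprod, place_tprod]
    congr 1
    ext k : 1
    by_cases hk : ∃ l, f l = k
    · obtain ⟨l, rfl⟩ := hk
      rw [placeVec, placeVec, hf.extend_apply, hf.extend_apply]
      refine Prod.ext rfl ?_
      rfl
    · rw [placeVec, placeVec, Function.extend_apply' _ _ _ hk, Function.extend_apply' _ _ _ hk]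
      refine Prod.ext ?_ rfl
      exact ((g : Module.End ℝ (Fin n → ℝ)).map_zero).symm
  exact LinearMap.congr_fun this x

theorem place_word (w : Fin m → Fin n) : place f hf (word (spaceBasis n) w) =
    word (stBasis n) (Function.extend f (fun a => (w a).castSucc) fun _ => Fin.last n) := by
  rw [word, word, place_tprod]
  congr 1
  ext k : 1
  by_cases hk : ∃ l, f l = k
  · obtain ⟨l, rfl⟩ := hk
    rw [placeVec, hf.extend_apply, hf.extend_apply, stBasis_castSucc]
    simp
  · rw [placeVec, Function.extend_apply' _ _ _ hk, Function.extend_apply' _ _ _ hk, stBasis_last]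

theorem place_permAct (σ : Equiv.Perm (Fin m)) (x : ⨂[ℝ]^m (Fin n → ℝ)) :
    place f hf (permAct _ σ x) = permAct _ (σ.viaFintypeEmbedding ⟨f, hf⟩) (place f hf x) := by
  refine LinearMap.congr_fun (f := place f hf ∘ₗ permAct _ σ)
    (g := permAct _ (σ.viaFintypeEmbedding ⟨f, hf⟩) ∘ₗ place f hf) ?_ x
  refine word_hom_ext (spaceBasis n) fun w => ?_
  rw [LinearMap.comp_apply, LinearMap.comp_apply, permAct_word, place_word, place_word,
    permAct_word]
  congr 1
  ext k : 1
  rw [Function.comp_apply]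
  obtain ⟨k, rfl⟩ := (σ.viaFintypeEmbedding ⟨f, hf⟩).surjective k
  rw [Equiv.symm_apply_apply]
  by_cases hk : ∃ l, f l = k
  · obtain ⟨l, rfl⟩ := hk
    have : σ.viaFintypeEmbedding ⟨f, hf⟩ (f l) = f (σ l) :=
      Equiv.Perm.viaFintypeEmbedding_apply_image σ ⟨f, hf⟩ l
    rw [this, hf.extend_apply, hf.extend_apply]
    simp
  · have : σ.viaFintypeEmbedding ⟨f, hf⟩ k = k :=
      Equiv.Perm.viaFintypeEmbedding_apply_notMem_range σ ⟨f, hf⟩ (by simpa using hk)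
    rw [this, Function.extend_apply' _ _ _ hk, Function.extend_apply' _ _ _ hk]

/-! ### Spatial operators -/

theorem unit_space_prodMap (i j : Fin n) (t : ℝ) :
    (1 + t • unit (stBasis n) i.castSucc j.castSucc : Module.End ℝ (Spacetime n)) =
      (1 + t • unit (spaceBasis n) i j : Module.End ℝ (Fin n → ℝ)).prodMap LinearMap.id := by
  refine (stBasis n).ext fun k => ?_
  rw [LinearMap.add_apply, LinearMap.smul_apply, unit_apply_basis]
  rcases Fin.eq_castSucc_or_eq_last k with ⟨k, rfl⟩ | rfl
  · have := unit_apply_basis (spaceBasis n) i j k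
    rw [Pi.basisFun_apply, Pi.basisFun_apply] at this
    rw [stBasis_castSucc, stBasis_castSucc, LinearMap.prodMap_apply, LinearMap.add_apply,
      LinearMap.smul_apply, this]
    simp only [Fin.castSucc_inj, Module.End.one_apply]
    split_ifs <;> simp
  · rw [if_neg (Fin.castSucc_lt_last j).ne', stBasis_last]
    simp

/-- Operators which commute with the spatial linear group commute with the spatial derivations. -/
theorem sumOp_of_spatial (F : (⨂[ℝ]^m (Fin n → ℝ)) →ₗ[ℝ] (⨂[ℝ]^r (Spacetime n)))
    (hF : ∀ g x, F (tensorRep _ m g x) = spatialRep n r g (F x)) (i j : Fin n)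
    (x : ⨂[ℝ]^m (Fin n → ℝ)) :
    F (sumOp Finset.univ (unit (spaceBasis n) i j) x) =
      sumOp Finset.univ (unit (stBasis n) i.castSucc j.castSucc) (F x) := by
  have := sumOp_mem_of_map_mem (LinearMap.range (LinearMap.id.prod F))
    (unit (spaceBasis n) i j) (unit (stBasis n) i.castSucc j.castSucc) infinite_ne_neg_one (by
      rintro t ht _ ⟨y, rfl⟩
      obtain ⟨g, hg⟩ := isUnit_one_add_smul_unit (spaceBasis n) i j ht
      refine ⟨tensorRep _ m g y, ?_⟩
      refine Prod.ext ?_ ?_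
      · change PiTensorProduct.map (fun _ => (g : Module.End ℝ (Fin n → ℝ))) y = _
        rw [hg]; rfl
      · change F (tensorRep _ m g y) = _
        rw [hF]
        change PiTensorProduct.map
          (fun _ => (g : Module.End ℝ (Fin n → ℝ)).prodMap LinearMap.id) (F y) = _
        rw [hg, ← unit_space_prodMap]; rfl) (x, F x) ⟨x, rfl⟩
  obtain ⟨y, hy⟩ := this
  have h1 : y = sumOp Finset.univ (unit (spaceBasis n) i j) x := (Prod.ext_iff.1 hy).1
  have h2 : F y = sumOp Finset.univ (unit (stBasis n) i.castSucc j.castSucc) (F x) :=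
    (Prod.ext_iff.1 hy).2
  rw [← h2, h1]

theorem glStable_of_spatialRep {S : Submodule ℝ (⨂[ℝ]^r (Spacetime n))}
    (h : ∀ g, ∀ x ∈ S, spatialRep n r g x ∈ S) : GlStable (stBasis n) n S := by
  intro i j hi hj x hx
  obtain ⟨i, rfl⟩ := Fin.exists_castSucc_eq.2 (Fin.ne_of_lt (b := Fin.last n) hi)
  obtain ⟨j, rfl⟩ := Fin.exists_castSucc_eq.2 (Fin.ne_of_lt (b := Fin.last n) hj)
  refine (sumOp_mem_of_map_mem (S.prod (⊥ : Submodule ℝ (⨂[ℝ]^0 (Fin n → ℝ))))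
    (unit (stBasis n) i.castSucc j.castSucc) 0
    infinite_ne_neg_one ?_ (x, 0) ⟨hx, rfl⟩).1
  rintro t ht ⟨x, y⟩ ⟨hx, hy⟩
  obtain ⟨g, hg⟩ := isUnit_one_add_smul_unit (spaceBasis n) i j ht
  refine ⟨?_, ?_⟩
  · have : PiTensorProduct.map
        (fun _ => (g : Module.End ℝ (Fin n → ℝ)).prodMap LinearMap.id) x ∈ S := h g x hx
    rw [hg, ← unit_space_prodMap] at this
    exact this
  · rw [(show y = 0 from hy)]
    simp

/-- All diagonal operators sum to `r` and the spatial ones to `m`, so the time index counts the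
remaining `k` places. -/
theorem sumOp_place_last {k : ℕ} (hk : m + k = r) (x : ⨂[ℝ]^m (Fin n → ℝ)) :
    sumOp Finset.univ (unit (stBasis n) (Fin.last n) (Fin.last n)) (place f hf x) =
      (k : ℝ) • place f hf x := by
  have h1 := sum_sumOp_diag (stBasis n) (place f hf x)
  rw [Fin.sum_univ_castSucc] at h1
  have h2 := congrArg (place f hf) (sum_sumOp_diag (spaceBasis n) x)
  rw [map_sum, map_smul] at h2
  simp only [sumOp_of_spatial (place f hf) (spatialRep_place f hf)] at h2
  rw [h2] at h1
  refine add_left_cancel (a := (m : ℝ) • place f hf x) ?_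
  rw [h1, ← add_smul, ← Nat.cast_add, hk]

end

end TensorSignature

namespace TensorSignature

noncomputable section

open Module

/-! ### The branching map -/

variable {n r m : ℕ} {lam mu : YoungDiagram}

theorem IsBranch.le (h : IsBranch n lam mu) : mu ≤ lam := h.1

theorem IsBranch.colLen_le (h : IsBranch n lam mu) : ∀ j, lam.colLen j ≤ mu.colLen j + 1 := h.2.1

theorem IsBranch.colLen_zero (h : IsBranch n lam mu) : mu.colLen 0 ≤ n := h.2.2

/-- The place in a tableau of the boxes of a tableau of a smaller shape. -/
def boxMap (hle : mu ≤ lam) (T : lam.cells ≃ Fin r) (T' : mu.cells ≃ Fin m) (k : Fin m) : Fin r :=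
  T ⟨T'.symm k, hle (T'.symm k).2⟩

variable (hle : mu ≤ lam) (T : lam.cells ≃ Fin r) (T' : mu.cells ≃ Fin m)

theorem boxMap_injective : Function.Injective (boxMap hle T T') := by
  intro k l h
  have h1 := congrArg Subtype.val (T.injective h)
  exact T'.symm.injective (Subtype.ext h1)

theorem rowOf_boxMap (k : Fin m) : rowOf T (boxMap hle T T' k) = rowOf T' k := by
  rw [rowOf, boxMap, Equiv.symm_apply_apply]; rfl

theorem colOf_boxMap (k : Fin m) : colOf T (boxMap hle T T' k) = colOf T' k := by
  rw [colOf, boxMap, Equiv.symm_apply_apply]; rfl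

theorem exists_boxMap_iff (k : Fin r) : (∃ l, boxMap hle T T' l = k) ↔ (rowOf T k, colOf T k) ∈ mu := by
  constructor
  · rintro ⟨l, rfl⟩
    rw [rowOf_boxMap, colOf_boxMap]
    exact (T'.symm l).2
  · intro h
    refine ⟨T' ⟨(rowOf T k, colOf T k), h⟩, ?_⟩
    rw [boxMap, ← Equiv.eq_symm_apply]
    refine Subtype.ext ?_
    simp only [Equiv.symm_apply_apply]
    rfl

/-- The map from spatial tensors to spacetime tensors that describes the branching. -/
def branchMap : (⨂[ℝ]^m (Fin n → ℝ)) →ₗ[ℝ] (⨂[ℝ]^r (Spacetime n)) :=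
  youngSymmetrizer (Spacetime n) T ∘ₗ place (boxMap hle T T') (boxMap_injective hle T T')

theorem branchMap_tensorRep (g : LinearMap.GeneralLinearGroup ℝ (Fin n → ℝ))
    (x : ⨂[ℝ]^m (Fin n → ℝ)) :
    branchMap hle T T' (tensorRep _ m g x) = spatialRep n r g (branchMap hle T T' x) := by
  rw [branchMap, LinearMap.comp_apply, spatialRep_place]
  exact youngSymmetrizer_tensorRep T (spatial n g) _

theorem sumOp_branchMap_last {k : ℕ} (hk : m + k = r) (x : ⨂[ℝ]^m (Fin n → ℝ)) :
    sumOp Finset.univ (unit (stBasis n) (Fin.last n) (Fin.last n)) (branchMap hle T T' x) =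
      (k : ℝ) • branchMap hle T T' x := by
  rw [branchMap, LinearMap.comp_apply, ← youngSymmetrizer_sumOp, sumOp_place_last _ _ hk, map_smul]

theorem sumOp_branchMap (i j : Fin n) (x : ⨂[ℝ]^m (Fin n → ℝ)) :
    branchMap hle T T' (sumOp Finset.univ (unit (spaceBasis n) i j) x) =
      sumOp Finset.univ (unit (stBasis n) i.castSucc j.castSucc) (branchMap hle T T' x) :=
  sumOp_of_spatial _ (branchMap_tensorRep hle T T') i j x

theorem colAlt_place_permAct {q : Equiv.Perm (Fin m)} (hq : q ∈ colPerms T')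
    (x : ⨂[ℝ]^m (Fin n → ℝ)) :
    colAlt _ T (place _ (boxMap_injective hle T T') (permAct _ q x)) =
      ((Equiv.Perm.sign q : ℤ) : ℝ) • colAlt _ T (place _ (boxMap_injective hle T T') x) := by
  have hmem : q.viaFintypeEmbedding ⟨_, boxMap_injective hle T T'⟩ ∈ colPerms T := by
    rw [mem_colPerms]
    intro k
    by_cases hk : ∃ l, boxMap hle T T' l = k
    · obtain ⟨l, rfl⟩ := hk
      have : q.viaFintypeEmbedding ⟨_, boxMap_injective hle T T'⟩ (boxMap hle T T' l) =
          boxMap hle T T' (q l) := Equiv.Perm.viaFintypeEmbedding_apply_image q ⟨_, _⟩ l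
      rw [this, colOf_boxMap, colOf_boxMap]
      exact (mem_colPerms T').1 hq l
    · have : q.viaFintypeEmbedding ⟨_, boxMap_injective hle T T'⟩ k = k :=
        Equiv.Perm.viaFintypeEmbedding_apply_notMem_range q ⟨_, _⟩ (by simpa using hk)
      rw [this]
  rw [place_permAct, ← Module.End.mul_apply, colAlt_mul_permAct T hmem,
    Equiv.Perm.viaFintypeEmbedding_sign]
  rfl

/-- Column permutations of the smaller tableau extend to column permutations of the larger one with
the same sign, so each term contributes equally. -/
theorem colAlt_place_colAlt (x : ⨂[ℝ]^m (Fin n → ℝ)) :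
    colAlt _ T (place _ (boxMap_injective hle T T') (colAlt _ T' x)) =
      ((colPerms T').card : ℝ) • colAlt _ T (place _ (boxMap_injective hle T T') x) := by
  rw [show colAlt _ T' = ∑ q ∈ colPerms T', ((Equiv.Perm.sign q : ℤ) : ℝ) • permAct _ q from rfl,
    LinearMap.sum_apply, map_sum, map_sum, Finset.sum_congr rfl
    (g := fun _ => colAlt _ T (place _ (boxMap_injective hle T T') x)), Finset.sum_const,
    Nat.cast_smul_eq_nsmul]
  intro q hq
  rw [LinearMap.smul_apply, map_smul, map_smul, colAlt_place_permAct hle T T' hq, smul_smul]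
  rcases Int.units_eq_one_or (Equiv.Perm.sign q) with h | h <;> simp [h]

/-- Column antisymmetrization on the smaller tableau can be inserted at the cost of nonzero factors,
and it reduces the inner symmetrized word to the plain tableau word. That word, with time in the
boxes outside `mu`, has a positive coefficient in its symmetrization, because `hcol` allows only one
such box per column. -/
theorem branchMap_rowWord_ne_zero (h' : mu.colLen 0 ≤ n)
    (hcol : ∀ j, lam.colLen j ≤ mu.colLen j + 1) :
    branchMap hle T T' (youngSymmetrizer _ T' (word (spaceBasis n) (rowWord T' h'))) ≠ 0 := by
  intro h0
  obtain ⟨a, ha, hae⟩ := exists_colAlt_youngSymmetrizer_eq (spaceBasis n) T' h'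
  set e := word (spaceBasis n) (rowWord T' h') with he
  have hQ : ((colPerms T').card : ℝ) ≠ 0 := by exact_mod_cast (card_colPerms_pos T').ne'
  have h1 := congrArg (fun z => colAlt _ T (place _ (boxMap_injective hle T T') z)) hae
  simp only [map_smul, colAlt_place_colAlt] at h1
  have h2 := congrArg (rowSym (Spacetime n) T) h1
  simp only [map_smul] at h2
  have h3 : rowSym (Spacetime n) T (colAlt _ T (place _ (boxMap_injective hle T T')
      (youngSymmetrizer _ T' e))) = 0 := h0
  rw [h3, smul_zero, smul_comm, eq_comm, smul_eq_zero_iff_right hQ, smul_eq_zero_iff_right ha,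
    he, place_word] at h2
  have h4 := coords_youngSymmetrizer_word_pos (stBasis n) T
    (f := Function.extend (boxMap hle T T') (fun a => (rowWord T' h' a).castSucc)
      fun _ => Fin.last n) (fun k => ∃ l, boxMap hle T T' l = k) (by
      rintro _ ⟨l, rfl⟩
      rw [(boxMap_injective hle T T').extend_apply, rowOf_boxMap]
      rfl) (by
      rintro k _ hk ⟨l, rfl⟩
      rw [Function.extend_apply' _ _ _ hk, (boxMap_injective hle T T').extend_apply]
      exact (Fin.castSucc_lt_last _).ne') (by
      intro k l hk hl hkl
      refine eq_of_row_col T ?_ hkl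
      rw [exists_boxMap_iff, YoungDiagram.mem_iff_lt_colLen] at hk hl
      have h5 := row_col_mem T k
      have h6 := row_col_mem T l
      rw [YoungDiagram.mem_iff_lt_colLen] at h5 h6
      rw [hkl] at hk h5
      have := hcol (colOf T l)
      omega)
  rw [youngSymmetrizer_eq, Module.End.mul_apply, h2] at h4
  simp at h4

variable (hbr : IsBranch n lam mu)

-- The kernel meets the irreducible spatial space in an invariant subspace, which is not everything.
include hbr in
theorem branchMap_injOn (x : ⨂[ℝ]^m (Fin n → ℝ))
    (hx : x ∈ (youngSubrep (Fin n → ℝ) T').toSubmodule) (h0 : branchMap hbr.le T T' x = 0) :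
    x = 0 := by
  have h1 := ((isIrreducible_iff _).1 (isIrreducible_youngSubrep (spaceBasis n) T' hbr.colLen_zero)).2
    ((youngSubrep (Fin n → ℝ) T').toSubmodule ⊓ LinearMap.ker (branchMap hbr.le T T'))
    inf_le_left (by
      rintro g y ⟨hy, hy0⟩
      refine ⟨(youngSubrep (Fin n → ℝ) T').apply_mem_toSubmodule g hy, ?_⟩
      change branchMap hbr.le T T' _ = 0
      rw [branchMap_tensorRep, LinearMap.mem_ker.1 hy0, map_zero])
  rcases h1 with h1 | h1
  · have : x ∈ (youngSubrep (Fin n → ℝ) T').toSubmodule ⊓ LinearMap.ker (branchMap hbr.le T T') :=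
      ⟨hx, h0⟩
    rw [h1] at this
    exact this
  · have h2 := inf_eq_left.1 h1
    exact absurd (h2 ⟨_, rfl⟩) (branchMap_rowWord_ne_zero hbr.le T T' hbr.colLen_zero hbr.colLen_le)

/-- The piece of the space of a Young symmetrizer that belongs to a branch of its diagram. -/
def branchRep (hle : mu ≤ lam) : Subrepresentation (spatialRep n r) where
  toSubmodule := (youngSubrep (Fin n → ℝ) T').toSubmodule.map (branchMap hle T T')
  apply_mem_toSubmodule g := by
    rintro _ ⟨y, hy, rfl⟩
    rw [← branchMap_tensorRep]
    exact Submodule.mem_map_of_mem ((youngSubrep (Fin n → ℝ) T').apply_mem_toSubmodule g hy)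

/-- The weight of the highest weight vector of a piece. -/
def branchWt (n r : ℕ) (mu : YoungDiagram) : Fin (n + 1) → ℕ :=
  Fin.snoc (fun i : Fin n => mu.rowLen i) (r - mu.card)

include hbr in
theorem hw_branchRep {x : ⨂[ℝ]^r (Spacetime n)} (hx : x ∈ (branchRep T T' hbr.le).toSubmodule)
    (h0 : x ≠ 0) {κ : Fin (n + 1) → ℕ} (hhw : x ∈ hw (stBasis n) n) (hκ : x ∈ wt (stBasis n) κ) :
    ∀ i : Fin n, κ i.castSucc = mu.rowLen i := by
  obtain ⟨y, hy, rfl⟩ := hx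
  have hinj := branchMap_injOn T T' hbr
  have hst := (youngSubrep (Fin n → ℝ) T').glStable (b := spaceBasis n) n
  have h1 : y ∈ hw (spaceBasis n) n := by
    intro i j hij hj
    refine hinj _ (hst i j i.2 j.2 y hy) ?_
    rw [sumOp_branchMap]
    exact hhw _ _ (Fin.castSucc_lt_castSucc_iff.2 hij) hj
  have h2 : y ∈ wt (spaceBasis n) (fun i => κ i.castSucc) := by
    rw [mem_wt_iff] at hκ ⊢
    intro i
    rw [← sub_eq_zero]
    refine hinj _ (Submodule.sub_mem _ (hst i i i.2 i.2 y hy) (Submodule.smul_mem _ _ hy)) ?_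
    rw [map_sub, map_smul, sumOp_branchMap, hκ, sub_self]
  intro i
  exact congrFun (hw_range (spaceBasis n) T' hbr.colLen_zero hy
    (fun h => h0 (by rw [h, map_zero])) h1 h2).1 i

/-- The highest weight vector of a piece. -/
def branchVec (hle : mu ≤ lam) (h : mu.colLen 0 ≤ n) : ⨂[ℝ]^r (Spacetime n) :=
  branchMap hle T T' (youngSymmetrizer _ T' (word (spaceBasis n) (rowWord T' h)))

theorem branchVec_mem_range (h : mu.colLen 0 ≤ n) :
    branchVec T T' hle h ∈ LinearMap.range (youngSymmetrizer (Spacetime n) T) := ⟨_, rfl⟩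

theorem branchVec_mem (h : mu.colLen 0 ≤ n) :
    branchVec T T' hle h ∈ (branchRep T T' hle).toSubmodule :=
  Submodule.mem_map_of_mem ⟨_, rfl⟩

theorem branchVec_mem_hw (h : mu.colLen 0 ≤ n) : branchVec T T' hle h ∈ hw (stBasis n) n := by
  intro i j hij hj
  obtain ⟨j, rfl⟩ := Fin.exists_castSucc_eq.2 (Fin.ne_of_lt (b := Fin.last n) hj)
  obtain ⟨i, rfl⟩ := Fin.exists_castSucc_eq.2 (Fin.ne_last_of_lt hij)
  rw [branchVec, ← sumOp_branchMap]
  have : youngSymmetrizer _ T' (word (spaceBasis n) (rowWord T' h)) ∈ hw (spaceBasis n) n :=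
    map_mem_hw _ (rowSym_sumOp T') (colAlt_rowWord_mem_hw T' (spaceBasis n) h n)
  rw [this i j (Fin.castSucc_lt_castSucc_iff.1 hij) j.2, map_zero]

theorem branchVec_mem_wt (h : mu.colLen 0 ≤ n) :
    branchVec T T' hle h ∈ wt (stBasis n) (branchWt n r mu) := by
  rw [mem_wt_iff]
  intro i
  rcases Fin.eq_castSucc_or_eq_last i with ⟨i, rfl⟩ | rfl
  · rw [branchVec, ← sumOp_branchMap, branchWt, Fin.snoc_castSucc]
    have : youngSymmetrizer _ T' (word (spaceBasis n) (rowWord T' h)) ∈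
        wt (spaceBasis n) (shapeWt n mu) := by
      refine map_mem_wt _ (youngSymmetrizer_sumOp T') ?_
      rw [← content_rowWord T' h]
      exact word_mem_wt _ _
    rw [(mem_wt_iff _).1 this i, map_smul]
    rfl
  · rw [branchVec, branchWt, Fin.snoc_last, sumOp_branchMap_last]
    rw [card_eq_of_tableau T', ← card_eq_of_tableau T, ← card_eq_of_tableau T']
    exact Nat.add_sub_cancel' (Finset.card_le_card hle)

end

end TensorSignature

namespace TensorSignature

noncomputable section

open Module

/-! ### Transport of irreducibility -/

section Transport

variable {G U U' : Type*} [Group G] [AddCommGroup U] [Module ℝ U] {ρ : Representation ℝ G U}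
  [AddCommGroup U'] [Module ℝ U'] {ρ' : Representation ℝ G U'}

theorem isIrreducible_iff_of_map (M : Subrepresentation ρ) (M' : Subrepresentation ρ')
    (f : U →ₗ[ℝ] U') (hf : ∀ g, ∀ x ∈ M.toSubmodule, f (ρ g x) = ρ' g (f x))
    (hinj : ∀ x ∈ M.toSubmodule, f x = 0 → x = 0)
    (hmap : M.toSubmodule.map f = M'.toSubmodule) :
    M.toRepresentation.IsIrreducible ↔ M'.toRepresentation.IsIrreducible := by
  have hinj' : ∀ S ≤ M.toSubmodule, ∀ S' ≤ M.toSubmodule, S.map f = S'.map f → S ≤ S' := by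
    intro S hS S' hS' h x hx
    obtain ⟨y, hy, hxy⟩ : f x ∈ S'.map f := h ▸ Submodule.mem_map_of_mem hx
    have := hinj (x - y) (Submodule.sub_mem _ (hS hx) (hS' hy)) (by rw [map_sub, hxy, sub_self])
    rwa [sub_eq_zero.1 this]
  have hinj'' : ∀ S ≤ M.toSubmodule, ∀ S' ≤ M.toSubmodule, S.map f = S'.map f → S = S' :=
    fun S hS S' hS' h => le_antisymm (hinj' S hS S' hS' h) (hinj' S' hS' S hS h.symm)
  rw [isIrreducible_iff, isIrreducible_iff, ← hmap]
  refine and_congr (not_congr ⟨fun h => by rw [h, Submodule.map_bot], fun h =>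
    hinj'' _ le_rfl _ bot_le (by rw [h, Submodule.map_bot])⟩) ⟨fun h S hS hg => ?_, fun h S hS hg => ?_⟩
  · have hS' : (S.comap f ⊓ M.toSubmodule).map f = S := by
      refine le_antisymm ?_ fun x hx => ?_
      · rintro _ ⟨x, ⟨hx, -⟩, rfl⟩
        exact hx
      · obtain ⟨y, hy, rfl⟩ := hS hx
        exact ⟨y, ⟨hx, hy⟩, rfl⟩
    rw [← hS']
    rcases h (S.comap f ⊓ M.toSubmodule) inf_le_right (by
      rintro g x ⟨hx, hxM⟩
      refine ⟨?_, M.apply_mem_toSubmodule g hxM⟩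
      have h1 : f (ρ g x) ∈ S := by
        rw [hf g x hxM]
        exact hg g _ hx
      exact h1) with h | h
    · left; rw [h, Submodule.map_bot]
    · right; rw [h]
  · rcases h (S.map f) (Submodule.map_mono hS) (by
      rintro g _ ⟨x, hx, rfl⟩
      rw [← hf g x (hS hx)]
      exact Submodule.mem_map_of_mem (hg g x hx)) with h | h
    · left
      exact hinj'' _ hS _ bot_le (by rw [h, Submodule.map_bot])
    · right
      exact hinj'' _ hS _ le_rfl h

end Transport

/-! ### Orthogonality from distinct highest weights -/

section Orthogonality

variable {V : Type*} [AddCommGroup V] [Module ℝ V] {r d m : ℕ} (b : Basis (Fin d) ℝ V)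

/-- Stable spaces without common highest weights are orthogonal. -/
theorem GlStable.form_eq_zero (hm : d ≤ m + 1) {M N : Submodule ℝ (⨂[ℝ]^r V)}
    (hM : GlStable b m M) (hN : GlStable b m N)
    (h : ∀ κ, ∀ x ∈ M, ∀ y ∈ N, x ∈ hw b m → y ∈ hw b m → x ∈ wt b κ → y ∈ wt b κ →
      x ≠ 0 → y ≠ 0 → False) : ∀ x ∈ M, ∀ y ∈ N, form b x y = 0 := by
  have hM' := hM.orthogonal
  set N₁ := N ⊓ (form b).orthogonal M with hN₁
  have hN₁s : GlStable b m N₁ := hN.inf hM'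
  -- Otherwise `N` contains a highest weight vector `y` orthogonal to `N₁`. Its projection `p` to
  -- `M` is killed by the same operators and has the same weight, since `M` and its complement are
  -- stable. It is nonzero, because otherwise `y` would lie in `N₁` and be orthogonal to itself.
  have key : N₁ = N := by
    refine eq_of_inf_orthogonal_eq_bot b inf_le_left ?_
    by_contra hne
    obtain ⟨κ, y, ⟨hyN, hy₁⟩, hy0, hyhw, hyκ⟩ :=
      (hN.inf hN₁s.orthogonal).exists_hw_vector b hm hne
    have hcompl := isCompl_orthogonal b M
    obtain ⟨p, hp, q, hq, hpq⟩ := Submodule.mem_sup.1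
      (hcompl.sup_eq_top ▸ Submodule.mem_top : y ∈ M ⊔ (form b).orthogonal M)
    have hdisj : ∀ u ∈ M, ∀ v ∈ (form b).orthogonal M, u + v = 0 → u = 0 := by
      intro u hu v hv huv
      refine Submodule.disjoint_def.1 hcompl.disjoint u hu ?_
      rw [eq_neg_of_add_eq_zero_left huv]
      exact Submodule.neg_mem _ hv
    refine h κ p hp y hyN ?_ hyhw ?_ hyκ ?_ hy0
    · intro i j hij hj
      refine hdisj _ (hM i j (lt_trans hij hj) hj p hp) _ (hM' i j (lt_trans hij hj) hj q hq) ?_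
      rw [← map_add, hpq]
      exact hyhw i j hij hj
    · rw [mem_wt_iff] at hyκ ⊢
      intro i
      rw [← sub_eq_zero]
      refine hdisj _ (Submodule.sub_mem _ (hM.diag hm i p hp) (Submodule.smul_mem _ _ hp)) _
        (Submodule.sub_mem _ (hM'.diag hm i q hq) (Submodule.smul_mem _ (κ i : ℝ) hq)) ?_
      rw [sub_add_sub_comm, ← map_add, ← smul_add, hpq, hyκ, sub_self]
    · rintro rfl
      rw [zero_add] at hpq
      subst hpq
      exact hy0 (eq_zero_of_form_self b ((mem_orthogonal b).1 hy₁ q ⟨hyN, hq⟩))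
  intro x hx y hy
  rw [← key] at hy
  exact (mem_orthogonal b).1 hy.2 x hx

end Orthogonality

variable {n r : ℕ} {lam mu : YoungDiagram}

/-- Interlacing row lengths are the same as columns shortened by at most one box. The diagram is
built from its rows. -/
theorem exists_isBranch (hlam : lam.colLen 0 ≤ n + 1) (κ : Fin n → ℕ)
    (h : ∀ j, κ j ≤ lam.rowLen j ∧ lam.rowLen (j + 1) ≤ κ j) :
    ∃ mu, IsBranch n lam mu ∧ ∀ j : Fin n, κ j = mu.rowLen j := by
  have hκ : Antitone κ := by
    intro i j hij
    rcases hij.eq_or_lt with rfl | hij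
    · rfl
    · exact (h j).1.trans ((lam.rowLen_anti _ _ (Nat.succ_le_of_lt hij)).trans (h i).2)
  set mu := YoungDiagram.ofRowLens (List.ofFn κ) hκ.sortedGE_ofFn with hmu
  have hmem : ∀ c : ℕ × ℕ, c ∈ mu ↔ ∃ h : c.1 < n, c.2 < κ ⟨c.1, h⟩ := by
    intro c
    rw [hmu, YoungDiagram.mem_ofRowLens]
    simp
  refine ⟨mu, ⟨?_, fun j => ?_, ?_⟩, fun j => ?_⟩
  · rintro ⟨i, j⟩ hc
    obtain ⟨hi, hj⟩ := (hmem _).1 hc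
    exact YoungDiagram.mem_iff_lt_rowLen.2 (hj.trans_le (h _).1)
  -- If a column lost two boxes, row `i + 1` of `lam`, with `i` the new column length, would still
  -- reach column `j`; by interlacing so would row `i` of `mu`, which is impossible.
  · by_contra! hcon
    have h1 : (mu.colLen j + 1, j) ∈ lam := YoungDiagram.mem_iff_lt_colLen.2 hcon
    have h2 : mu.colLen j < n := by
      have := lam.colLen_anti 0 j (Nat.zero_le _)
      omega
    have h3 : (mu.colLen j, j) ∈ mu := (hmem _).2 ⟨h2, lt_of_lt_of_le
      (YoungDiagram.mem_iff_lt_rowLen.1 h1) (h ⟨_, h2⟩).2⟩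
    exact lt_irrefl _ (YoungDiagram.mem_iff_lt_colLen.1 h3)
  · by_contra! hcon
    obtain ⟨h1, -⟩ := (hmem _).1 (YoungDiagram.mem_iff_lt_colLen.2 hcon)
    exact lt_irrefl _ h1
  · refine eq_of_forall_lt_iff fun k => ?_
    rw [← YoungDiagram.mem_iff_lt_rowLen, hmem]
    exact ⟨fun h => ⟨j.2, h⟩, fun ⟨_, h⟩ => h⟩

/-! ### Decomposition of an irreducible space into its pieces -/

section Decomposition

variable (M : Subrepresentation (tensorRep (Spacetime n) r)) (T : lam.cells ≃ Fin r)

/-- The piece of an invariant space that belongs to a branch of its diagram. -/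
def piece (hle : mu ≤ lam) : Subrepresentation (spatialRep n r) where
  toSubmodule := M.toSubmodule ⊓
    (branchRep T mu.cells.equivFin hle).toSubmodule.comap (youngSymmetrizer (Spacetime n) T)
  apply_mem_toSubmodule g := by
    rintro y ⟨hy, hy'⟩
    refine ⟨M.apply_mem_toSubmodule (spatial n g) hy, ?_⟩
    have h := (branchRep T mu.cells.equivFin hle).apply_mem_toSubmodule g hy'
    have h2 := youngSymmetrizer_tensorRep T (spatial n g) y
    have h3 : youngSymmetrizer _ T (tensorRep (Spacetime n) r (spatial n g) y) ∈
        (branchRep T mu.cells.equivFin hle).toSubmodule := by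
      rw [h2]
      exact h
    exact h3

theorem piece_le (hle : mu ≤ lam) : (piece M T hle).toSubmodule ≤ M.toSubmodule := inf_le_left

theorem piece_glStable (hle : mu ≤ lam) :
    GlStable (stBasis n) n (piece M T hle).toSubmodule :=
  glStable_of_spatialRep fun g _ hx => (piece M T hle).apply_mem_toSubmodule g hx

variable (hinj : ∀ x ∈ M.toSubmodule, youngSymmetrizer (Spacetime n) T x = 0 → x = 0)
  (hmap : M.toSubmodule.map (youngSymmetrizer (Spacetime n) T) =
    LinearMap.range (youngSymmetrizer (Spacetime n) T))

include hmap in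
theorem map_piece (hle : mu ≤ lam) :
    (piece M T hle).toSubmodule.map (youngSymmetrizer (Spacetime n) T) =
      (branchRep T mu.cells.equivFin hle).toSubmodule := by
  refine le_antisymm ?_ ?_
  · rintro _ ⟨x, ⟨-, hx⟩, rfl⟩
    exact hx
  · intro x hx
    have h1 : x ∈ M.toSubmodule.map (youngSymmetrizer (Spacetime n) T) := by
      rw [hmap]
      obtain ⟨y, -, rfl⟩ := hx
      exact ⟨_, rfl⟩
    obtain ⟨y, hy, rfl⟩ := h1
    exact ⟨y, ⟨hy, hx⟩, rfl⟩

include hinj hmap in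
theorem piece_isIrreducible (hbr : IsBranch n lam mu) :
    Representation.IsIrreducible (V := (piece M T hbr.le).toSubmodule)
      (piece M T hbr.le).toRepresentation := by
  rw [isIrreducible_iff_of_map (piece M T hbr.le) (branchRep T mu.cells.equivFin hbr.le)
    (youngSymmetrizer (Spacetime n) T)
    (fun g x _ => youngSymmetrizer_tensorRep T (spatial n g) x)
    (fun x hx => hinj x hx.1) (map_piece M T hmap hbr.le),
    ← isIrreducible_iff_of_map (youngSubrep (Fin n → ℝ) mu.cells.equivFin) _
    (branchMap hbr.le T mu.cells.equivFin)
    (fun g x _ => branchMap_tensorRep hbr.le T mu.cells.equivFin g x)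
    (branchMap_injOn T mu.cells.equivFin hbr) rfl]
  exact isIrreducible_youngSubrep (spaceBasis n) _ hbr.colLen_zero

include hinj hmap in
theorem nonempty_piece_equiv (hbr : IsBranch n lam mu) :
    Nonempty ((piece M T hbr.le).toRepresentation.Equiv
      (youngSubrep (Fin n → ℝ) mu.cells.equivFin).toRepresentation) := by
  obtain ⟨e₁⟩ := nonempty_equiv_of_map (piece M T hbr.le) (branchRep T mu.cells.equivFin hbr.le)
    (youngSymmetrizer (Spacetime n) T)
    (fun g x _ => youngSymmetrizer_tensorRep T (spatial n g) x)
    (fun x hx => hinj x hx.1) (map_piece M T hmap hbr.le)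
  obtain ⟨e₂⟩ := nonempty_equiv_of_map (youngSubrep (Fin n → ℝ) mu.cells.equivFin)
    (branchRep T mu.cells.equivFin hbr.le) (branchMap hbr.le T mu.cells.equivFin)
    (fun g x _ => branchMap_tensorRep hbr.le T mu.cells.equivFin g x)
    (branchMap_injOn T mu.cells.equivFin hbr) rfl
  exact ⟨e₁.trans e₂.symm⟩

include hinj in
theorem sumOp_piece_last (hle : mu ≤ lam) {x : ⨂[ℝ]^r (Spacetime n)}
    (hx : x ∈ (piece M T hle).toSubmodule) :
    sumOp Finset.univ (unit (stBasis n) (Fin.last n) (Fin.last n)) x =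
      ((lam.card - mu.card : ℕ) : ℝ) • x := by
  rw [← sub_eq_zero]
  have hM := M.glStable (b := stBasis n) (n + 1)
  refine hinj _ (Submodule.sub_mem _ (hM _ _ (Fin.last n).2 (Fin.last n).2 x hx.1)
    (Submodule.smul_mem _ _ hx.1)) ?_
  obtain ⟨y, -, hy⟩ := hx.2
  rw [map_sub, map_smul, youngSymmetrizer_sumOp, ← hy, sumOp_branchMap_last, sub_self]
  rw [card_eq_of_tableau T]
  refine Nat.add_sub_cancel' ?_
  rw [← card_eq_of_tableau T]
  exact Finset.card_le_card hle

include hinj in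
theorem hw_piece (hbr : IsBranch n lam mu) {x : ⨂[ℝ]^r (Spacetime n)}
    (hx : x ∈ (piece M T hbr.le).toSubmodule)
    (h0 : x ≠ 0) {κ : Fin (n + 1) → ℕ} (hhw : x ∈ hw (stBasis n) n) (hκ : x ∈ wt (stBasis n) κ) :
    ∀ i : Fin n, κ i.castSucc = mu.rowLen i :=
  hw_branchRep T _ hbr hx.2 (fun h => h0 (hinj x hx.1 h))
    (map_mem_hw _ (youngSymmetrizer_sumOp T) hhw) (map_mem_wt _ (youngSymmetrizer_sumOp T) hκ)

include hinj in
theorem form_piece {nu : YoungDiagram} (hmu : IsBranch n lam mu) (hnu : IsBranch n lam nu)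
    (hne : mu ≠ nu) : ∀ x ∈ (piece M T hmu.le).toSubmodule, ∀ y ∈ (piece M T hnu.le).toSubmodule,
      form (stBasis n) x y = 0 := by
  refine GlStable.form_eq_zero _ le_rfl (piece_glStable M T hmu.le) (piece_glStable M T hnu.le) ?_
  intro κ x hx y hy hxhw hyhw hxκ hyκ hx0 hy0
  refine hne (eq_of_shapeWt_eq hmu.colLen_zero hnu.colLen_zero (funext fun i => ?_))
  exact (hw_piece M T hinj hmu hx hx0 hxhw hxκ i).symm.trans
    (hw_piece M T hinj hnu hy hy0 hyhw hyκ i)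

-- Otherwise the complement of `S` in `M` contains a `GL(n)` highest weight vector. Its
-- symmetrization has an interlacing weight, so by uniqueness it is a multiple of the highest weight
-- vector of a branch. The vector then lies in a piece, hence in `S`, and is orthogonal to itself.
include hinj in
theorem iSup_piece (hlam : lam.colLen 0 ≤ n + 1) (S : Submodule ℝ (⨂[ℝ]^r (Spacetime n)))
    (hS : GlStable (stBasis n) n S) (hSM : S ≤ M.toSubmodule)
    (hpiece : ∀ mu, ∀ h : IsBranch n lam mu, (piece M T h.le).toSubmodule ≤ S) :
    S = M.toSubmodule := by
  refine eq_of_inf_orthogonal_eq_bot (stBasis n) hSM ?_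
  by_contra hne
  obtain ⟨κ, x, ⟨hxM, hxS⟩, hx0, hhw, hκ⟩ :=
    ((M.glStable n).inf hS.orthogonal).exists_hw_vector (stBasis n) le_rfl hne
  set y := youngSymmetrizer (Spacetime n) T x with hy
  have hyr : y ∈ LinearMap.range (youngSymmetrizer (Spacetime n) T) := ⟨x, rfl⟩
  have hy0 : y ≠ 0 := fun h => hx0 (hinj x hxM h)
  have hyhw : y ∈ hw (stBasis n) n := map_mem_hw _ (youngSymmetrizer_sumOp T) hhw
  have hyκ : y ∈ wt (stBasis n) κ := map_mem_wt _ (youngSymmetrizer_sumOp T) hκ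
  obtain ⟨mu, hmu, hκmu⟩ := exists_isBranch hlam (fun j => κ j.castSucc)
    fun j => branch_bounds (stBasis n) T hlam hyr hy0 hyhw hyκ j
  set v := branchVec T mu.cells.equivFin hmu.le hmu.colLen_zero with hv
  have hv0 : v ≠ 0 := branchMap_rowWord_ne_zero hmu.le T _ hmu.colLen_zero hmu.colLen_le
  have hvκ : v ∈ wt (stBasis n) (branchWt n r mu) :=
    branchVec_mem_wt hmu.le T _ hmu.colLen_zero
  -- The spatial entries agree by the choice of `mu`; the time entries agree because both weights
  -- have total `r`.
  have hκ' : branchWt n r mu = κ := by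
    have h1 := sum_weight _ hvκ hv0
    have h2 := sum_weight _ hκ hx0
    have h3 : ∀ i : Fin n, branchWt n r mu i.castSucc = κ i.castSucc := by
      intro i
      rw [branchWt, Fin.snoc_castSucc]
      exact (hκmu i).symm
    rw [Fin.sum_univ_castSucc] at h1 h2
    simp only [h3] at h1
    ext i
    rcases Fin.eq_castSucc_or_eq_last i with ⟨i, rfl⟩ | rfl
    · exact h3 i
    · omega
  obtain ⟨c, hc⟩ := branch_unique (stBasis n) T hlam (branchVec_mem_range ..) hv0
    (branchVec_mem_hw hmu.le T _ hmu.colLen_zero) (hκ' ▸ hvκ) hyr hyhw hyκ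
  have hxp : x ∈ (piece M T hmu.le).toSubmodule := by
    refine ⟨hxM, ?_⟩
    have h1 : y ∈ (branchRep T mu.cells.equivFin hmu.le).toSubmodule := by
      rw [hc]
      exact Submodule.smul_mem _ _ (branchVec_mem ..)
    exact h1
  exact hx0 (eq_zero_of_form_self _ ((mem_orthogonal _).1 hxS x (hpiece mu hmu hxp)))

end Decomposition

end

end TensorSignature

namespace TensorSignature

noncomputable section

open Module

/-! ### Signatures from definite subspaces -/

section Signature

variable {E : Type*} [AddCommGroup E] [Module ℝ E] [FiniteDimensional ℝ E]

/-- The dimension of `P` bounds the positive index from below, and the dimension of the space minus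
that of `N` bounds it from above. Since the two subspaces span, the bounds meet. -/
theorem sigPos_eq_of_sup_eq_top (Q : QuadraticForm ℝ E) (P N : Submodule ℝ E)
    (hP : ∀ x ∈ P, x ≠ 0 → 0 < Q x) (hN : ∀ x ∈ N, Q x ≤ 0) (hsup : P ⊔ N = ⊤) :
    sigPos Q = finrank ℝ P := by
  have h1 : finrank ℝ P ≤ sigPos Q :=
    le_sigPos_of_posDef Q fun x hx => hP x x.2 fun h => hx (Subtype.ext h)
  have h2 := QuadraticForm.sigPos_add_finrank_le_of_nonpos hN
  have h3 := Submodule.finrank_add_le_finrank_add_finrank P N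
  rw [hsup, finrank_top] at h3
  omega

theorem sigNeg_eq_of_sup_eq_top (Q : QuadraticForm ℝ E) (P N : Submodule ℝ E)
    (hP : ∀ x ∈ P, 0 ≤ Q x) (hN : ∀ x ∈ N, x ≠ 0 → Q x < 0) (hsup : P ⊔ N = ⊤) :
    sigNeg Q = finrank ℝ N := by
  rw [← sigPos_neg]
  refine sigPos_eq_of_sup_eq_top (-Q) N P (fun x hx h0 => ?_) (fun x hx => ?_)
    (by rw [sup_comm, hsup])
  · simpa using hN x hx h0
  · simpa using hP x hx

theorem sig_restrict_eq (Q : QuadraticForm ℝ E) (S P N : Submodule ℝ E) (hsup : P ⊔ N = S)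
    (hP : ∀ x ∈ P, x ≠ 0 → 0 < Q x) (hN : ∀ x ∈ N, x ≠ 0 → Q x < 0) :
    sigPos (Q.restrict S) = finrank ℝ P ∧ sigNeg (Q.restrict S) = finrank ℝ N := by
  have hPS : P ≤ S := hsup ▸ le_sup_left
  have hNS : N ≤ S := hsup ▸ le_sup_right
  have hsup' : P.comap S.subtype ⊔ N.comap S.subtype = ⊤ := by
    refine Submodule.map_injective_of_injective S.injective_subtype ?_
    rw [Submodule.map_sup, Submodule.map_comap_subtype, Submodule.map_comap_subtype,
      inf_eq_right.2 hPS, inf_eq_right.2 hNS, hsup, Submodule.map_subtype_top]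
  have hp : ∀ x ∈ P.comap S.subtype, x ≠ 0 → 0 < Q.restrict S x :=
    fun x hx h0 => hP x hx fun h => h0 (Subtype.ext h)
  have hn : ∀ x ∈ N.comap S.subtype, x ≠ 0 → Q.restrict S x < 0 :=
    fun x hx h0 => hN x hx fun h => h0 (Subtype.ext h)
  rw [← (Submodule.comapSubtypeEquivOfLe hPS).finrank_eq,
    ← (Submodule.comapSubtypeEquivOfLe hNS).finrank_eq]
  constructor
  · refine sigPos_eq_of_sup_eq_top _ _ _ hp (fun x hx => ?_) hsup'
    by_cases h : x = 0
    · rw [h, map_zero]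
    · exact (hn x hx h).le
  · refine sigNeg_eq_of_sup_eq_top _ _ _ (fun x hx => ?_) hn hsup'
    by_cases h : x = 0
    · rw [h, map_zero]
    · exact (hp x hx h).le

end Signature

/-! ### The metric and time reversal -/

variable {n r : ℕ}

/-- The sign of a basis vector of spacetime. -/
def timeSign (i : Fin (n + 1)) : ℝ := if i = Fin.last n then -1 else 1

/-- The reversal of time. -/
def timeFlip (n : ℕ) : LinearMap.GeneralLinearGroup ℝ (Spacetime n) :=
  LinearMap.GeneralLinearGroup.ofLinearEquiv
    ((LinearEquiv.refl ℝ (Fin n → ℝ)).prodCongr (LinearEquiv.neg ℝ))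

theorem timeFlip_basis (i : Fin (n + 1)) :
    (timeFlip n : Module.End ℝ (Spacetime n)) (stBasis n i) = timeSign i • stBasis n i := by
  rcases Fin.eq_castSucc_or_eq_last i with ⟨i, rfl⟩ | rfl
  · rw [timeSign, if_neg (Fin.castSucc_lt_last i).ne, one_smul, stBasis_castSucc]
    exact Prod.ext rfl neg_zero
  · rw [timeSign, if_pos rfl, stBasis_last]
    refine Prod.ext ?_ ?_ <;> simp [timeFlip]

/-- The sign of a word in the basis of spacetime. -/
def wordSign (w : Fin r → Fin (n + 1)) : ℝ := ∏ k, timeSign (w k)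

theorem wordSign_eq (w : Fin r → Fin (n + 1)) : wordSign w = (-1) ^ content w (Fin.last n) := by
  simp only [wordSign, timeSign, content]
  rw [Finset.prod_ite]
  simp

theorem coords_timeFlip (x : ⨂[ℝ]^r (Spacetime n)) (w : Fin r → Fin (n + 1)) :
    coords (stBasis n) (tensorRep _ r (timeFlip n) x) w = wordSign w * coords (stBasis n) x w := by
  have : tensorRep _ r (timeFlip n) = (coords (stBasis n)).symm.toLinearMap ∘ₗ
      LinearMap.pi (fun w => wordSign w • LinearMap.proj w) ∘ₗ
      (coords (r := r) (stBasis n)).toLinearMap := by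
    refine word_hom_ext (stBasis n) fun w => ?_
    have h1 : tensorRep _ r (timeFlip n) (word (stBasis n) w) =
        wordSign w • word (stBasis n) w := by
      change PiTensorProduct.map (fun _ => (timeFlip n : Module.End ℝ (Spacetime n)))
        (PiTensorProduct.tprod ℝ fun k => stBasis n (w k)) = _
      rw [PiTensorProduct.map_tprod]
      simp only [timeFlip_basis]
      rw [MultilinearMap.map_smul_univ]
      rfl
    rw [h1]
    refine coords_ext (stBasis n) fun u => ?_
    simp only [LinearMap.comp_apply, LinearEquiv.coe_coe, LinearEquiv.apply_symm_apply,
      LinearMap.pi_apply, LinearMap.smul_apply, LinearMap.proj_apply, smul_eq_mul, map_smul,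
      Pi.smul_apply, coords_word]
    split_ifs with h
    · rw [h]
    · simp
  rw [this]
  simp only [LinearMap.comp_apply, LinearEquiv.coe_coe, LinearEquiv.apply_symm_apply,
      LinearMap.pi_apply, LinearMap.smul_apply, LinearMap.proj_apply, smul_eq_mul]

theorem wordSign_mul_self (w : Fin r → Fin (n + 1)) : wordSign w * wordSign w = 1 := by
  rw [wordSign_eq, ← mul_pow]; simp

theorem eta_basis (i j : Fin (n + 1)) :
    eta n (stBasis n i) (stBasis n j) = if i = j then timeSign i else 0 := by
  rcases Fin.eq_castSucc_or_eq_last i with ⟨i, rfl⟩ | rfl <;>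
  rcases Fin.eq_castSucc_or_eq_last j with ⟨j, rfl⟩ | rfl <;>
  simp [stBasis_castSucc, stBasis_last, eta, timeSign, Pi.single_apply, eq_comm,
    (Fin.castSucc_lt_last _).ne]

theorem tensorMetric_apply (x y : ⨂[ℝ]^r (Spacetime n)) :
    tensorMetric n r x y = ∑ w, wordSign w * (coords (stBasis n) x w * coords (stBasis n) y w) := by
  have h1 : ∀ w u : Fin r → Fin (n + 1),
      tensorMetric n r (word (stBasis n) w) (word (stBasis n) u) =
        if w = u then wordSign w else 0 := by
    intro w u
    rw [word, word, tensorMetric_tprod]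
    simp only [eta_basis]
    rw [Fintype.prod_ite_zero]
    simp only [← funext_iff]
    rfl
  conv_lhs => rw [← sum_coords_smul_word (stBasis n) x, ← sum_coords_smul_word (stBasis n) y]
  rw [map_sum (tensorMetric n r), LinearMap.sum_apply]
  refine Finset.sum_congr rfl fun w _ => ?_
  rw [map_sum, Finset.sum_eq_single w]
  · rw [map_smul, map_smul, LinearMap.smul_apply, h1, if_pos rfl, smul_eq_mul, smul_eq_mul]
    ring
  · intro u _ hu
    rw [map_smul, map_smul, LinearMap.smul_apply, h1, if_neg (Ne.symm hu), smul_zero, smul_zero]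
  · simp

/-- This reduces the indefinite metric to the positive definite product and an element of the group.
-/
theorem tensorMetric_eq_form (x y : ⨂[ℝ]^r (Spacetime n)) :
    tensorMetric n r x y = form (stBasis n) (tensorRep _ r (timeFlip n) x) y := by
  rw [tensorMetric_apply, form_apply]
  refine Finset.sum_congr rfl fun w _ => ?_
  rw [coords_timeFlip, mul_assoc]

theorem tensorMetric_comm (x y : ⨂[ℝ]^r (Spacetime n)) :
    tensorMetric n r x y = tensorMetric n r y x := by
  simp only [tensorMetric_apply, mul_comm (coords _ x _)]

/-- The diagonal time operator counts time indices, so all words of `x` contain exactly `k` of them.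
-/
theorem timeFlip_of_sumOp {k : ℕ} {x : ⨂[ℝ]^r (Spacetime n)}
    (hx : sumOp Finset.univ (unit (stBasis n) (Fin.last n) (Fin.last n)) x = (k : ℝ) • x) :
    tensorRep _ r (timeFlip n) x = (-1 : ℝ) ^ k • x := by
  refine coords_ext (stBasis n) fun w => ?_
  rw [coords_timeFlip, map_smul, Pi.smul_apply, smul_eq_mul]
  by_cases h0 : coords (stBasis n) x w = 0
  · rw [h0, mul_zero, mul_zero]
  have h1 := coords_diag (stBasis n) (Fin.last n) x w
  rw [hx, map_smul, Pi.smul_apply, smul_eq_mul] at h1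
  have h2 : k = content w (Fin.last n) := by exact_mod_cast mul_right_cancel₀ h0 h1
  rw [wordSign_eq, h2]

/-- For nonzero `x`, the metric product of `x` with its time reversal, which stays in `M`, is the
squared Euclidean length of the time reversal and hence positive. -/
theorem restrict_nondegenerate (M : Submodule ℝ (⨂[ℝ]^r (Spacetime n)))
    (hM : ∀ x ∈ M, tensorRep _ r (timeFlip n) x ∈ M) :
    ((tensorMetric n r).restrict M).Nondegenerate := by
  have h1 : ∀ x ∈ M, (∀ y ∈ M, tensorMetric n r x y = 0) → x = 0 := by
    intro x hx h
    have h2 := h _ (hM x hx)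
    rw [tensorMetric_eq_form] at h2
    have h3 := eq_zero_of_form_self _ h2
    refine coords_ext (stBasis n) fun w => ?_
    have h4 := congrArg (fun z => wordSign w * coords (stBasis n) z w) h3
    simp only [coords_timeFlip, ← mul_assoc, wordSign_mul_self, one_mul, map_zero, Pi.zero_apply,
      mul_zero] at h4
    rw [h4, map_zero, Pi.zero_apply]
  constructor
  · intro x hx
    exact Subtype.ext (h1 x x.2 fun y hy => hx ⟨y, hy⟩)
  · intro x hx
    exact Subtype.ext (h1 x x.2 fun y hy => (tensorMetric_comm _ _).trans (hx ⟨y, hy⟩))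

theorem tensorMetric_nondegenerate : (tensorMetric n r).Nondegenerate := by
  have h := restrict_nondegenerate (n := n) (r := r) ⊤ fun _ _ => trivial
  exact ⟨fun x hx => congrArg Subtype.val (h.1 ⟨x, trivial⟩ fun y => hx y),
    fun x hx => congrArg Subtype.val (h.2 ⟨x, trivial⟩ fun y => hx y)⟩

theorem tensorNorm_apply (x : ⨂[ℝ]^r (Spacetime n)) :
    tensorNorm n r x = tensorMetric n r x x := rfl

theorem tensorNorm_of_timeFlip {c : ℝ} {x : ⨂[ℝ]^r (Spacetime n)}
    (hx : tensorRep _ r (timeFlip n) x = c • x) : tensorNorm n r x = c * form (stBasis n) x x := by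
  rw [tensorNorm_apply, tensorMetric_eq_form, hx, map_smul, LinearMap.smul_apply, smul_eq_mul]

theorem signature_eq (S P N : Submodule ℝ (⨂[ℝ]^r (Spacetime n))) (hsup : P ⊔ N = S)
    (hP : ∀ x ∈ P, tensorRep _ r (timeFlip n) x = (1 : ℝ) • x)
    (hN : ∀ x ∈ N, tensorRep _ r (timeFlip n) x = (-1 : ℝ) • x) :
    signature n r S = (finrank ℝ P, finrank ℝ N) := by
  have := finite_of_basis (r := r) (stBasis n)
  have h := sig_restrict_eq (tensorNorm n r) S P N hsup (fun x hx h0 => by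
    rw [tensorNorm_of_timeFlip (hP x hx), one_mul]
    exact form_self_pos _ h0) (fun x hx h0 => by
    rw [tensorNorm_of_timeFlip (hN x hx), neg_one_mul]
    exact neg_lt_zero.2 (form_self_pos _ h0))
  exact Prod.ext h.1 h.2

theorem tensorNorm_equivalent : QuadraticMap.Equivalent (tensorNorm n r)
    (QuadraticMap.weightedSumSquares ℝ fun w : Fin r → Fin (n + 1) => wordSign w) :=
  ⟨{ coords (stBasis n) with
      map_app' := by
        intro x
        change QuadraticMap.weightedSumSquares ℝ _ (coords (stBasis n) x) = _
        rw [QuadraticMap.weightedSumSquares_apply, tensorNorm_apply, tensorMetric_apply]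
        rfl }⟩

theorem sum_wordSign : ∑ w : Fin r → Fin (n + 1), wordSign w = ((n : ℝ) - 1) ^ r := by
  have : ∑ i : Fin (n + 1), timeSign i = (n : ℝ) - 1 := by
    rw [Fin.sum_univ_castSucc]
    simp [timeSign, (Fin.castSucc_lt_last _).ne, sub_eq_add_neg]
  rw [← this, Fintype.sum_pow]
  rfl

theorem wordSign_eq_one_or (w : Fin r → Fin (n + 1)) : wordSign w = 1 ∨ wordSign w = -1 :=
  mul_self_eq_one_iff.1 (wordSign_mul_self w)

/-- Words diagonalize the norm with signs as coefficients. Summing `1 + sign` counts the positive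
words twice, and the signs add up to the `r`-th power of the trace `n - 1`. -/
theorem two_mul_sigPos : 2 * (sigPos (tensorNorm n r) : ℤ) =
    ((n : ℤ) + 1) ^ r + ((n : ℤ) + 1 - 2) ^ r := by
  classical
  rw [QuadraticForm.sigPos_of_equiv_weightedSumSquares tensorNorm_equivalent,
    Set.ncard_eq_toFinset_card', Set.toFinset_ofPred]
  have h : ∑ w : Fin r → Fin (n + 1), (1 + wordSign w) =
      ∑ w : Fin r → Fin (n + 1), if 0 < wordSign w then (2 : ℝ) else 0 := by
    refine Finset.sum_congr rfl fun w _ => ?_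
    rcases wordSign_eq_one_or w with h | h <;> rw [h] <;> norm_num
  rw [Finset.sum_add_distrib, sum_wordSign, ← Finset.sum_filter, Finset.sum_const,
    Finset.sum_const] at h
  have h' : ((2 * ((Finset.univ.filter fun w : Fin r → Fin (n + 1) => 0 < wordSign w).card : ℤ) :
      ℤ) : ℝ) = (((n : ℤ) + 1) ^ r + ((n : ℤ) + 1 - 2) ^ r : ℤ) := by
    push_cast
    rw [nsmul_eq_mul, nsmul_eq_mul] at h
    rw [mul_comm, ← h]
    simp
    ring
  exact_mod_cast h'

theorem two_mul_sigNeg : 2 * (sigNeg (tensorNorm n r) : ℤ) =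
    ((n : ℤ) + 1) ^ r - ((n : ℤ) + 1 - 2) ^ r := by
  classical
  rw [QuadraticForm.sigNeg_of_equiv_weightedSumSquares tensorNorm_equivalent,
    Set.ncard_eq_toFinset_card', Set.toFinset_ofPred]
  have h : ∑ w : Fin r → Fin (n + 1), (1 - wordSign w) =
      ∑ w : Fin r → Fin (n + 1), if wordSign w < 0 then (2 : ℝ) else 0 := by
    refine Finset.sum_congr rfl fun w _ => ?_
    rcases wordSign_eq_one_or w with h | h <;> rw [h] <;> norm_num
  rw [Finset.sum_sub_distrib, sum_wordSign, ← Finset.sum_filter, Finset.sum_const,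
    Finset.sum_const] at h
  have h' : ((2 * ((Finset.univ.filter fun w : Fin r → Fin (n + 1) => wordSign w < 0).card : ℤ) :
      ℤ) : ℝ) = (((n : ℤ) + 1) ^ r - ((n : ℤ) + 1 - 2) ^ r : ℤ) := by
    push_cast
    rw [nsmul_eq_mul, nsmul_eq_mul] at h
    rw [mul_comm, ← h]
    simp
    ring
  exact_mod_cast h'

end

end TensorSignature

namespace TensorSignature

noncomputable section

open Module

/-! ### Sums of orthogonal families -/

section OrthogonalFamilies

variable {V ι : Type*} [AddCommGroup V] [Module ℝ V] {r d : ℕ} (b : Basis (Fin d) ℝ V)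
  (W : ι → Submodule ℝ (⨂[ℝ]^r V))

theorem disjoint_biSup_of_form {s : Set ι} {i : ι}
    (h : ∀ j ∈ s, ∀ x ∈ W i, ∀ y ∈ W j, form b x y = 0) : Disjoint (W i) (⨆ j ∈ s, W j) := by
  rw [Submodule.disjoint_def]
  intro x hx hx'
  have hle : ⨆ j ∈ s, W j ≤ (form b).orthogonal (W i) :=
    iSup₂_le fun j hj y hy => (mem_orthogonal b).2 fun x hx => h j hj x hx y hy
  exact eq_zero_of_form_self b ((mem_orthogonal b).1 (hle hx') x hx)

theorem finrank_biSup_of_form (s : Finset ι)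
    (h : ∀ i ∈ s, ∀ j ∈ s, i ≠ j → ∀ x ∈ W i, ∀ y ∈ W j, form b x y = 0) :
    finrank ℝ (⨆ i ∈ s, W i : Submodule ℝ (⨂[ℝ]^r V)) = ∑ i ∈ s, finrank ℝ (W i) := by
  classical
  have := finite_of_basis (r := r) b
  induction s using Finset.induction_on with
  | empty => simp
  | insert i s hi ih =>
    rw [Finset.sum_insert hi, Finset.iSup_insert, ← ih fun j hj k hk => h j
      (Finset.mem_insert_of_mem hj) k (Finset.mem_insert_of_mem hk)]
    have hd : Disjoint (W i) (⨆ j ∈ s, W j) := disjoint_biSup_of_form b W (s := {j | j ∈ s})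
      fun j hj => h i (Finset.mem_insert_self i s) j (Finset.mem_insert_of_mem hj) (by
        rintro rfl
        exact hi hj)
    have h1 := Submodule.finrank_sup_add_finrank_inf_eq (W i) (⨆ j ∈ s, W j)
    rw [hd.eq_bot, finrank_bot, add_zero] at h1
    exact h1

end OrthogonalFamilies

/-! ### The family of pieces and the signature -/

variable {n r : ℕ} {lam : YoungDiagram}

/-- The dimension of the `GL(n)`-irreducible space of a given type. -/
def dimYoung (n : ℕ) (mu : YoungDiagram) : ℕ :=
  finrank ℝ (youngSubrep (Fin n → ℝ) mu.cells.equivFin).toSubmodule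

section

variable (M : Subrepresentation (tensorRep (Spacetime n) r)) (T : lam.cells ≃ Fin r)

open Classical in
/-- The pieces of an invariant space. -/
def pieces (mu : YoungDiagram) : Subrepresentation (spatialRep n r) :=
  -- Diagrams that are not branches get the zero space, so that the family is indexed by all
  -- diagrams.
  if h : IsBranch n lam mu then piece M T h.le else ⊥

theorem mem_branches {mu : YoungDiagram} : mu ∈ branches n lam ↔ IsBranch n lam mu := by
  simp [branches]

theorem pieces_eq {mu : YoungDiagram} (h : IsBranch n lam mu) :
    pieces M T mu = piece M T h.le := dif_pos h

variable (hinj : ∀ x ∈ M.toSubmodule, youngSymmetrizer (Spacetime n) T x = 0 → x = 0)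
  (hmap : M.toSubmodule.map (youngSymmetrizer (Spacetime n) T) =
    LinearMap.range (youngSymmetrizer (Spacetime n) T))

include hinj in
theorem form_pieces {mu nu : YoungDiagram} (hmu : mu ∈ branches n lam) (hnu : nu ∈ branches n lam)
    (hne : mu ≠ nu) : ∀ x ∈ (pieces M T mu).toSubmodule, ∀ y ∈ (pieces M T nu).toSubmodule,
      form (stBasis n) x y = 0 := by
  rw [mem_branches] at hmu hnu
  rw [pieces_eq M T hmu, pieces_eq M T hnu]
  exact form_piece M T hinj hmu hnu hne

include hinj hmap in
theorem finrank_pieces {mu : YoungDiagram} (hmu : mu ∈ branches n lam) :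
    finrank ℝ (pieces M T mu).toSubmodule = dimYoung n mu := by
  rw [mem_branches] at hmu
  rw [pieces_eq M T hmu]
  obtain ⟨e⟩ := nonempty_piece_equiv M T hinj hmap hmu
  exact e.toLinearEquiv.finrank_eq

include hinj in
theorem timeFlip_pieces {mu : YoungDiagram} (hmu : mu ∈ branches n lam)
    {x : ⨂[ℝ]^r (Spacetime n)} (hx : x ∈ (pieces M T mu).toSubmodule) :
    tensorRep _ r (timeFlip n) x = (-1 : ℝ) ^ (lam.card - mu.card) • x := by
  rw [mem_branches] at hmu
  rw [pieces_eq M T hmu] at hx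
  exact timeFlip_of_sumOp (sumOp_piece_last M T hinj hmu.le hx)

include hinj in
theorem biSup_pieces (hlam : lam.colLen 0 ≤ n + 1) :
    ⨆ mu ∈ branches n lam, (pieces M T mu).toSubmodule = M.toSubmodule := by
  refine iSup_piece M T hinj hlam _ ?_ ?_ ?_
  · intro i j hi hj
    have : (⨆ mu ∈ branches n lam, (pieces M T mu).toSubmodule) ≤
        (⨆ mu ∈ branches n lam, (pieces M T mu).toSubmodule).comap
          (sumOp Finset.univ (unit (stBasis n) i j)) := by
      refine iSup₂_le fun mu hmu x hx => ?_
      refine Submodule.mem_comap.2 (le_iSup₂ (f := fun mu (_ : mu ∈ branches n lam) =>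
        (pieces M T mu).toSubmodule) mu hmu ?_)
      have h := pieces_eq M T (mem_branches.1 hmu)
      rw [h] at hx ⊢
      exact piece_glStable M T _ i j hi hj x hx
    exact this
  · refine iSup₂_le fun mu hmu => ?_
    rw [pieces_eq M T (mem_branches.1 hmu)]
    exact piece_le M T _
  · intro mu hmu
    have h := le_iSup₂ (f := fun mu (_ : mu ∈ branches n lam) =>
        (pieces M T mu).toSubmodule) mu (mem_branches.2 hmu)
    rwa [pieces_eq M T hmu] at h

-- Pieces of even and of odd parity span subspaces on which time reversal is `1` and `-1`. There the
-- norm is plus or minus the Euclidean one, so these are complementary definite subspaces.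
include hinj in
theorem signature_eq_sum (hlam : lam.colLen 0 ≤ n + 1) :
    signature n r M.toSubmodule =
      (∑ mu ∈ branches n lam with Even (lam.card - mu.card),
        finrank ℝ (pieces M T mu).toSubmodule,
       ∑ mu ∈ branches n lam with Odd (lam.card - mu.card),
        finrank ℝ (pieces M T mu).toSubmodule) := by
  have horth : ∀ p : YoungDiagram → Prop, ∀ _ : DecidablePred p,
      ∀ mu ∈ (branches n lam).filter p, ∀ nu ∈ (branches n lam).filter p, mu ≠ nu →
      ∀ x ∈ (pieces M T mu).toSubmodule, ∀ y ∈ (pieces M T nu).toSubmodule,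
      form (stBasis n) x y = 0 := fun p _ mu hmu nu hnu =>
    form_pieces M T hinj (Finset.mem_filter.1 hmu).1 (Finset.mem_filter.1 hnu).1
  rw [← finrank_biSup_of_form (stBasis n) (fun mu => (pieces M T mu).toSubmodule) _
      (horth (fun mu => Even (lam.card - mu.card)) inferInstance),
    ← finrank_biSup_of_form (stBasis n) (fun mu => (pieces M T mu).toSubmodule) _
      (horth (fun mu => Odd (lam.card - mu.card)) inferInstance)]
  have heig : ∀ (p : YoungDiagram → Prop) (_ : DecidablePred p) (c : ℝ),
      (∀ mu, p mu → (-1 : ℝ) ^ (lam.card - mu.card) = c) →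
      ∀ x ∈ ⨆ mu ∈ (branches n lam).filter p, (pieces M T mu).toSubmodule,
        tensorRep _ r (timeFlip n) x = c • x := by
    intro p _ c hc
    have hle : (⨆ mu ∈ (branches n lam).filter p, (pieces M T mu).toSubmodule) ≤
        Module.End.eigenspace (tensorRep _ r (timeFlip n)) c := by
      refine iSup₂_le fun mu hmu x hx => ?_
      obtain ⟨h1, h2⟩ := Finset.mem_filter.1 hmu
      rw [Module.End.mem_eigenspace_iff, timeFlip_pieces M T hinj h1 hx, hc mu h2]
    exact fun x hx => Module.End.mem_eigenspace_iff.1 (hle hx)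
  refine signature_eq _ _ _ ?_ (heig _ _ _ fun mu h => h.neg_one_pow)
    (heig _ _ _ fun mu h => h.neg_one_pow)
  rw [← biSup_pieces M T hinj hlam]
  refine le_antisymm (sup_le ?_ ?_) (iSup₂_le fun mu h => ?_)
  · exact biSup_mono fun mu h => (Finset.mem_filter.1 h).1
  · exact biSup_mono fun mu h => (Finset.mem_filter.1 h).1
  · rcases Nat.even_or_odd (lam.card - mu.card) with h' | h'
    · exact le_sup_of_le_left (le_iSup₂ (f := fun mu (_ : mu ∈ (branches n lam).filter fun mu =>
        Even (lam.card - mu.card)) => (pieces M T mu).toSubmodule) mu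
        (Finset.mem_filter.2 ⟨h, h'⟩))
    · exact le_sup_of_le_right (le_iSup₂ (f := fun mu (_ : mu ∈ (branches n lam).filter fun mu =>
        Odd (lam.card - mu.card)) => (pieces M T mu).toSubmodule) mu
        (Finset.mem_filter.2 ⟨h, h'⟩))

include hinj hmap in
theorem finrank_eq_sum (hlam : lam.colLen 0 ≤ n + 1) :
    finrank ℝ M.toSubmodule = ∑ mu ∈ branches n lam, dimYoung n mu := by
  rw [← biSup_pieces M T hinj hlam, finrank_biSup_of_form (stBasis n)
    (fun mu => (pieces M T mu).toSubmodule) _ fun mu hmu nu hnu => form_pieces M T hinj hmu hnu]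
  exact Finset.sum_congr rfl fun mu hmu => finrank_pieces M T hinj hmap hmu

end

/-! ### Uniqueness of the type -/

section Unique

variable {V : Type*} [AddCommGroup V] [Module ℝ V] {d : ℕ}

theorem HasShape.card_eq (b : Basis (Fin d) ℝ V) {M : Subrepresentation (tensorRep V r)}
    (hM : M.toRepresentation.IsIrreducible) (h : HasShape M.toRepresentation lam) :
    lam.card = r ∧ lam.colLen 0 ≤ d := by
  obtain ⟨κ, x, hx, hx0, hhw, hκ⟩ := (M.glStable (b := b) d).exists_hw_vector b (Nat.le_succ d)
    ((isIrreducible_iff M).1 hM).1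
  exact ⟨(h.shapeWt_eq hx hx0 hhw hκ).1, (h.shapeWt_eq hx hx0 hhw hκ).2.1⟩

theorem HasShape.unique (b : Basis (Fin d) ℝ V) {M : Subrepresentation (tensorRep V r)}
    (hM : M.toRepresentation.IsIrreducible) {lam' : YoungDiagram}
    (h : HasShape M.toRepresentation lam) (h' : HasShape M.toRepresentation lam') : lam = lam' := by
  obtain ⟨κ, x, hx, hx0, hhw, hκ⟩ := (M.glStable (b := b) d).exists_hw_vector b (Nat.le_succ d)
    ((isIrreducible_iff M).1 hM).1
  obtain ⟨-, h1, h2⟩ := h.shapeWt_eq hx hx0 hhw hκ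
  obtain ⟨-, h3, h4⟩ := h'.shapeWt_eq hx hx0 hhw hκ
  exact eq_of_shapeWt_eq h1 h3 (h2.trans h4.symm)

/-- An irreducible space of a given type is identified by some Young symmetrizer of that type. -/
theorem HasShape.exists_youngSymmetrizer (b : Basis (Fin d) ℝ V)
    {M : Subrepresentation (tensorRep V r)}
    (hM : M.toRepresentation.IsIrreducible) (h : HasShape M.toRepresentation lam) :
    ∃ T : lam.cells ≃ Fin r, (∀ x ∈ M.toSubmodule, youngSymmetrizer V T x = 0 → x = 0) ∧
      M.toSubmodule.map (youngSymmetrizer V T) = LinearMap.range (youngSymmetrizer V T) := by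
  obtain ⟨lam', -, T, h1, h2⟩ := TensorSignature.exists_youngSymmetrizer b M hM
  obtain rfl := h.unique b hM (hasShape_of_map M T h1 h2)
  exact ⟨T, h1, h2⟩

end Unique

end

end TensorSignature

namespace TensorSignature

/-! ### Sums over branches and dimensions -/

section BranchSums

variable {n : ℕ} {lam mu : YoungDiagram}

theorem IsBranch.rowLen_bounds (h : IsBranch n lam mu) (i : ℕ) :
    mu.rowLen i ≤ lam.rowLen i ∧ lam.rowLen (i + 1) ≤ mu.rowLen i := by
  constructor
  · refine le_of_forall_lt fun k hk => ?_
    exact YoungDiagram.mem_iff_lt_rowLen.1 (h.le (YoungDiagram.mem_iff_lt_rowLen.2 hk))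
  · refine le_of_forall_lt fun k hk => ?_
    rw [← YoungDiagram.mem_iff_lt_rowLen, YoungDiagram.mem_iff_lt_colLen] at hk ⊢
    have := h.colLen_le k
    omega

/-- Branches correspond to interlacing integer sequences, which form a product of intervals; this
makes the sums computable. -/
theorem sum_branches (hlam : lam.colLen 0 ≤ n + 1) (F : (Fin n → ℕ) → ℕ) :
    ∑ mu ∈ branches n lam, F (shapeWt n mu) =
      ∑ ν ∈ Fintype.piFinset fun j : Fin n =>
        Finset.Icc (shapeWt (n + 1) lam j.succ) (shapeWt (n + 1) lam j.castSucc), F ν := by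
  refine Finset.sum_nbij (shapeWt n) ?_ ?_ ?_ fun _ _ => rfl
  · intro mu hmu
    rw [Fintype.mem_piFinset]
    intro j
    have h := (mem_branches.1 hmu).rowLen_bounds j
    exact Finset.mem_Icc.2 ⟨h.2, h.1⟩
  · intro mu hmu nu hnu h
    exact eq_of_shapeWt_eq (mem_branches.1 hmu).colLen_zero (mem_branches.1 hnu).colLen_zero h
  · intro ν hν
    rw [Finset.mem_coe, Fintype.mem_piFinset] at hν
    obtain ⟨mu, hmu, h⟩ := exists_isBranch hlam ν fun j =>
      (Finset.mem_Icc.1 (hν j)).symm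
    exact ⟨mu, mem_branches.2 hmu, (funext h).symm⟩

theorem sum_shapeWt (h : lam.colLen 0 ≤ n) : ∑ i, shapeWt n lam i = lam.card := by
  rw [← content_rowWord lam.cells.equivFin h]
  exact sum_content _

/-- The dimensions of the irreducible representations of `GL(n)` by their highest weights. -/
def dimRec : (n : ℕ) → (Fin n → ℕ) → ℕ
  | 0, _ => 1
  | n + 1, κ => ∑ ν ∈ Fintype.piFinset fun j : Fin n => Finset.Icc (κ j.succ) (κ j.castSucc),
      dimRec n ν

end BranchSums

noncomputable section

open Module

variable {V V' : Type*} [AddCommGroup V] [Module ℝ V] [AddCommGroup V'] [Module ℝ V']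
  {n r : ℕ} {lam : YoungDiagram}

theorem finrank_youngSubrep_congr (e : V ≃ₗ[ℝ] V') (T : lam.cells ≃ Fin r) :
    finrank ℝ (youngSubrep V T).toSubmodule = finrank ℝ (youngSubrep V' T).toSubmodule := by
  let E : (⨂[ℝ]^r V) ≃ₗ[ℝ] (⨂[ℝ]^r V') := PiTensorProduct.congr fun _ => e
  have h1 : ∀ σ x, E (permAct V σ x) = permAct V' σ (E x) := by
    intro σ x
    refine LinearMap.congr_fun (f := E.toLinearMap ∘ₗ permAct V σ)
      (g := permAct V' σ ∘ₗ E.toLinearMap) (PiTensorProduct.ext (MultilinearMap.ext fun v => ?_)) x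
    change E (permAct V σ (PiTensorProduct.tprod ℝ v)) =
      permAct V' σ (E (PiTensorProduct.tprod ℝ v))
    rw [permAct_tprod, PiTensorProduct.congr_tprod, PiTensorProduct.congr_tprod, permAct_tprod]
  have h2 : ∀ x, E (youngSymmetrizer V T x) = youngSymmetrizer V' T (E x) := by
    intro x
    rw [youngSymmetrizer, youngSymmetrizer, Module.End.mul_apply, Module.End.mul_apply]
    simp only [LinearMap.sum_apply, map_sum, LinearMap.smul_apply, map_smul, h1]
  have h3 : (youngSubrep V' T).toSubmodule = (youngSubrep V T).toSubmodule.map E.toLinearMap := by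
    refine le_antisymm ?_ ?_
    · rintro _ ⟨x, rfl⟩
      refine ⟨youngSymmetrizer V T (E.symm x), ⟨_, rfl⟩, ?_⟩
      rw [LinearEquiv.coe_coe, h2, LinearEquiv.apply_symm_apply]
    · rintro _ ⟨_, ⟨x, rfl⟩, rfl⟩
      exact ⟨E x, (h2 x).symm⟩
  rw [h3, LinearEquiv.finrank_map_eq]

/-- The image of the symmetrizer over `ℝ^(n+1)` is transported to spacetime, where the decomposition
into pieces applies. -/
theorem dimYoung_succ (h : lam.colLen 0 ≤ n + 1) :
    dimYoung (n + 1) lam = ∑ mu ∈ branches n lam, dimYoung n mu := by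
  have hirr := isIrreducible_youngSubrep (stBasis n) lam.cells.equivFin h
  have hshape : HasShape (youngSubrep (Spacetime n) lam.cells.equivFin).toRepresentation lam :=
    ⟨lam.cells.equivFin, ⟨Representation.Equiv.refl _⟩⟩
  obtain ⟨T, h1, h2⟩ := hshape.exists_youngSymmetrizer (stBasis n) hirr
  rw [← finrank_eq_sum _ T h1 h2 h]
  exact finrank_youngSubrep_congr ((spaceBasis (n + 1)).equiv (stBasis n) (Equiv.refl _)) _

/-- The image is nonzero and lies in a space of dimension `0 ^ lam.card`, which is at most 1. -/
theorem dimYoung_zero (h : lam.colLen 0 ≤ 0) : dimYoung 0 lam = 1 := by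
  have := finite_of_basis (r := lam.card) (spaceBasis 0)
  have h1 : dimYoung 0 lam ≠ 0 := by
    intro h0
    have h2 := Submodule.finrank_eq_zero.1 h0
    have h3 : youngSymmetrizer _ lam.cells.equivFin (word (spaceBasis 0)
        (rowWord lam.cells.equivFin h)) ∈
        (youngSubrep (Fin 0 → ℝ) lam.cells.equivFin).toSubmodule := ⟨_, rfl⟩
    rw [h2] at h3
    exact youngSymmetrizer_rowWord_ne_zero _ _ h h3
  have h2 : dimYoung 0 lam ≤ finrank ℝ (⨂[ℝ]^lam.card (Fin 0 → ℝ)) := Submodule.finrank_le _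
  rw [(coords (spaceBasis 0)).finrank_eq, finrank_fintype_fun_eq_card, Fintype.card_fun,
    Fintype.card_fin, Fintype.card_fin] at h2
  have h3 : 0 ^ lam.card ≤ 1 := by
    rcases Nat.eq_zero_or_pos lam.card with h | h
    · rw [h]; rfl
    · rw [zero_pow h.ne']; exact Nat.zero_le _
  omega

theorem dimYoung_eq_dimRec : ∀ (n : ℕ) (lam : YoungDiagram), lam.colLen 0 ≤ n →
    dimYoung n lam = dimRec n (shapeWt n lam)
  | 0, lam, h => dimYoung_zero h
  | n + 1, lam, h => by
    rw [dimYoung_succ h, dimRec, ← sum_branches h]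
    exact Finset.sum_congr rfl fun mu hmu =>
      dimYoung_eq_dimRec n mu (mem_branches.1 hmu).colLen_zero

theorem rowLens_eq_filter {d : ℕ} (h : lam.colLen 0 ≤ d) :
    lam.rowLens = (List.ofFn (shapeWt d lam)).filter (0 < ·) := by
  obtain ⟨k, rfl⟩ := Nat.exists_eq_add_of_le h
  have h1 : List.ofFn (shapeWt (lam.colLen 0 + k) lam) =
      (List.range (lam.colLen 0) ++ (List.range k).map (lam.colLen 0 + ·)).map lam.rowLen := by
    rw [← List.range_add]
    exact List.ext_getElem (by simp) fun i _ _ => by simp [shapeWt]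
  have hpos : ∀ i, 0 < lam.rowLen i ↔ i < lam.colLen 0 := fun i => by
    rw [← YoungDiagram.mem_iff_lt_rowLen, YoungDiagram.mem_iff_lt_colLen]
  rw [h1, List.map_append, List.filter_append, List.filter_eq_self.2, List.filter_eq_nil_iff.2,
    List.append_nil]
  · rfl
  · intro x hx
    simp only [List.mem_map, List.mem_range] at hx
    obtain ⟨_, ⟨j, -, rfl⟩, rfl⟩ := hx
    simp [hpos]
  · intro x hx
    simp only [List.mem_map, List.mem_range] at hx
    obtain ⟨i, hi, rfl⟩ := hx
    simpa [hpos] using hi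

/-! ### The table for dimension four -/

/-- The sum of the dimensions of the pieces with a given parity of the number of time indices. -/
def paritySum (n : ℕ) (κ : Fin (n + 1) → ℕ) (e : ℕ) : ℕ :=
  ∑ ν ∈ Fintype.piFinset fun j : Fin n => Finset.Icc (κ j.succ) (κ j.castSucc),
    if (∑ i, κ i - ∑ i, ν i) % 2 = e then dimRec n ν else 0

theorem sum_dimYoung_parity (h : lam.colLen 0 ≤ n + 1) (e : ℕ) :
    ∑ mu ∈ branches n lam with (lam.card - mu.card) % 2 = e, dimYoung n mu =
      paritySum n (shapeWt (n + 1) lam) e := by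
  rw [paritySum, ← sum_branches h fun ν =>
    if (∑ i, shapeWt (n + 1) lam i - ∑ i, ν i) % 2 = e then dimRec n ν else 0,
    Finset.sum_filter]
  refine Finset.sum_congr rfl fun mu hmu => ?_
  have h1 := (mem_branches.1 hmu).colLen_zero
  rw [sum_shapeWt h, sum_shapeWt h1, dimYoung_eq_dimRec n mu h1]

theorem signature_eq_paritySum {M : Subrepresentation (tensorRep (Spacetime n) r)}
    (hM : Representation.IsIrreducible (V := M.toSubmodule) M.toRepresentation)
    (h : HasShape M.toRepresentation lam) :
    signature n r M.toSubmodule =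
      (paritySum n (shapeWt (n + 1) lam) 0, paritySum n (shapeWt (n + 1) lam) 1) := by
  obtain ⟨T, h1, h2⟩ := h.exists_youngSymmetrizer (stBasis n) hM
  have hlam := (h.card_eq (stBasis n) hM).2
  rw [signature_eq_sum M T h1 hlam, ← sum_dimYoung_parity hlam, ← sum_dimYoung_parity hlam]
  refine Prod.ext ?_ ?_
  · simp only [Nat.even_iff]
    exact Finset.sum_congr rfl fun mu hmu =>
      finrank_pieces M T h1 h2 (Finset.mem_filter.1 hmu).1
  · simp only [Nat.odd_iff]
    exact Finset.sum_congr rfl fun mu hmu =>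
      finrank_pieces M T h1 h2 (Finset.mem_filter.1 hmu).1

theorem mem_generalTable {κ : Fin 4 → ℕ} (hκ : Antitone κ) (hr : ∑ i, κ i ≤ 5) :
    ((List.ofFn κ).filter (0 < ·), paritySum 3 κ 0, paritySum 3 κ 1) ∈ generalTable := by
  -- Decreasing lengths with total at most 5 satisfy `a ≤ 5`, `b ≤ 2`, `c ≤ 1` and `d ≤ 1`, so
  -- finitely many cases remain to be evaluated.
  have key : ∀ (a : Fin 6) (b : Fin 3) (c d : Fin 2),
      b.1 ≤ a ∧ c.1 ≤ b ∧ d.1 ≤ c ∧ a.1 + b + c + d ≤ 5 →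
      ((List.ofFn ![a.1, b.1, c.1, d.1]).filter (0 < ·), paritySum 3 ![a.1, b.1, c.1, d.1] 0,
        paritySum 3 ![a.1, b.1, c.1, d.1] 1) ∈ generalTable := by
    decide +kernel
  have h1 : κ 1 ≤ κ 0 := hκ (by decide)
  have h2 : κ 2 ≤ κ 1 := hκ (by decide)
  have h3 : κ 3 ≤ κ 2 := hκ (by decide)
  rw [Fin.sum_univ_four] at hr
  have h4 : κ = ![κ 0, κ 1, κ 2, κ 3] := by
    ext i
    fin_cases i <;> rfl
  rw [h4]
  exact key ⟨κ 0, by omega⟩ ⟨κ 1, by omega⟩ ⟨κ 2, by omega⟩ ⟨κ 3, by omega⟩ ⟨h1, h2, h3, hr⟩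

end

end TensorSignature
open TensorSignature in
theorem mainTheorem3 (n r : ℕ) :
    -- the space of all tensors of rank `r` in dimension `d = n + 1`
    ((TensorSignature.tensorMetric n r).Nondegenerate ∧
      2 * (sigPos (TensorSignature.tensorNorm n r) : ℤ) =
        ((n : ℤ) + 1) ^ r + ((n : ℤ) + 1 - 2) ^ r ∧
      2 * (sigNeg (TensorSignature.tensorNorm n r) : ℤ) =
        ((n : ℤ) + 1) ^ r - ((n : ℤ) + 1 - 2) ^ r) ∧
    -- every diagram with `r` boxes and at most `d` rows occurs as a symmetry type
    (∀ (lam : YoungDiagram) (T : lam.cells ≃ Fin r), lam.colLen 0 ≤ n + 1 →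
      (TensorSignature.youngSubrep
        (TensorSignature.Spacetime n) T).toRepresentation.IsIrreducible) ∧
    -- every irreducible `GL(d)`-invariant space `V` of tensors of rank `r`
    (∀ V : Subrepresentation
        (TensorSignature.tensorRep (TensorSignature.Spacetime n) r),
      V.toRepresentation.IsIrreducible →
      ((TensorSignature.tensorMetric n r).restrict V.toSubmodule).Nondegenerate ∧
      (∃! lam : YoungDiagram, TensorSignature.HasShape V.toRepresentation lam) ∧
      ∀ lam : YoungDiagram, TensorSignature.HasShape V.toRepresentation lam →
        lam.card = r ∧ lam.colLen 0 ≤ n + 1 ∧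
        (∃ W : YoungDiagram → Subrepresentation (TensorSignature.spatialRep n r),
          -- `V` is the direct sum of the pieces `W mu`
          iSupIndep (fun mu : TensorSignature.branches n lam => (W mu).toSubmodule) ∧
          (⨆ mu ∈ TensorSignature.branches n lam, (W mu).toSubmodule) = V.toSubmodule ∧
          -- which are irreducible under `GL(d - 1)`, of type `mu`, definite and orthogonal
          (∀ mu ∈ TensorSignature.branches n lam,
            Representation.IsIrreducible (V := (W mu).toSubmodule) (W mu).toRepresentation ∧
            TensorSignature.HasShape (W mu).toRepresentation mu ∧
            ∀ F ∈ W mu, F ≠ 0 →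
              0 < (-1 : ℝ) ^ (lam.card - mu.card) * TensorSignature.tensorNorm n r F) ∧
          (∀ mu ∈ TensorSignature.branches n lam, ∀ nu ∈ TensorSignature.branches n lam,
            mu ≠ nu → ∀ F ∈ W mu, ∀ G ∈ W nu, TensorSignature.tensorMetric n r F G = 0) ∧
          -- the signature of `V`
          (TensorSignature.signature n r V.toSubmodule).1 =
            ∑ mu ∈ TensorSignature.branches n lam with Even (lam.card - mu.card),
              Module.finrank ℝ (W mu).toSubmodule ∧
          (TensorSignature.signature n r V.toSubmodule).2 =
            ∑ mu ∈ TensorSignature.branches n lam with Odd (lam.card - mu.card),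
              Module.finrank ℝ (W mu).toSubmodule) ∧
        -- its values in dimension `4` for ranks up to `5`
        (n = 3 → r ≤ 5 →
          (lam.rowLens, TensorSignature.signature n r V.toSubmodule) ∈
              TensorSignature.generalTable)) := by
  refine ⟨⟨tensorMetric_nondegenerate, two_mul_sigPos, two_mul_sigNeg⟩,
    fun lam T h => isIrreducible_youngSubrep (stBasis n) T h, fun V hV => ⟨?_, ?_, ?_⟩⟩
  · exact restrict_nondegenerate V.toSubmodule fun x hx =>
      V.apply_mem_toSubmodule (timeFlip n) hx
  · obtain ⟨lam, _, T, h1, h2⟩ := exists_youngSymmetrizer (stBasis n) V hV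
    exact ⟨lam, hasShape_of_map V T h1 h2, fun lam' h' =>
      h'.unique (stBasis n) hV (hasShape_of_map V T h1 h2)⟩
  · intro lam h
    obtain ⟨hcard, hlam⟩ := h.card_eq (stBasis n) hV
    obtain ⟨T, h1, h2⟩ := h.exists_youngSymmetrizer (stBasis n) hV
    have hsig := signature_eq_sum V T h1 hlam
    have horth : ∀ mu ∈ branches n lam, ∀ nu ∈ branches n lam, mu ≠ nu →
        ∀ x ∈ (pieces V T mu).toSubmodule, ∀ y ∈ (pieces V T nu).toSubmodule,
        form (stBasis n) x y = 0 := fun mu hmu nu hnu => form_pieces V T h1 hmu hnu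
    refine ⟨hcard, hlam, ⟨pieces V T, ?_, biSup_pieces V T h1 hlam, ?_, ?_, ?_, ?_⟩, ?_⟩
    · intro mu
      refine disjoint_biSup_of_form (stBasis n)
        (fun mu : branches n lam => (pieces V T mu).toSubmodule) (s := {nu | nu ≠ mu}) ?_
      exact fun nu hne => horth mu mu.2 nu nu.2 fun h => hne (Subtype.ext h.symm)
    · intro mu hmu
      have hbr := mem_branches.1 hmu
      refine ⟨?_, ?_, fun F hF hF0 => ?_⟩
      · rw [pieces_eq V T hbr]
        exact piece_isIrreducible V T h1 h2 hbr
      · rw [pieces_eq V T hbr]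
        exact ⟨mu.cells.equivFin, nonempty_piece_equiv V T h1 h2 hbr⟩
      -- The norm on a piece is `(-1)^k` times the Euclidean one, with `k` the number of time
      -- indices, and the two signs cancel.
      · rw [tensorNorm_of_timeFlip (timeFlip_pieces V T h1 hmu hF), ← mul_assoc, ← mul_pow]
        simpa using form_self_pos (stBasis n) hF0
    · intro mu hmu nu hnu hne F hF G hG
      rw [tensorMetric_eq_form, timeFlip_pieces V T h1 hmu hF, map_smul, LinearMap.smul_apply,
        horth mu hmu nu hnu hne F hF G hG, smul_zero]
    · rw [hsig]
    · rw [hsig]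
    · rintro rfl hr
      rw [signature_eq_paritySum hV h, rowLens_eq_filter hlam]
      refine mem_generalTable (fun i j hij => lam.rowLen_anti _ _ hij) ?_
      rw [sum_shapeWt hlam, hcard]
      exact hr
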